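/- **Setup.** For each sample size $n$ let $p=p_n$ satisfy $\tau\le p/n\le 1/\tau$ for a fixed $\tau\in(0,1)$. Let $X_1,\dots,X_n$ be i.i.d. random vectors in $\mathbb{R}^p$ with $E[X_i]=0$ and $E[X_iX_i^\top]=\Sigma/n$, $\Sigma=\Sigma_n$ positive definite, and let $G_1,\dots,G_n$ be i.i.d. $N(0,\Sigma/n)$; write $\mathbf X,\mathbf G\in\mathbb{R}^{n\times p}$ for the matrices with these rows. Let $\xi=(\xi_1,\dots,\xi_n)$ be a (possibly random) noise vector that is independent of $\mathbf X$ and independent of $\mathbf G$. Let $\ell_0$ be one of the squared loss $\ell_0(u)=u^2$, the absolute loss $\ell_0(u)=|u|$, or the Huber loss $\ell_0(u)=\tfrac12u^2\mathbf 1\{|u|\le\eta\}+(\eta|u|-\tfrac12\eta^2)\mathbf 1\{|u|>\eta\}$ with a fixed $\eta>0$, and put $\ell_i(z)=\ell_0(z-\xi_i)$. For a convex function $R=R_n:\mathbb{R}^p\to\mathbb{R}$ set $$H_\ell(w,\mathbf Z)=\frac1n\sum_{i=1}^n\ell_i(Z_i^\top w)+R(w),\qquad w\in\mathbb{R}^p,\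 \mathbf Z\in\{\mathbf X,\mathbf G\}.$$ **Assumptions.** (a) *Losses.* There are $q_0,q_1,q_2,q_3\ge0$, $\bar\rho\in(0,1]$, measurable functions $\mathcal M_\ell,\mathcal D_\ell:(0,\bar\rho)\to[0,\infty)$ with $\mathcal M_\ell\le1\le\mathcal D_\ell$, none of them depending on $n$ or $\xi$, and numbers $L_{\ell_i}\ge1$ (which may depend on $n$ and $\xi$) such that $\sup_x|\ell_i(x)|/(1+|x|^{q_0})\le L_{\ell_i}$ for all $i$, and for every $\rho\in(0,\bar\rho)$ and $i$ there is $\ell_{i;\rho}\in C^3(\mathbb{R})$, $\ell_{i;\rho}\ge0$, with $\|\ell_{i;\rho}-\ell_i\|_\infty\le\mathcal M_\ell(\rho)$ and $\sup_x|\ell_{i;\rho}^{(k)}(x)|/(1+|\ell_{i;\rho}(x)|^{q_k})\le\mathcal D_\ell(\rho)$ for $k=1,2,3$. Put $\mathbf q=\max\{3q_1,q_1+q_2,q_3\}$ and $\bar{\mathbf q}_0=2\lceil q_0\mathbf q/2\rceil$. Suppose $\bar{\mathbf q}_0\le6$ and $\frac1n\sum_{i=1}^nL_{\ell_i}^{\mathbf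 q}=O(1)$ (bounded in probability if $\xi$ is random). (b) *Moments.* There is a constant $M<\infty$, independent of $n$, such that $\|\sqrt n\,X_{i,j}\|_{q^*}\le M$ for all $i,j$, where $q^*=2^{(\bar{\mathbf q}_0+4)/2}$ and $\|\cdot\|_{q}=E[|\cdot|^{q}]^{1/q}$, and $\lambda_{\max}(\Sigma)\le M$. (c) *Block dependence.* For $d=d_n$, the index set $\{1,\dots,p\}$ has a partition $B_1,\dots,B_k$ (with $k\le p$) into cells of at most $d$ elements, the same for all $i$, such that for each $i$ the subvectors $(X_{i,j})_{j\in B_1},\dots,(X_{i,j})_{j\in B_k}$ are mutually independent. **Statement.** Let $\kappa\ge0$, $\alpha\in[0,1/(2\bar{\mathbf q}_0+6)]$, $L_n\ge1$, $L_n=O(n^\alpha\log^\kappa n)$, and $$d=o\!\left(\frac{n^{1/4-(\bar{\mathbf q}_0+3)\alpha/2}}{\log^{6+(2\bar{\mathbf q}_0+6)\kappa}n}\right)\qquad(n\to\infty).$$ Then for any nonempty sets $\mathcal S_n\subset[-L_n,L_n]^p$ and any $g\in C^3(\mathbb{R})$ with $g,g',g'',g'''$ bounded, the expectations below exist and $$\Bigl|E\Bigl[g\bigl(\min_{w\in\mathcal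 S_n}H_\ell(w,\mathbf X)\bigr)\Bigr]-E\Bigl[g\bigl(\min_{w\in\mathcal S_n}H_\ell(w,\mathbf G)\bigr)\Bigr]\Bigr|\longrightarrow0\qquad(n,p\to\infty),$$ where $\min$ denotes the infimum when it is not attained. In particular, for $\alpha=0$ it suffices that $d=o(n^{1/4})$ up to the logarithmic factor $\log^{6+(2\bar{\mathbf q}_0+6)\kappa}n$ in the denominator. -/

import Mathlib

open MeasureTheory ProbabilityTheory Filter Topology Asymptotics
open scoped NNReal ENNReal

noncomputable section

/-- Squared loss, as a function of the residual. -/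
def squaredLoss (u : ℝ) : ℝ := u ^ 2

/-- Absolute loss, as a function of the residual. -/
def absoluteLoss (u : ℝ) : ℝ := |u|

/-- Huber loss with threshold `η`, as a function of the residual. -/
def huberLoss (η : ℝ) (u : ℝ) : ℝ :=
  if |u| ≤ η then u ^ 2 / 2 else η * |u| - η ^ 2 / 2

/-- The loss is the squared loss, the absolute loss, or a Huber loss. -/
def IsExampleLoss (ell0 : ℝ → ℝ) : Prop :=
  ell0 = squaredLoss ∨ ell0 = absoluteLoss ∨ ∃ η : ℝ, 0 < η ∧ ell0 = huberLoss η

/-- The individual losses `ℓ_i(z) = ℓ₀(z - ξ_i)` attached to a noise vector `ξ`. -/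
def noisyLoss (ell0 : ℝ → ℝ) {n : ℕ} (ξ : Fin n → ℝ) (i : Fin n) (z : ℝ) : ℝ :=
  ell0 (z - ξ i)

/-- The regularity assumption on a family of losses `ℓ i`, with exponents `q 0, q 1, q 2, q 3`,
growth constants `Lc i`, and accuracy / derivative-bound functions `Mℓ`, `Dℓ` on `(0, ρbar)`. -/
structure LossAssumption {ι : Type*} (ℓ : ι → ℝ → ℝ) (q : Fin 4 → ℝ) (Lc : ι → ℝ)
    (ρbar : ℝ) (Dℓ Mℓ : Set.Ioo (0 : ℝ) ρbar → ℝ) : Prop where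
  q_nonneg : ∀ k, 0 ≤ q k
  ρbar_pos : 0 < ρbar
  ρbar_le_one : ρbar ≤ 1
  one_le_Lc : ∀ i, 1 ≤ Lc i
  measurable_D : Measurable Dℓ
  measurable_M : Measurable Mℓ
  M_nonneg : ∀ ρ, 0 ≤ Mℓ ρ
  M_le_one : ∀ ρ, Mℓ ρ ≤ 1
  one_le_D : ∀ ρ, 1 ≤ Dℓ ρ
  growth : ∀ i x, |ℓ i x| / (1 + |x| ^ q 0) ≤ Lc i
  approx : ∃ ℓs : Set.Ioo (0 : ℝ) ρbar → ι → ℝ → ℝ, ∀ ρ i,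
    (∀ x, 0 ≤ ℓs ρ i x) ∧
    ContDiff ℝ 3 (ℓs ρ i) ∧
    (∀ x, |ℓs ρ i x - ℓ i x| ≤ Mℓ ρ) ∧
    ∀ k : Fin 4, k ≠ 0 → ∀ x,
      |iteratedDeriv (k : ℕ) (ℓs ρ i) x| / (1 + |ℓs ρ i x| ^ q k) ≤ Dℓ ρ

/-- `𝐪 = max {3 q₁, q₁ + q₂, q₃}`. -/
def qBold (q : Fin 4 → ℝ) : ℝ := max (3 * q 1) (max (q 1 + q 2) (q 3))

/-- `q̄₀ = 2 ⌈q₀ 𝐪 / 2⌉`, an even natural number. -/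
def qBar (q : Fin 4 → ℝ) : ℕ := 2 * ⌈q 0 * qBold q / 2⌉₊

/-- The moment order `q* = 2 ^ ((q̄₀ + 4) / 2)`; `q̄₀` is even, so the division is exact. -/
def qStar (q : Fin 4 → ℝ) : ℕ := 2 ^ ((qBar q + 4) / 2)

/-- `Av(a) = (1/n) ∑ a_i`. -/
def Av {n : ℕ} (a : Fin n → ℝ) : ℝ := (1 / (n : ℝ)) * ∑ i, a i

/-- A random vector is `d`-block dependent: its coordinates can be split into `k ≤ p` cells
(the fibres of `c`) with at most `d` elements each, so that the subvectors belonging to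
different cells are mutually independent. The cells are shared by all vectors `X i`. -/
def BlockDependent {Ω ι : Type*} [MeasurableSpace Ω] (P : Measure Ω) {p : ℕ} (d : ℕ)
    (X : Ω → ι → Fin p → ℝ) : Prop :=
  ∃ k : ℕ, k ≤ p ∧ ∃ c : Fin p → Fin k,
    (∀ b, (Finset.univ.filter (fun j => c j = b)).card ≤ d) ∧
    ∀ i, iIndepFun (fun (b : Fin k) (ω : Ω) (j : {j : Fin p // c j = b}) => X ω i j) P

/-- The rows of the random matrix `X` are i.i.d., centred, with
`E[X_i X_iᵀ] = Sig / n`. -/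
structure IsCovariateDesign {Ω : Type*} [MeasurableSpace Ω] (P : Measure Ω) {n p : ℕ}
    (Sig : Matrix (Fin p) (Fin p) ℝ) (X : Ω → Fin n → Fin p → ℝ) : Prop where
  measurable : Measurable X
  indep : iIndepFun (fun i ω => X ω i) P
  ident : ∀ i i', IdentDistrib (fun ω => X ω i) (fun ω => X ω i') P P
  mean : ∀ i j, Integrable (fun ω => X ω i j) P ∧ ∫ ω, X ω i j ∂P = 0
  second : ∀ i j j', Integrable (fun ω => X ω i j * X ω i j') P ∧
    ∫ ω, X ω i j * X ω i j' ∂P = Sig j j' / n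

/-- The rows of the random matrix `G` are i.i.d. with law `N(0, Sig / n)`. -/
structure IsGaussianDesign {Ω : Type*} [MeasurableSpace Ω] (P : Measure Ω) {n p : ℕ}
    (Sig : Matrix (Fin p) (Fin p) ℝ) (G : Ω → Fin n → Fin p → ℝ) : Prop where
  measurable : Measurable G
  indep : iIndepFun (fun i ω => G ω i) P
  law : ∀ i, P.map (fun ω => WithLp.toLp 2 (G ω i)) =
    multivariateGaussian 0 ((1 / (n : ℝ)) • Sig)

/-- `H_ℓ(w, x) = (1/n) ∑ ℓ_i(x_iᵀ w) + R(w)`. -/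
def empRisk {n p : ℕ} (ℓ : Fin n → ℝ → ℝ) (R : (Fin p → ℝ) → ℝ)
    (x : Fin n → Fin p → ℝ) (w : Fin p → ℝ) : ℝ :=
  Av (fun i => ℓ i (∑ j, x i j * w j)) + R w

/-- The minimal (infimal) value of the empirical risk over `S`. -/
def minRisk {n p : ℕ} (ℓ : Fin n → ℝ → ℝ) (R : (Fin p → ℝ) → ℝ)
    (S : Set (Fin p → ℝ)) (x : Fin n → Fin p → ℝ) : ℝ :=
  ⨅ w : S, empRisk ℓ R x w

end

/-! The minimal risk is replaced by a smooth function of the design, and the design is then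
exchanged in Lindeberg's manner, one cell of one row at a time.

Smooth surrogate. The cube is cut into cells of side `δ = n⁻³`, and the infimum becomes a soft
minimum at inverse temperature `β = n λ`, `λ = log² n`, over one point of `S` per occupied cell.
Each point is charged the infimum of `R` over its cell, so no modulus of continuity of `R` enters
(`exists_softmin_approx`). There are at most `exp (O(n log n))` cells, hence the entropy error
`log(#cells) / β` is `O(1 / log n)`; the mesh error is `n⁻³` times a quantity of smaller order. The
absolute and Huber losses are smoothed by three moving averages up to an error `ε`; the squared loss
is kept.

Exchange. The cells of a row of `X` are independent, hence uncorrelated, and so the cells of a row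
of `G` are independent too. Two corresponding cells have the same first two moments, so only the
third order remainder of `softmin_taylor` survives. With `Y = L ∑ |y j|` over the exchanged cell, it
is at most a constant times `λ² (Y³ / n) (1 + ⟨|ℓ_i'|³⟩)`, where `⟨·⟩` is a Gibbs average. For
Lipschitz losses the average is bounded. For the squared loss, `|ℓ_i'|³` is an increasing function
of `ℓ_i`, while the Gibbs density contains the factor `exp (-λ ℓ_i)`; by Chebyshev's association
inequality (`gibbs_sub_le_of_monovary`) deleting this factor only raises the average. What is left
is a Gibbs measure built from the other rows, independent of row `i`, so the fourth moment of the
row at each fixed weight suffices (`integral_gibbs_restRow_le`), without any supremum over the net.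
The parameter `s` separates the two cases: it is `0` for Lipschitz losses, and everything beyond
third moments is asked only if `s ≠ 0`.

Counting. The third moment of `Y` is of order `L³ d² |cell| n^(-3/2)`, and cell sizes add up to `p =
O(n)`; after the `n` rows have cancelled the `1 / n`, the total error is of order `λ² L³ d² / √n`.
For the squared loss the fourth moment of a row brings in `L⁴`, so `L⁷` appears. The growth
condition on `d` pays for the power `q̄₀ + 3` of `L`; this covers `7` because assumption (a) forces
`q₀ ≥ 2` and `q₁ ≥ 1/2`, hence `q̄₀ ≥ 4`, for the squared loss.

Noise. By independence the noise may be frozen. The bounds depend on it only through the average of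
`|ξ_i|³`, which for the squared loss is dominated by the average of `L_{ℓ_i}^𝐪`; the event where it
is large has small probability and costs at most `2 K` times that probability. -/

/-! ### Gibbs averages and the soft minimum -/

/-- The Gibbs weights with log-densities `E`. -/
noncomputable def gibbsWeight {ι : Type*} [Fintype ι] (E : ι → ℝ) (w : ι) : ℝ :=
  Real.exp (E w) / ∑ v, Real.exp (E v)

/-- The average of `f` under the Gibbs weights with log-densities `E`. -/
noncomputable def gibbs {ι : Type*} [Fintype ι] (E f : ι → ℝ) : ℝ :=
  ∑ w, gibbsWeight E w * f w

/-- The soft minimum of `H` at inverse temperature `β`. -/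
noncomputable def softmin {ι : Type*} [Fintype ι] (β : ℝ) (H : ι → ℝ) : ℝ :=
  -(1 / β) * Real.log (∑ w, Real.exp (-β * H w))

section Gibbs

variable {ι : Type*} [Fintype ι]

lemma gibbs_add (E f f' : ι → ℝ) : gibbs E (fun w => f w + f' w) = gibbs E f + gibbs E f' := by
  simp [gibbs, mul_add, Finset.sum_add_distrib]

lemma gibbs_mul (E : ι → ℝ) (c : ℝ) (f : ι → ℝ) : gibbs E (fun w => c * f w) = c * gibbs E f := by
  simp only [gibbs, Finset.mul_sum]
  exact Finset.sum_congr rfl fun w _ => by ring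

lemma softmin_le {β : ℝ} (hβ : 0 < β) (H : ι → ℝ) (w : ι) : softmin β H ≤ H w := by
  have h1 : Real.exp (-β * H w) ≤ ∑ v, Real.exp (-β * H v) :=
    Finset.single_le_sum (f := fun v => Real.exp (-β * H v)) (fun v _ => (Real.exp_pos _).le)
      (Finset.mem_univ w)
  have h2 := Real.log_le_log (Real.exp_pos _) h1
  rw [Real.log_exp] at h2
  unfold softmin
  rw [neg_mul, neg_le, one_div, inv_mul_eq_div, le_div_iff₀ hβ]
  linarith

variable [Nonempty ι]

lemma sum_exp_pos (E : ι → ℝ) : 0 < ∑ w, Real.exp (E w) :=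
  Finset.sum_pos (fun _ _ => Real.exp_pos _) Finset.univ_nonempty

lemma gibbsWeight_nonneg (E : ι → ℝ) (w : ι) : 0 ≤ gibbsWeight E w :=
  div_nonneg (Real.exp_pos _).le (sum_exp_pos E).le

lemma sum_gibbsWeight (E : ι → ℝ) : ∑ w, gibbsWeight E w = 1 := by
  unfold gibbsWeight
  rw [← Finset.sum_div, div_self (sum_exp_pos E).ne']

lemma gibbsWeight_le_one (E : ι → ℝ) (w : ι) : gibbsWeight E w ≤ 1 := by
  rw [← sum_gibbsWeight E]
  exact Finset.single_le_sum (fun v _ => gibbsWeight_nonneg E v) (Finset.mem_univ w)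

lemma gibbs_mono (E : ι → ℝ) {f f' : ι → ℝ} (h : ∀ w, f w ≤ f' w) : gibbs E f ≤ gibbs E f' :=
  Finset.sum_le_sum fun w _ => mul_le_mul_of_nonneg_left (h w) (gibbsWeight_nonneg E w)

lemma gibbs_const (E : ι → ℝ) (c : ℝ) : gibbs E (fun _ => c) = c := by
  simp [gibbs, ← Finset.sum_mul, sum_gibbsWeight]

lemma gibbs_nonneg (E : ι → ℝ) {f : ι → ℝ} (h : ∀ w, 0 ≤ f w) : 0 ≤ gibbs E f :=
  Finset.sum_nonneg fun w _ => mul_nonneg (gibbsWeight_nonneg E w) (h w)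

lemma abs_gibbs_le (E : ι → ℝ) {f a : ι → ℝ} (h : ∀ w, |f w| ≤ a w) : |gibbs E f| ≤ gibbs E a := by
  refine (Finset.abs_sum_le_sum_abs _ _).trans (Finset.sum_le_sum fun w _ => ?_)
  rw [abs_mul, abs_of_nonneg (gibbsWeight_nonneg E w)]
  exact mul_le_mul_of_nonneg_left (h w) (gibbsWeight_nonneg E w)

/-- With `m` the Gibbs mean of `a`, average `(a - m)² (a + m) ≥ 0`; the two terms in `m³` cancel.
This controls the mixed product of first and second moments in the third derivative of the soft
minimum. -/
lemma gibbs_sq_mul_le_gibbs_cube (E : ι → ℝ) {a : ι → ℝ} (ha : ∀ w, 0 ≤ a w) :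
    gibbs E (fun w => a w ^ 2) * gibbs E a ≤ gibbs E (fun w => a w ^ 3) := by
  set m := gibbs E a with hm
  have hm0 : 0 ≤ m := gibbs_nonneg E ha
  have h : 0 ≤ gibbs E (fun w => (a w - m) ^ 2 * (a w + m)) :=
    gibbs_nonneg E fun w => mul_nonneg (sq_nonneg _) (add_nonneg (ha w) hm0)
  have e : gibbs E (fun w => (a w - m) ^ 2 * (a w + m))
      = gibbs E (fun w => a w ^ 3) + (-m) * gibbs E (fun w => a w ^ 2) + (-m ^ 2) * gibbs E a
        + m ^ 3 := by
    rw [← gibbs_mul, ← gibbs_mul, ← gibbs_add, ← gibbs_add]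
    conv_rhs => rw [← gibbs_const E (m ^ 3), ← gibbs_add]
    congr 1; ext w; ring
  rw [e, ← hm] at h
  nlinarith

lemma gibbs_pow_three_le (E : ι → ℝ) {a : ι → ℝ} (ha : ∀ w, 0 ≤ a w) :
    gibbs E a ^ 3 ≤ gibbs E (fun w => a w ^ 3) := by
  exact Real.pow_arith_mean_le_arith_mean_pow Finset.univ _ _
    (fun w _ => gibbsWeight_nonneg E w) (sum_gibbsWeight E) (fun w _ => ha w) 3

lemma gibbs_sq_le (E : ι → ℝ) (a : ι → ℝ) : gibbs E a ^ 2 ≤ gibbs E (fun w => a w ^ 2) :=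
  Real.pow_arith_mean_le_arith_mean_pow_of_even Finset.univ _ _
    (fun w _ => gibbsWeight_nonneg E w) (sum_gibbsWeight E) even_two

lemma gibbs_le_one_add_gibbs_cube (E : ι → ℝ) {a : ι → ℝ} (ha : ∀ w, 0 ≤ a w) :
    gibbs E a ≤ 1 + gibbs E (fun w => a w ^ 3) := by
  have h : gibbs E a ≤ gibbs E (fun w => 1 + a w ^ 3) := gibbs_mono E fun w => by
    nlinarith [ha w, sq_nonneg (a w - 1), mul_nonneg (ha w) (sq_nonneg (a w - 1)), pow_nonneg (ha w) 3]
  rwa [gibbs_add, gibbs_const] at h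

/-- Chebyshev's association inequality: tilting by a decreasing function of `u` lowers the average
of an increasing function of `u`. -/
lemma gibbs_sub_le_of_monovary (E u D : ι → ℝ) (h : ∀ v w, u v ≤ u w → D v ≤ D w) :
    gibbs (fun w => E w - u w) D ≤ gibbs E D := by
  -- Up to normalisation this is minus the covariance of `D` and `exp (-u)`, symmetrised over pairs:
  -- `D` and `exp (-u)` are oppositely ordered, so every summand is nonnegative.
  have key : 0 ≤ ∑ v, ∑ w, Real.exp (E v) * Real.exp (E w) * ((D v - D w) *
      (Real.exp (-u w) - Real.exp (-u v))) := by
    refine Finset.sum_nonneg fun v _ => Finset.sum_nonneg fun w _ => ?_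
    refine mul_nonneg (by positivity) ?_
    rcases le_total (u v) (u w) with hvw | hvw
    · have h1 := h v w hvw
      have h2 : Real.exp (-u w) ≤ Real.exp (-u v) := Real.exp_le_exp.2 (by linarith)
      nlinarith
    · have h1 := h w v hvw
      have h2 : Real.exp (-u v) ≤ Real.exp (-u w) := Real.exp_le_exp.2 (by linarith)
      nlinarith
  have e1 : ∀ w, Real.exp (E w - u w) = Real.exp (E w) * Real.exp (-u w) := fun w => by
    rw [← Real.exp_add]; ring_nf
  have e : ∑ v, ∑ w, Real.exp (E v) * Real.exp (E w) * ((D v - D w) *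
      (Real.exp (-u w) - Real.exp (-u v)))
      = 2 * ((∑ v, Real.exp (E v) * D v) * (∑ w, Real.exp (E w - u w))
        - (∑ v, Real.exp (E v - u v) * D v) * ∑ w, Real.exp (E w)) := by
    have s1 : ∑ v, ∑ w, Real.exp (E v) * Real.exp (E w) * (D v * Real.exp (-u w))
        = (∑ v, Real.exp (E v) * D v) * (∑ w, Real.exp (E w - u w)) := by
      rw [Finset.sum_mul_sum]
      exact Finset.sum_congr rfl fun v _ => Finset.sum_congr rfl fun w _ => by rw [e1]; ring
    have s2 : ∑ v, ∑ w, Real.exp (E v) * Real.exp (E w) * (D w * Real.exp (-u v))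
        = (∑ v, Real.exp (E v) * D v) * (∑ w, Real.exp (E w - u w)) := by
      rw [Finset.sum_comm, ← s1]
      exact Finset.sum_congr rfl fun v _ => Finset.sum_congr rfl fun w _ => by ring
    have s3 : ∑ v, ∑ w, Real.exp (E v) * Real.exp (E w) * (D v * Real.exp (-u v))
        = (∑ v, Real.exp (E v - u v) * D v) * ∑ w, Real.exp (E w) := by
      rw [Finset.sum_mul_sum]
      exact Finset.sum_congr rfl fun v _ => Finset.sum_congr rfl fun w _ => by rw [e1]; ring
    have s4 : ∑ v, ∑ w, Real.exp (E v) * Real.exp (E w) * (D w * Real.exp (-u w))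
        = (∑ v, Real.exp (E v - u v) * D v) * ∑ w, Real.exp (E w) := by
      rw [Finset.sum_comm, ← s3]
      exact Finset.sum_congr rfl fun v _ => Finset.sum_congr rfl fun w _ => by ring
    calc
      _ = (∑ v, ∑ w, Real.exp (E v) * Real.exp (E w) * (D v * Real.exp (-u w)))
          + (∑ v, ∑ w, Real.exp (E v) * Real.exp (E w) * (D w * Real.exp (-u v)))
          - (∑ v, ∑ w, Real.exp (E v) * Real.exp (E w) * (D v * Real.exp (-u v)))
          - (∑ v, ∑ w, Real.exp (E v) * Real.exp (E w) * (D w * Real.exp (-u w))) := by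
        simp only [← Finset.sum_add_distrib, ← Finset.sum_sub_distrib]
        exact Finset.sum_congr rfl fun v _ => Finset.sum_congr rfl fun w _ => by ring
      _ = _ := by rw [s1, s2, s3, s4]; ring
  rw [e] at key
  have g1 : ∀ E' : ι → ℝ, gibbs E' D = (∑ v, Real.exp (E' v) * D v) / ∑ v, Real.exp (E' v) := by
    intro E'
    simp only [gibbs, gibbsWeight, Finset.sum_div]
    exact Finset.sum_congr rfl fun v _ => by ring
  rw [g1, g1, div_le_div_iff₀ (sum_exp_pos _) (sum_exp_pos _)]
  linarith

/-! ### Derivatives along a curve -/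

/-- Differentiating the weights contributes the Gibbs covariance of `f` with the derivative of the
log-density. Iterated, this turns the derivatives of the soft minimum into joint cumulants. -/
lemma hasDerivAt_gibbs {E f : ℝ → ι → ℝ} {E' f' : ι → ℝ} {t : ℝ}
    (hE : ∀ w, HasDerivAt (fun t => E t w) (E' w) t)
    (hf : ∀ w, HasDerivAt (fun t => f t w) (f' w) t) :
    HasDerivAt (fun t => gibbs (E t) (f t))
      (gibbs (E t) f' + (gibbs (E t) (fun w => f t w * E' w) - gibbs (E t) (f t) * gibbs (E t) E'))
      t := by
  have hZ : HasDerivAt (fun t => ∑ w, Real.exp (E t w)) (∑ w, Real.exp (E t w) * E' w) t :=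
    HasDerivAt.fun_sum fun w _ => (hE w).exp
  have hN : HasDerivAt (fun t => ∑ w, Real.exp (E t w) * f t w)
      (∑ w, (Real.exp (E t w) * E' w * f t w + Real.exp (E t w) * f' w)) t :=
    HasDerivAt.fun_sum fun w _ => (hE w).exp.mul (hf w)
  have hZ0 := (sum_exp_pos (E t)).ne'
  have g1 : ∀ E' f' : ι → ℝ,
      gibbs E' f' = (∑ v, Real.exp (E' v) * f' v) / ∑ v, Real.exp (E' v) := by
    intro E' f'
    simp only [gibbs, gibbsWeight, Finset.sum_div]
    exact Finset.sum_congr rfl fun v _ => by ring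
  have := hN.div hZ hZ0
  simp only [g1]
  refine this.congr_deriv ?_
  have e1 : ∑ w, (Real.exp (E t w) * E' w * f t w + Real.exp (E t w) * f' w)
      = ∑ w, Real.exp (E t w) * (f t w * E' w) + ∑ w, Real.exp (E t w) * f' w := by
    rw [← Finset.sum_add_distrib]
    exact Finset.sum_congr rfl fun w _ => by ring
  rw [e1]
  field_simp
  ring

lemma hasDerivAt_softmin {β : ℝ} (hβ : β ≠ 0) {H : ℝ → ι → ℝ} {H' : ι → ℝ} {t : ℝ}
    (hH : ∀ w, HasDerivAt (fun t => H t w) (H' w) t) :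
    HasDerivAt (fun t => softmin β (H t)) (gibbs (fun w => -β * H t w) H') t := by
  have hZ : HasDerivAt (fun t => ∑ w, Real.exp (-β * H t w))
      (∑ w, Real.exp (-β * H t w) * (-β * H' w)) t :=
    HasDerivAt.fun_sum fun w _ => ((hH w).const_mul (-β)).exp
  have hZ0 := (sum_exp_pos (fun w => -β * H t w)).ne'
  have := (hZ.log hZ0).const_mul (-(1 / β))
  refine this.congr_deriv ?_
  have g1 : gibbs (fun w => -β * H t w) H' = (∑ v, Real.exp (-β * H t v) * H' v) /
      ∑ v, Real.exp (-β * H t v) := by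
    simp only [gibbs, gibbsWeight, Finset.sum_div]
    exact Finset.sum_congr rfl fun v _ => by ring
  have e1 : ∑ w, Real.exp (-β * H t w) * (-β * H' w) = -β * ∑ w, Real.exp (-β * H t w) * H' w := by
    rw [Finset.mul_sum]
    exact Finset.sum_congr rfl fun w _ => by ring
  rw [g1, e1]
  field_simp

/-- The partition function has `card ι` terms, each at most `exp (-β m)`. The logarithm of this
count is the whole price of softening the minimum, since `softmin_le` loses nothing in the other
direction. -/
lemma le_softmin {β : ℝ} (hβ : 0 < β) {H : ι → ℝ} {m : ℝ} (hm : ∀ w, m ≤ H w) :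
    m - Real.log (Fintype.card ι) / β ≤ softmin β H := by
  have h1 : ∑ v, Real.exp (-β * H v) ≤ Fintype.card ι * Real.exp (-β * m) := by
    rw [← nsmul_eq_mul]
    refine Finset.sum_le_card_nsmul _ _ _ fun v _ => Real.exp_le_exp.2 ?_
    nlinarith [hm v]
  have h2 := Real.log_le_log (sum_exp_pos fun w => -β * H w) h1
  rw [Real.log_mul (by exact_mod_cast Fintype.card_ne_zero) (Real.exp_pos _).ne', Real.log_exp] at h2
  unfold softmin
  rw [neg_mul, le_neg, one_div, inv_mul_eq_div, div_le_iff₀ hβ]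
  have : Real.log (Fintype.card ι) / β * β = Real.log (Fintype.card ι) := by field_simp
  nlinarith

end Gibbs

/-! ### Third order expansion of the soft minimum -/

/-- Second order Taylor expansion with a bound on the third derivative. -/
lemma abs_taylor_two_le {Φ Φ1 Φ2 Φ3 : ℝ → ℝ} {B : ℝ}
    (h0 : ∀ t, HasDerivAt Φ (Φ1 t) t) (h1 : ∀ t, HasDerivAt Φ1 (Φ2 t) t)
    (h2 : ∀ t, HasDerivAt Φ2 (Φ3 t) t) (hB : ∀ t ∈ Set.Icc (0 : ℝ) 1, |Φ3 t| ≤ B) :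
    |Φ 1 - Φ 0 - (Φ1 0 + Φ2 0 / 2)| ≤ B := by
  have hB0 : 0 ≤ B := (abs_nonneg _).trans (hB 0 (by simp))
  -- A function on `[0, 1]` that vanishes at `0` with derivative at most `B` is at most `B`. Three
  -- applications give the remainder, at the loss of the factor `1/6`.
  have step : ∀ {ψ ψ' : ℝ → ℝ}, (∀ t, HasDerivAt ψ (ψ' t) t) → ψ 0 = 0 →
      (∀ t ∈ Set.Icc (0 : ℝ) 1, |ψ' t| ≤ B) → ∀ t ∈ Set.Icc (0 : ℝ) 1, |ψ t| ≤ B := by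
    intro ψ ψ' hd h00 hb t ht
    have := norm_image_sub_le_of_norm_deriv_le_segment' (f := ψ) (f' := ψ') (a := 0) (b := 1) (C := B)
      (fun x _ => (hd x).hasDerivWithinAt) (fun x hx => hb x ⟨hx.1, hx.2.le⟩) t ht
    rw [h00, sub_zero, sub_zero, Real.norm_eq_abs] at this
    exact this.trans (mul_le_of_le_one_right hB0 ht.2)
  have a2 := step (ψ := fun t => Φ2 t - Φ2 0) (fun t => (h2 t).sub_const _) (by simp) hB
  have a1 := step (ψ := fun t => Φ1 t - Φ1 0 - Φ2 0 * t) (ψ' := fun t => Φ2 t - Φ2 0)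
    (fun t => (((h1 t).sub_const _).sub ((hasDerivAt_id t).const_mul (Φ2 0))).congr_deriv (by simp))
    (by simp) a2
  have a0 := step (ψ := fun t => Φ t - Φ 0 - Φ1 0 * t - Φ2 0 / 2 * t ^ 2)
    (ψ' := fun t => Φ1 t - Φ1 0 - Φ2 0 * t)
    (fun t => ((((h0 t).sub_const _).sub ((hasDerivAt_id t).const_mul (Φ1 0))).sub
      ((hasDerivAt_pow 2 t).const_mul (Φ2 0 / 2))).congr_deriv (by simp; ring))
    (by simp) a1
  have := a0 1 (by simp)
  simp only [mul_one, one_pow] at this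
  convert this using 2
  ring

section SoftminTaylor

variable {ι : Type*}

/-- The log-density of the Gibbs measure attached to the losses `c w + f (z w) / n`. -/
noncomputable def riskLogDensity (β n : ℝ) (f : ℝ → ℝ) (c z : ι → ℝ) (w : ι) : ℝ :=
  -β * (c w + f (z w) / n)

/-- Faà di Bruno's formula for the third derivative of `g ∘ F`, where `A1`, `A2`, `A3` are the Gibbs
moments of `|f'|`. A cumulant of order `k` costs `β ^ (k - 1) / n ^ k`, which is `lam ^ (k - 1) / n`
for `β = n lam`; thus all terms are of order `Y ^ 3 / n` with at most `lam ^ 2`. The constant is the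
sum of the coefficients, `1 + 6 + 6` on `A3` and `3 + 6 + 1` on the terms with `C`. -/
lemma abs_third_derivative_bound {n lam C K Y Q A1 A2 A3 F1 F2 F3 G1 G2 G3 : ℝ}
    (hn : 1 ≤ n) (hlam : 1 ≤ lam) (hC : 0 ≤ C) (hK : 0 ≤ K) (hY : 0 ≤ Y)
    (hA1 : 0 ≤ A1) (hA2 : 0 ≤ A2) (hA3 : 0 ≤ A3)
    (h13 : A1 ^ 3 ≤ A3) (h21 : A2 * A1 ≤ A3) (h1 : A1 ≤ 1 + A3) (hQ : A3 ≤ Q)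
    (hF1 : |F1| ≤ A1 * (Y / n)) (hF2 : |F2| ≤ Y ^ 2 / n * (C + 2 * lam * A2))
    (hF3 : |F3| ≤ Y ^ 3 / n * (C + 6 * lam * C * A1 + 6 * lam ^ 2 * A3))
    (hG1 : |G1| ≤ K) (hG2 : |G2| ≤ K) (hG3 : |G3| ≤ K) :
    |G3 * F1 ^ 3 + 3 * G2 * F1 * F2 + G1 * F3|
      ≤ 23 * K * (1 + C) * lam ^ 2 * (Y ^ 3 / n) * (1 + Q) := by
  have hn0 : 0 < n := by linarith
  have hYn : 0 ≤ Y / n := by positivity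
  have hl2 : lam ≤ lam ^ 2 := by nlinarith
  have hl1 : 1 ≤ lam ^ 2 := by nlinarith
  have hYn1 : (Y / n) ^ 3 ≤ Y ^ 3 / n := by
    rw [div_pow]
    exact div_le_div_of_nonneg_left (by positivity) hn0 (le_self_pow₀ hn (by norm_num))
  have hYn2 : (Y / n) * (Y ^ 2 / n) ≤ Y ^ 3 / n := by
    rw [div_mul_div_comm, ← pow_succ']
    exact div_le_div_of_nonneg_left (by positivity) hn0 (by nlinarith)
  set y := Y ^ 3 / n with hy
  have hy0 : 0 ≤ y := by positivity
  have b1 : |G3 * F1 ^ 3| ≤ K * (y * A3) := by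
    rw [abs_mul, abs_pow]
    refine mul_le_mul hG3 ?_ (by positivity) hK
    calc |F1| ^ 3 ≤ (A1 * (Y / n)) ^ 3 := pow_le_pow_left₀ (abs_nonneg _) hF1 3
      _ = (Y / n) ^ 3 * A1 ^ 3 := by ring
      _ ≤ y * A3 := mul_le_mul hYn1 h13 (by positivity) hy0
  have b2 : |3 * G2 * F1 * F2| ≤ 3 * K * (y * (C * A1 + 2 * lam * A3)) := by
    have : |3 * G2 * F1 * F2| = 3 * |G2| * (|F1| * |F2|) := by
      rw [abs_mul, abs_mul, abs_mul, abs_of_nonneg (by norm_num : (0:ℝ) ≤ 3)]; ring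
    rw [this]
    refine mul_le_mul (by linarith) ?_ (by positivity) (by positivity)
    calc |F1| * |F2| ≤ (A1 * (Y / n)) * (Y ^ 2 / n * (C + 2 * lam * A2)) :=
          mul_le_mul hF1 hF2 (abs_nonneg _) (by positivity)
      _ = ((Y / n) * (Y ^ 2 / n)) * (C * A1 + 2 * lam * (A2 * A1)) := by ring
      _ ≤ y * (C * A1 + 2 * lam * A3) := by
          refine mul_le_mul hYn2 ?_ (by positivity) hy0
          have := mul_le_mul_of_nonneg_left h21 (by positivity : 0 ≤ 2 * lam)
          linarith
  have b3 : |G1 * F3| ≤ K * (y * (C + 6 * lam * C * A1 + 6 * lam ^ 2 * A3)) := by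
    rw [abs_mul]
    exact mul_le_mul hG1 hF3 (abs_nonneg _) hK
  have b : |G3 * F1 ^ 3 + 3 * G2 * F1 * F2 + G1 * F3| ≤
      K * y * (A3 + 3 * (C * A1 + 2 * lam * A3) + (C + 6 * lam * C * A1 + 6 * lam ^ 2 * A3)) := by
    refine ((abs_add_le _ _).trans (add_le_add_left (abs_add_le _ _) _)).trans ?_
    linarith
  refine b.trans ?_
  have e : 23 * K * (1 + C) * lam ^ 2 * y * (1 + Q) = K * y * (23 * (1 + C) * lam ^ 2 * (1 + Q)) := by
    ring
  rw [e]
  refine mul_le_mul_of_nonneg_left ?_ (by positivity)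
  have hCA : C * A1 ≤ C * (1 + Q) := mul_le_mul_of_nonneg_left (by linarith) hC
  have hCA0 : 0 ≤ C * A1 := by positivity
  have hCQ : 0 ≤ C * (1 + Q) := mul_nonneg hC (by linarith)
  have c1 : lam * (C * A1) ≤ lam ^ 2 * (C * (1 + Q)) :=
    mul_le_mul hl2 hCA hCA0 (by positivity)
  have c2 : C * A1 ≤ lam ^ 2 * (C * (1 + Q)) :=
    hCA.trans (le_mul_of_one_le_left hCQ hl1)
  have c3 : lam * A3 ≤ lam ^ 2 * Q := mul_le_mul hl2 hQ hA3 (by positivity)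
  have c4 : A3 ≤ lam ^ 2 * Q := hQ.trans (le_mul_of_one_le_left (by linarith) hl1)
  have c5 : lam ^ 2 * A3 ≤ lam ^ 2 * Q := mul_le_mul_of_nonneg_left hQ (by positivity)
  have c6 : C ≤ lam ^ 2 * (C * (1 + Q)) := by
    exact (le_mul_of_one_le_right hC (by linarith)).trans (le_mul_of_one_le_left hCQ hl1)
  have c7 : 0 ≤ lam ^ 2 * (C * (1 + Q)) := by positivity
  have c8 : 0 ≤ lam ^ 2 := by positivity
  have c9 : 0 ≤ lam ^ 2 * Q := hA3.trans c4
  have e2 : 23 * (1 + C) * lam ^ 2 * (1 + Q)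
      = 23 * lam ^ 2 + 23 * (lam ^ 2 * Q) + 23 * (lam ^ 2 * (C * (1 + Q))) := by ring
  rw [e2]
  linarith

variable [Fintype ι] [Nonempty ι]

/-- Third order expansion of a smooth function of the soft minimum of `c w + f (v w) / n` in a
perturbation `y` of `v`. The first and second order terms are linear and quadratic in `y`. -/
theorem softmin_taylor {n lam C K : ℝ} (hn : 1 ≤ n) (hlam : 1 ≤ lam) (hC : 0 ≤ C) (hK : 0 ≤ K)
    {f : ℕ → ℝ → ℝ} (hf : ∀ k < 3, ∀ x, HasDerivAt (f k) (f (k + 1) x) x)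
    (hf2 : ∀ x, |f 2 x| ≤ C) (hf3 : ∀ x, |f 3 x| ≤ C)
    {g : ℕ → ℝ → ℝ} (hg : ∀ k < 3, ∀ x, HasDerivAt (g k) (g (k + 1) x) x)
    (hgK : ∀ k ≤ 3, ∀ x, |g k x| ≤ K) (c v : ι → ℝ) :
    ∃ (T1 : ι → ℝ) (T2 : ι → ι → ℝ), ∀ (y : ι → ℝ) (Y Q : ℝ), (∀ w, |y w| ≤ Y) →
      (∀ t ∈ Set.Icc (0 : ℝ) 1,
        gibbs (riskLogDensity (n * lam) n (f 0) c (fun w => v w + t * y w))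
          (fun w => |f 1 (v w + t * y w)| ^ 3) ≤ Q) →
      |g 0 (softmin (n * lam) (fun w => c w + f 0 (v w + y w) / n))
        - g 0 (softmin (n * lam) (fun w => c w + f 0 (v w) / n))
        - (∑ w, T1 w * y w + ∑ w, ∑ w', T2 w w' * (y w * y w'))|
        ≤ 23 * K * (1 + C) * lam ^ 2 * (Y ^ 3 / n) * (1 + Q) := by
  have hn0 : 0 < n := by linarith
  set β := n * lam with hβ
  have hβ0 : 0 < β := by positivity
  set S0 := softmin β (fun w => c w + f 0 (v w) / n) with hS0
  set π0 := gibbsWeight (riskLogDensity β n (f 0) c v) with hπ0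
  classical
  -- These are the coefficients of `Φ'(0)` and `Φ''(0) / 2` for `Φ t = g (softmin at v + t y)`: the
  -- soft minimum has the Gibbs mean as derivative, and its second derivative is a mean minus `β`
  -- times a variance. The squared mean gives the rank-one part with `g'' + β g'`, the rest sits on
  -- the diagonal. Nothing here depends on `y`, so matching two moments of `y` will cancel both
  -- orders.
  refine ⟨fun w => g 1 S0 * (π0 w * (f 1 (v w) / n)),
    fun w w' => (g 2 S0 + β * g 1 S0) / 2 * ((π0 w * (f 1 (v w) / n)) * (π0 w' * (f 1 (v w') / n)))
      + if w' = w then g 1 S0 / 2 * (π0 w * (f 2 (v w) / n - β * (f 1 (v w) / n) ^ 2)) else 0,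
    fun y Y Q hy hQ => ?_⟩
  have hY : 0 ≤ Y := (abs_nonneg _).trans (hy (Classical.arbitrary ι))
  set z : ℝ → ι → ℝ := fun t w => v w + t * y w with hz
  have hzd : ∀ w t, HasDerivAt (fun t => z t w) (y w) t := fun w t =>
    (((hasDerivAt_id t).mul_const (y w)).const_add (v w)).congr_deriv (by simp)
  set h : ℕ → ℝ → ι → ℝ := fun k t w => f k (z t w) * y w ^ k / n with hh
  have hhd : ∀ k < 3, ∀ w t, HasDerivAt (fun t => h k t w) (h (k + 1) t w) t := fun k hk w t =>
    ((((hf k hk _).comp t (hzd w t)).mul_const (y w ^ k)).div_const n).congr_deriv (by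
      simp only [hh]; ring)
  set E : ℝ → ι → ℝ := fun t => riskLogDensity β n (f 0) c (z t) with hE
  have hEd : ∀ w t, HasDerivAt (fun t => E t w) (-β * h 1 t w) t := fun w t => by
    have := ((hhd 0 (by norm_num) w t).const_add (c w)).const_mul (-β)
    simpa [hE, hh, riskLogDensity] using this
  -- derivatives of the soft minimum
  set F0 : ℝ → ℝ := fun t => softmin β (fun w => c w + f 0 (z t w) / n) with hF0
  set F1 : ℝ → ℝ := fun t => gibbs (E t) (h 1 t) with hF1
  set F2 : ℝ → ℝ := fun t => gibbs (E t) (h 2 t)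
    - β * (gibbs (E t) (fun w => h 1 t w ^ 2) - gibbs (E t) (h 1 t) ^ 2) with hF2
  -- The third derivative is the sum of a mean, `-3 β` times a covariance and `β ^ 2` times a third
  -- cumulant, for the derivatives `h k` of the energy along the segment.
  set F3 : ℝ → ℝ := fun t => gibbs (E t) (h 3 t)
    - 3 * β * (gibbs (E t) (fun w => h 2 t w * h 1 t w) - gibbs (E t) (h 2 t) * gibbs (E t) (h 1 t))
    + β ^ 2 * (gibbs (E t) (fun w => h 1 t w ^ 3)
      - 3 * (gibbs (E t) (fun w => h 1 t w ^ 2) * gibbs (E t) (h 1 t)) + 2 * gibbs (E t) (h 1 t) ^ 3)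
    with hF3
  have dF0 : ∀ t, HasDerivAt F0 (F1 t) t := fun t => by
    have := hasDerivAt_softmin hβ0.ne' (H := fun t w => c w + f 0 (z t w) / n) (H' := h 1 t) (t := t)
      (fun w => by
        have := (hhd 0 (by norm_num) w t).const_add (c w)
        simpa [hh] using this)
    exact this
  have dA : ∀ {u u' : ℝ → ι → ℝ} {t : ℝ}, (∀ w, HasDerivAt (fun t => u t w) (u' t w) t) →
      HasDerivAt (fun t => gibbs (E t) (u t)) (gibbs (E t) (u' t)
        - β * (gibbs (E t) (fun w => u t w * h 1 t w) - gibbs (E t) (u t) * gibbs (E t) (h 1 t))) t := by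
    intro u u' t hu
    refine (hasDerivAt_gibbs (fun w => hEd w t) hu).congr_deriv ?_
    rw [gibbs_mul, show (fun w => u t w * (-β * h 1 t w)) = fun w => -β * (u t w * h 1 t w) from
      funext fun w => by ring, gibbs_mul]
    ring
  have dF1 : ∀ t, HasDerivAt F1 (F2 t) t := fun t => by
    refine (dA (fun w => hhd 1 (by norm_num) w t)).congr_deriv ?_
    simp only [hF2, sq]
  have dF2 : ∀ t, HasDerivAt F2 (F3 t) t := fun t => by
    have d2 := dA (fun w => hhd 2 (by norm_num) w t)
    have dsq := dA (u := fun t w => h 1 t w ^ 2) (u' := fun t w => 2 * (h 2 t w * h 1 t w)) (t := t)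
      (fun w => ((hhd 1 (by norm_num) w t).pow 2).congr_deriv (by push_cast; ring))
    have d1 := (dF1 t).pow 2
    refine ((d2.sub ((dsq.sub d1).const_mul β))).congr_deriv ?_
    simp only [hF3, hF2, hF1, gibbs_mul]
    rw [show (fun w => h 1 t w ^ 2 * h 1 t w) = fun w => h 1 t w ^ 3 from funext fun w => by ring]
    push_cast
    ring
  -- derivatives of the composition
  set Φ1 : ℝ → ℝ := fun t => g 1 (F0 t) * F1 t with hΦ1
  set Φ2 : ℝ → ℝ := fun t => g 2 (F0 t) * F1 t ^ 2 + g 1 (F0 t) * F2 t with hΦ2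
  set Φ3 : ℝ → ℝ := fun t => g 3 (F0 t) * F1 t ^ 3 + 3 * g 2 (F0 t) * F1 t * F2 t + g 1 (F0 t) * F3 t
    with hΦ3
  have dg : ∀ k < 3, ∀ t, HasDerivAt (fun t => g k (F0 t)) (g (k + 1) (F0 t) * F1 t) t :=
    fun k hk t => (hg k hk _).comp t (dF0 t)
  have dΦ1 : ∀ t, HasDerivAt Φ1 (Φ2 t) t := fun t =>
    ((dg 1 (by norm_num) t).mul (dF1 t)).congr_deriv (by simp only [hΦ2]; ring)
  have dΦ2 : ∀ t, HasDerivAt Φ2 (Φ3 t) t := fun t =>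
    (((dg 2 (by norm_num) t).mul ((dF1 t).pow 2)).add
      ((dg 1 (by norm_num) t).mul (dF2 t))).congr_deriv (by simp only [hΦ3, Pi.pow_apply]; push_cast; ring)
  have bound : ∀ t ∈ Set.Icc (0 : ℝ) 1,
      |Φ3 t| ≤ 23 * K * (1 + C) * lam ^ 2 * (Y ^ 3 / n) * (1 + Q) := by
    intro t ht
    set a : ι → ℝ := fun w => |f 1 (z t w)| with ha
    have ha0 : ∀ w, 0 ≤ a w := fun w => abs_nonneg _
    have hYn : 0 ≤ Y / n := by positivity
    have k1 : ∀ w, |h 1 t w| ≤ (Y / n) * a w := fun w => by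
      simp only [hh, ha]
      rw [abs_div, abs_mul, pow_one, abs_of_pos hn0, mul_div_assoc, mul_comm]
      exact mul_le_mul_of_nonneg_right (div_le_div_of_nonneg_right (hy w) hn0.le) (abs_nonneg _)
    have k2 : ∀ w, |h 2 t w| ≤ C * Y ^ 2 / n := fun w => by
      simp only [hh]
      rw [abs_div, abs_mul, abs_pow, abs_of_pos hn0]
      exact div_le_div_of_nonneg_right (mul_le_mul (hf2 _) (pow_le_pow_left₀ (abs_nonneg _) (hy w) 2)
        (by positivity) hC) hn0.le
    have k3 : ∀ w, |h 3 t w| ≤ C * Y ^ 3 / n := fun w => by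
      simp only [hh]
      rw [abs_div, abs_mul, abs_pow, abs_of_pos hn0]
      exact div_le_div_of_nonneg_right (mul_le_mul (hf3 _) (pow_le_pow_left₀ (abs_nonneg _) (hy w) 3)
        (by positivity) hC) hn0.le
    set A1 := gibbs (E t) a with hA1
    set A2 := gibbs (E t) (fun w => a w ^ 2) with hA2
    set A3 := gibbs (E t) (fun w => a w ^ 3) with hA3
    have hA1' : 0 ≤ A1 := gibbs_nonneg _ ha0
    have hA2' : 0 ≤ A2 := gibbs_nonneg _ fun w => sq_nonneg _
    have hA3' : 0 ≤ A3 := gibbs_nonneg _ fun w => pow_nonneg (ha0 w) 3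
    have m1 : |gibbs (E t) (h 1 t)| ≤ Y / n * A1 := by
      rw [hA1, ← gibbs_mul]; exact abs_gibbs_le _ k1
    have mp : ∀ k : ℕ, |gibbs (E t) (fun w => h 1 t w ^ k)| ≤
        (Y / n) ^ k * gibbs (E t) (fun w => a w ^ k) := by
      intro k
      rw [← gibbs_mul]
      refine abs_gibbs_le _ fun w => ?_
      rw [abs_pow, ← mul_pow]
      exact pow_le_pow_left₀ (abs_nonneg _) (k1 w) k
    have m2 : |gibbs (E t) (h 2 t)| ≤ C * Y ^ 2 / n := by
      rw [← gibbs_const (E t) (C * Y ^ 2 / n)]; exact abs_gibbs_le _ k2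
    have m3 : |gibbs (E t) (h 3 t)| ≤ C * Y ^ 3 / n := by
      rw [← gibbs_const (E t) (C * Y ^ 3 / n)]; exact abs_gibbs_le _ k3
    have m21 : |gibbs (E t) (fun w => h 2 t w * h 1 t w)| ≤ (C * Y ^ 2 / n * (Y / n)) * A1 := by
      rw [hA1, ← gibbs_mul]
      refine abs_gibbs_le _ fun w => ?_
      rw [abs_mul, mul_assoc]
      exact mul_le_mul (k2 w) (k1 w) (abs_nonneg _) (by positivity)
    have s1 : A1 ^ 2 ≤ A2 := gibbs_sq_le _ _
    have s13 : A1 ^ 3 ≤ A3 := gibbs_pow_three_le _ ha0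
    have s21 : A2 * A1 ≤ A3 := gibbs_sq_mul_le_gibbs_cube _ ha0
    have e1 : β * (Y / n) ^ 2 = Y ^ 2 / n * lam := by rw [hβ]; field_simp
    have e2 : β ^ 2 * (Y / n) ^ 3 = Y ^ 3 / n * lam ^ 2 := by rw [hβ]; field_simp
    have e3 : β * (C * Y ^ 2 / n * (Y / n)) = Y ^ 3 / n * (lam * C) := by rw [hβ]; field_simp
    refine abs_third_derivative_bound hn hlam hC hK hY hA1' hA2' hA3' s13 s21
      (gibbs_le_one_add_gibbs_cube _ ha0) (hQ t ht) ?_ ?_ ?_ (hgK 1 (by norm_num) _)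
      (hgK 2 (by norm_num) _) (hgK 3 (by norm_num) _)
    · rw [mul_comm]; exact m1
    · have p1 : |gibbs (E t) (h 1 t) ^ 2| ≤ (Y / n) ^ 2 * A2 := by
        rw [abs_pow]
        refine (pow_le_pow_left₀ (abs_nonneg _) m1 2).trans ?_
        rw [mul_pow]
        exact mul_le_mul_of_nonneg_left s1 (by positivity)
      have p2 : |gibbs (E t) (fun w => h 1 t w ^ 2) - gibbs (E t) (h 1 t) ^ 2|
          ≤ 2 * ((Y / n) ^ 2 * A2) := (abs_sub _ _).trans (by linarith [mp 2])
      have p3 : |β * (gibbs (E t) (fun w => h 1 t w ^ 2) - gibbs (E t) (h 1 t) ^ 2)|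
          ≤ β * (2 * ((Y / n) ^ 2 * A2)) := by
        rw [abs_mul, abs_of_pos hβ0]; exact mul_le_mul_of_nonneg_left p2 hβ0.le
      have p4 : β * (2 * ((Y / n) ^ 2 * A2)) = Y ^ 2 / n * lam * 2 * A2 := by
        rw [← e1]; ring
      have p5 : Y ^ 2 / n * (C + 2 * lam * A2) = C * Y ^ 2 / n + Y ^ 2 / n * lam * 2 * A2 := by ring
      rw [p5, ← p4]
      exact (abs_sub _ _).trans (add_le_add m2 p3)
    · have p1 : |gibbs (E t) (h 2 t) * gibbs (E t) (h 1 t)| ≤ (C * Y ^ 2 / n * (Y / n)) * A1 := by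
        rw [abs_mul, mul_assoc]
        exact mul_le_mul m2 m1 (abs_nonneg _) (by positivity)
      have p2 : |3 * β * (gibbs (E t) (fun w => h 2 t w * h 1 t w)
          - gibbs (E t) (h 2 t) * gibbs (E t) (h 1 t))|
          ≤ 3 * β * (2 * ((C * Y ^ 2 / n * (Y / n)) * A1)) := by
        rw [abs_mul, abs_of_pos (by positivity : 0 < 3 * β)]
        exact mul_le_mul_of_nonneg_left ((abs_sub _ _).trans (by linarith)) (by positivity)
      have q2 : |3 * (gibbs (E t) (fun w => h 1 t w ^ 2) * gibbs (E t) (h 1 t))|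
          ≤ 3 * ((Y / n) ^ 3 * A3) := by
        rw [abs_mul, abs_of_nonneg (by norm_num : (0:ℝ) ≤ 3), abs_mul]
        refine mul_le_mul_of_nonneg_left ?_ (by norm_num)
        refine (mul_le_mul (mp 2) m1 (abs_nonneg _) (by positivity)).trans ?_
        rw [show (Y / n) ^ 2 * gibbs (E t) (fun w => a w ^ 2) * (Y / n * A1)
          = (Y / n) ^ 3 * (A2 * A1) by rw [hA2]; ring]
        exact mul_le_mul_of_nonneg_left s21 (by positivity)
      have q3 : |2 * gibbs (E t) (h 1 t) ^ 3| ≤ 2 * ((Y / n) ^ 3 * A3) := by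
        rw [abs_mul, abs_of_nonneg (by norm_num : (0:ℝ) ≤ 2), abs_pow]
        refine mul_le_mul_of_nonneg_left ?_ (by norm_num)
        refine (pow_le_pow_left₀ (abs_nonneg _) m1 3).trans ?_
        rw [mul_pow]
        exact mul_le_mul_of_nonneg_left s13 (by positivity)
      have p3 : |β ^ 2 * (gibbs (E t) (fun w => h 1 t w ^ 3)
          - 3 * (gibbs (E t) (fun w => h 1 t w ^ 2) * gibbs (E t) (h 1 t))
          + 2 * gibbs (E t) (h 1 t) ^ 3)| ≤ β ^ 2 * (6 * ((Y / n) ^ 3 * A3)) := by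
        rw [abs_mul, abs_of_pos (by positivity : 0 < β ^ 2)]
        refine mul_le_mul_of_nonneg_left ?_ (by positivity)
        refine (abs_add_le _ _).trans ((add_le_add_left (abs_sub _ _) _).trans ?_)
        linarith [mp 3]
      have p4 : Y ^ 3 / n * (C + 6 * lam * C * A1 + 6 * lam ^ 2 * A3)
          = C * Y ^ 3 / n + 3 * β * (2 * ((C * Y ^ 2 / n * (Y / n)) * A1))
            + β ^ 2 * (6 * ((Y / n) ^ 3 * A3)) := by
        calc
          _ = C * Y ^ 3 / n + 6 * (Y ^ 3 / n * (lam * C)) * A1 + 6 * (Y ^ 3 / n * lam ^ 2) * A3 := by ring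
          _ = _ := by rw [← e2, ← e3]; ring
      rw [p4]
      exact (abs_add_le _ _).trans (add_le_add ((abs_sub _ _).trans (add_le_add m3 p2)) p3)
  have main := abs_taylor_two_le (dg 0 (by norm_num)) dΦ1 dΦ2 bound
  convert main using 2
  have z1 : ∀ w, z 1 w = v w + y w := fun w => by simp [hz]
  have z0 : z 0 = v := funext fun w => by simp [hz]
  have E0 : E 0 = riskLogDensity β n (f 0) c v := by simp only [hE, z0]
  have F00 : F0 0 = S0 := by simp only [hF0, z0, hS0]
  congr 1
  · simp only [hF0, z1, z0, hS0]
  · simp only [hΦ2, F00, hF1, hF2, E0, hh, z0]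
    simp only [gibbs, ← hπ0]
    have l1 : ∑ w, π0 w * (f 1 (v w) * y w ^ 1 / n) = ∑ w, (π0 w * (f 1 (v w) / n)) * y w :=
      Finset.sum_congr rfl fun w _ => by ring
    have l2 : (∑ w, (π0 w * (f 1 (v w) / n)) * y w) ^ 2
        = ∑ w, ∑ w', ((π0 w * (f 1 (v w) / n)) * (π0 w' * (f 1 (v w') / n))) * (y w * y w') := by
      rw [sq, Finset.sum_mul_sum]
      exact Finset.sum_congr rfl fun w _ => Finset.sum_congr rfl fun w' _ => by ring
    rw [l1, l2]
    simp only [add_mul, Finset.sum_add_distrib, ite_mul, zero_mul, Finset.sum_ite_eq',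
      Finset.mem_univ, if_true]
    have l3 : ∑ w, g 1 S0 * (π0 w * (f 1 (v w) / n)) * y w
        = g 1 S0 * ∑ w, π0 w * (f 1 (v w) / n) * y w := by
      rw [Finset.mul_sum]; exact Finset.sum_congr rfl fun w _ => by ring
    have l4 : ∑ w, ∑ w', (g 2 S0 + β * g 1 S0) / 2 *
          ((π0 w * (f 1 (v w) / n)) * (π0 w' * (f 1 (v w') / n))) * (y w * y w')
        = (g 2 S0 + β * g 1 S0) / 2 *
          ∑ w, ∑ w', ((π0 w * (f 1 (v w) / n)) * (π0 w' * (f 1 (v w') / n))) * (y w * y w') := by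
      simp only [Finset.mul_sum]
      exact Finset.sum_congr rfl fun w _ => Finset.sum_congr rfl fun w' _ => by ring
    have l5 : ∑ w, g 1 S0 / 2 * (π0 w * (f 2 (v w) / n - β * (f 1 (v w) / n) ^ 2)) * (y w * y w)
        = g 1 S0 / 2 * (∑ w, π0 w * (f 2 (v w) * y w ^ 2 / n)
          - β * ∑ w, π0 w * (f 1 (v w) * y w ^ 1 / n) ^ 2) := by
      rw [Finset.mul_sum, ← Finset.sum_sub_distrib, Finset.mul_sum]
      exact Finset.sum_congr rfl fun w _ => by ring
    rw [l3, l4, l5]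
    ring

end SoftminTaylor

/-! ### Lindeberg's replacement principle for product measures -/

section Lindeberg

variable {J E : Type*} [MeasurableSpace E]

/-- The functions with equal integrals under `μ` and `ν`. -/
def matchedFunctions (μ ν : Measure E) : Submodule ℝ (E → ℝ) where
  carrier := {T | Integrable T μ ∧ Integrable T ν ∧ ∫ y, T y ∂μ = ∫ y, T y ∂ν}
  zero_mem' := ⟨integrable_zero _ _ _, integrable_zero _ _ _, by simp⟩
  add_mem' := by
    rintro S T ⟨h1, h2, h3⟩ ⟨k1, k2, k3⟩
    refine ⟨h1.add k1, h2.add k2, ?_⟩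
    simp only [Pi.add_apply]
    rw [integral_add h1 k1, integral_add h2 k2, h3, k3]
  smul_mem' := by
    rintro c T ⟨h1, h2, h3⟩
    refine ⟨h1.smul c, h2.smul c, ?_⟩
    simp only [Pi.smul_apply]
    rw [integral_smul, integral_smul, h3]

/-- The constant and the matched part integrate to the same value under both laws, so only the
remainder `r` is left. -/
lemma abs_integral_sub_le_of_matched {μ ν : Measure E} [IsProbabilityMeasure μ]
    [IsProbabilityMeasure ν] {F T r : E → ℝ} {c : ℝ} (hFμ : Integrable F μ) (hFν : Integrable F ν)
    (hT : T ∈ matchedFunctions μ ν) (hrμ : Integrable r μ) (hrν : Integrable r ν)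
    (h : ∀ y, |F y - c - T y| ≤ r y) :
    |∫ y, F y ∂μ - ∫ y, F y ∂ν| ≤ ∫ y, r y ∂μ + ∫ y, r y ∂ν := by
  obtain ⟨hTμ, hTν, hTe⟩ := hT
  have key : ∀ (κ : Measure E) [IsProbabilityMeasure κ], Integrable F κ → Integrable T κ →
      Integrable r κ → |∫ y, F y ∂κ - c - ∫ y, T y ∂κ| ≤ ∫ y, r y ∂κ := by
    intro κ _ hF hT hr
    have e : ∫ y, (F y - c - T y) ∂κ = ∫ y, F y ∂κ - c - ∫ y, T y ∂κ := by
      have hFc : Integrable (fun y => F y - c) κ := hF.sub (integrable_const c)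
      rw [integral_sub hFc hT, integral_sub hF (integrable_const c)]
      simp
    rw [← e]
    refine (abs_integral_le_integral_abs).trans (integral_mono_of_nonneg ?_ hr ?_)
    · exact Eventually.of_forall fun y => abs_nonneg _
    · exact Eventually.of_forall h
  have h1 := key μ hFμ hTμ hrμ
  have h2 := key ν hFν hTν hrν
  rw [hTe] at h1
  calc
    _ = |(∫ y, F y ∂μ - c - ∫ y, T y ∂ν) - (∫ y, F y ∂ν - c - ∫ y, T y ∂ν)| := by ring_nf
    _ ≤ _ := (abs_sub _ _).trans (add_le_add h1 h2)

variable [DecidableEq J]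

lemma isProbabilityMeasure_update (κ : J → Measure E) [∀ j, IsProbabilityMeasure (κ j)] (a : J)
    (μ : Measure E) [IsProbabilityMeasure μ] (j : J) :
    IsProbabilityMeasure (Function.update κ a μ j) := by
  by_cases h : j = a
  · subst h; rw [Function.update_self]; infer_instance
  · rw [Function.update_of_ne h]; infer_instance

lemma measurable_update_prod (a : J) :
    Measurable (fun z : (J → E) × E => Function.update z.1 a z.2) := by
  refine measurable_pi_lambda _ fun j => ?_
  by_cases h : j = a
  · subst h; simpa using measurable_snd
  · simp only [Function.update_of_ne h]
    exact (measurable_pi_apply j).comp measurable_fst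

variable [Fintype J]

/-- Replacing a coordinate of a product measure. -/
lemma map_update_pi (κ : J → Measure E) [∀ j, IsProbabilityMeasure (κ j)] (a : J)
    (μ : Measure E) [IsProbabilityMeasure μ] :
    ((Measure.pi κ).prod μ).map (fun z => Function.update z.1 a z.2)
      = Measure.pi (Function.update κ a μ) := by
  have := isProbabilityMeasure_update κ a μ
  refine (Measure.pi_eq fun s hs => ?_).symm
  rw [Measure.map_apply (measurable_update_prod a) (MeasurableSet.univ_pi hs)]
  have e : (fun z : (J → E) × E => Function.update z.1 a z.2) ⁻¹' (Set.univ.pi s)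
      = (Set.univ.pi (Function.update s a Set.univ)) ×ˢ (s a) := by
    ext z
    simp only [Set.mem_preimage, Set.mem_univ_pi, Set.mem_prod]
    constructor
    · intro h
      refine ⟨fun j => ?_, by simpa using h a⟩
      by_cases hj : j = a
      · subst hj; simp
      · simpa [Function.update_of_ne hj] using h j
    · rintro ⟨h1, h2⟩ j
      by_cases hj : j = a
      · subst hj; simpa using h2
      · simpa [Function.update_of_ne hj] using h1 j
  rw [e, Measure.prod_prod, Measure.pi_pi, ← Finset.prod_erase_mul _ _ (Finset.mem_univ a),
    ← Finset.prod_erase_mul Finset.univ (fun i => (Function.update κ a μ i) (s i)) (Finset.mem_univ a)]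
  simp only [Function.update_self, measure_univ, mul_one]
  congr 1
  refine Finset.prod_congr rfl fun j hj => ?_
  rw [Function.update_of_ne (Finset.ne_of_mem_erase hj), Function.update_of_ne (Finset.ne_of_mem_erase hj)]

lemma integral_pi_update (κ : J → Measure E) [∀ j, IsProbabilityMeasure (κ j)] (a : J)
    (μ : Measure E) [IsProbabilityMeasure μ] {f : (J → E) → ℝ} (hf : Measurable f) {K : ℝ}
    (hK : ∀ x, |f x| ≤ K) :
    ∫ x, f x ∂(Measure.pi (Function.update κ a μ))
      = ∫ x, ∫ y, f (Function.update x a y) ∂μ ∂(Measure.pi κ) := by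
  rw [← map_update_pi, integral_map (measurable_update_prod a).aemeasurable
    hf.aestronglyMeasurable, integral_prod]
  exact Integrable.of_bound (hf.comp (measurable_update_prod a)).aestronglyMeasurable K
    (Eventually.of_forall fun z => hK _)

/-- **Lindeberg's principle**: if changing one coordinate changes `f` by a matched function plus a
controlled remainder, then the integrals of `f` under two product measures are close. -/
theorem abs_integral_pi_sub_le (μ ν : J → Measure E) [∀ j, IsProbabilityMeasure (μ j)]
    [∀ j, IsProbabilityMeasure (ν j)] {f : (J → E) → ℝ} (hf : Measurable f) {K : ℝ}
    (hK : ∀ x, |f x| ≤ K) {U W : J → E → ℝ} {V : J → (J → E) → ℝ} {v : J → ℝ}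
    (hUμ : ∀ a, Integrable (U a) (μ a)) (hUν : ∀ a, Integrable (U a) (ν a))
    (hWμ : ∀ a, Integrable (W a) (μ a)) (hWν : ∀ a, Integrable (W a) (ν a))
    (hU0 : ∀ a y, 0 ≤ U a y)
    (hV : ∀ (κ : J → Measure E), (∀ j, IsProbabilityMeasure (κ j)) → (∀ j, κ j = μ j ∨ κ j = ν j) →
      ∀ a, Integrable (V a) (Measure.pi κ) ∧ ∫ x, V a x ∂(Measure.pi κ) ≤ v a)
    (hT : ∀ a x, ∃ T ∈ matchedFunctions (μ a) (ν a), ∃ c, ∀ y,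
      |f (Function.update x a y) - c - T y| ≤ U a y * V a x + W a y) :
    |∫ x, f x ∂(Measure.pi μ) - ∫ x, f x ∂(Measure.pi ν)|
      ≤ ∑ a, ((∫ y, U a y ∂(μ a) + ∫ y, U a y ∂(ν a)) * v a
        + (∫ y, W a y ∂(μ a) + ∫ y, W a y ∂(ν a))) := by
  -- Hybrid laws: the coordinates in `s` have been exchanged already. The bound on `V` is asked for
  -- all hybrids at once, since each of them occurs as the background of some exchange.
  set hyb : Finset J → J → Measure E := fun s j => if j ∈ s then ν j else μ j with hhyb
  have hp : ∀ s j, IsProbabilityMeasure (hyb s j) := by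
    intro s j; simp only [hhyb]; split_ifs <;> infer_instance
  have hor : ∀ s j, hyb s j = μ j ∨ hyb s j = ν j := by
    intro s j; simp only [hhyb]; split_ifs <;> simp
  set ε : J → ℝ := fun a => (∫ y, U a y ∂(μ a) + ∫ y, U a y ∂(ν a)) * v a
        + (∫ y, W a y ∂(μ a) + ∫ y, W a y ∂(ν a)) with hε
  have step : ∀ (s : Finset J) (a : J), a ∉ s →
      |∫ x, f x ∂(Measure.pi (hyb s)) - ∫ x, f x ∂(Measure.pi (hyb (insert a s)))| ≤ ε a := by
    intro s a has
    -- Both neighbouring hybrids are the same background `hyb s` with the coordinate `a`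
    -- overwritten, so their integrals differ only in the inner integral over that coordinate.
    have e1 : hyb s = Function.update (hyb s) a (μ a) := by
      funext j
      by_cases hj : j = a
      · subst hj; simp [hhyb, has]
      · simp [Function.update_of_ne hj]
    have e2 : hyb (insert a s) = Function.update (hyb s) a (ν a) := by
      funext j
      by_cases hj : j = a
      · subst hj; simp [hhyb]
      · simp [hhyb, hj]
    have hfu : Measurable (fun z : (J → E) × E => f (Function.update z.1 a z.2)) :=
      hf.comp (measurable_update_prod a)
    have int1 : ∀ (κ : Measure E) [IsProbabilityMeasure κ] (x : J → E),
        Integrable (fun y => f (Function.update x a y)) κ := fun κ _ x =>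
      Integrable.of_bound (hfu.comp measurable_prodMk_left).aestronglyMeasurable K
        (Eventually.of_forall fun y => hK _)
    have int2 : ∀ (κ : Measure E) [IsProbabilityMeasure κ],
        Integrable (fun x => ∫ y, f (Function.update x a y) ∂κ) (Measure.pi (hyb s)) := by
      intro κ _
      have : Integrable (fun z : (J → E) × E => f (Function.update z.1 a z.2))
          ((Measure.pi (hyb s)).prod κ) :=
        Integrable.of_bound hfu.aestronglyMeasurable K (Eventually.of_forall fun y => hK _)
      exact this.integral_prod_left
    have i1 : ∫ x, f x ∂(Measure.pi (hyb s))
        = ∫ x, ∫ y, f (Function.update x a y) ∂(μ a) ∂(Measure.pi (hyb s)) := by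
      conv_lhs => rw [e1]
      exact integral_pi_update (hyb s) a (μ a) hf hK
    have i2 : ∫ x, f x ∂(Measure.pi (hyb (insert a s)))
        = ∫ x, ∫ y, f (Function.update x a y) ∂(ν a) ∂(Measure.pi (hyb s)) := by
      conv_lhs => rw [e2]
      exact integral_pi_update (hyb s) a (ν a) hf hK
    rw [i1, i2, ← integral_sub (int2 _) (int2 _)]
    obtain ⟨hVi, hVle⟩ := hV (hyb s) (hp s) (hor s) a
    have hb : ∀ x, |∫ y, f (Function.update x a y) ∂(μ a) - ∫ y, f (Function.update x a y) ∂(ν a)|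
        ≤ (∫ y, U a y ∂(μ a) + ∫ y, U a y ∂(ν a)) * V a x
          + (∫ y, W a y ∂(μ a) + ∫ y, W a y ∂(ν a)) := by
      intro x
      obtain ⟨T, hTm, c, hc⟩ := hT a x
      refine (abs_integral_sub_le_of_matched (int1 _ x) (int1 _ x) hTm
        (((hUμ a).mul_const _).add (hWμ a)) (((hUν a).mul_const _).add (hWν a)) hc).trans_eq ?_
      simp only [Pi.add_apply]
      rw [integral_add ((hUμ a).mul_const _) (hWμ a), integral_add ((hUν a).mul_const _) (hWν a),
        integral_mul_const, integral_mul_const]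
      ring
    have hUint : 0 ≤ ∫ y, U a y ∂(μ a) + ∫ y, U a y ∂(ν a) :=
      add_nonneg (integral_nonneg (hU0 a)) (integral_nonneg (hU0 a))
    refine (abs_integral_le_integral_abs).trans
      ((integral_mono_of_nonneg (Eventually.of_forall fun x => abs_nonneg _)
        ((hVi.const_mul _).add (integrable_const _)) (Eventually.of_forall hb)).trans ?_)
    simp only [Pi.add_apply]
    rw [integral_add (hVi.const_mul _) (integrable_const _), integral_const_mul, integral_const]
    simp only [probReal_univ, one_smul, hε]
    exact add_le_add_left (mul_le_mul_of_nonneg_left hVle hUint) _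
  have main : ∀ s : Finset J,
      |∫ x, f x ∂(Measure.pi (hyb ∅)) - ∫ x, f x ∂(Measure.pi (hyb s))| ≤ ∑ a ∈ s, ε a := by
    intro s
    induction s using Finset.induction_on with
    | empty => simp
    | insert a s has ih =>
      rw [Finset.sum_insert has]
      have := step s a has
      refine (abs_sub_le _ (∫ x, f x ∂(Measure.pi (hyb s))) _).trans ?_
      linarith
  have := main Finset.univ
  have h0 : hyb ∅ = μ := by funext j; simp [hhyb]
  have h1 : hyb Finset.univ = ν := by funext j; simp [hhyb]
  rwa [h0, h1] at this

end Lindeberg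

/-! ### Fourth moments of sums of independent centred variables -/

section FourthMoment

variable {Ω : Type*} [MeasurableSpace Ω] {P : Measure Ω} [IsProbabilityMeasure P]

lemma MeasureTheory.MemLp.integrable_pow_of_le {f : Ω → ℝ} {m : ℕ} (hf : MemLp f m P) {k : ℕ}
    (hk : k ≤ m) : Integrable (fun ω => f ω ^ k) P := by
  have h1 : MemLp f k P := hf.mono_exponent (by exact_mod_cast hk)
  have h2 := h1.integrable_norm_pow'
  refine (integrable_norm_iff (h1.aestronglyMeasurable.pow k)).1 ?_
  simpa [norm_pow] using h2

lemma MeasureTheory.MemLp.integrable_abs_pow_of_le {f : Ω → ℝ} {m : ℕ} (hf : MemLp f m P) {k : ℕ}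
    (hk : k ≤ m) : Integrable (fun ω => |f ω| ^ k) P := by
  have := (hf.integrable_pow_of_le hk).norm
  simpa [norm_pow] using this

/-- In the expansion of `(S + X a) ^ 4` the terms with a first power vanish by independence and
centring. The term `6 E[S²] E[X a ²]` is exactly the cross term of `3 (E[S²] + E[X a ²])²`, which
closes the induction; mean and variance are carried along to evaluate it. -/
theorem fourth_moment_sum {J : Type*} {X : J → Ω → ℝ} (hX : iIndepFun X P)
    (hm : ∀ j, Measurable (X j)) (h4 : ∀ j, MemLp (X j) (4 : ℕ) P) (h0 : ∀ j, ∫ ω, X j ω ∂P = 0)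
    (s : Finset J) :
    MemLp (∑ j ∈ s, X j) (4 : ℕ) P ∧ ∫ ω, (∑ j ∈ s, X j) ω ∂P = 0 ∧
      ∫ ω, (∑ j ∈ s, X j) ω ^ 2 ∂P = ∑ j ∈ s, ∫ ω, X j ω ^ 2 ∂P ∧
      ∫ ω, (∑ j ∈ s, X j) ω ^ 4 ∂P ≤
        ∑ j ∈ s, ∫ ω, X j ω ^ 4 ∂P + 3 * (∑ j ∈ s, ∫ ω, X j ω ^ 2 ∂P) ^ 2 := by
  classical
  induction s using Finset.induction_on with
  | empty => simp
  | insert a s has ih =>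
    obtain ⟨i1, i2, i3, i4⟩ := ih
    set S := ∑ j ∈ s, X j with hS
    have ind : S ⟂ᵢ[P] X a := hX.indepFun_finsetSum_of_notMem hm has
    rw [Finset.sum_insert has, ← hS]
    have hSm : Measurable S := by
      have := Finset.measurable_sum s fun j (_ : j ∈ s) => hm j
      convert this using 1
      funext ω; simp [hS]
    have intS : ∀ k ≤ 4, Integrable (fun ω => S ω ^ k) P := fun k hk => i1.integrable_pow_of_le hk
    have intX : ∀ k ≤ 4, Integrable (fun ω => X a ω ^ k) P := fun k hk =>
      (h4 a).integrable_pow_of_le hk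
    have indp : ∀ k l : ℕ, (fun ω => S ω ^ k) ⟂ᵢ[P] (fun ω => X a ω ^ l) := fun k l =>
      ind.comp (φ := fun x => x ^ k) (ψ := fun x => x ^ l) (measurable_id.pow_const k)
        (measurable_id.pow_const l)
    have intP : ∀ k ≤ 4, ∀ l ≤ 4, Integrable (fun ω => S ω ^ k * X a ω ^ l) P := fun k hk l hl =>
      (indp k l).integrable_mul (intS k hk) (intX l hl)
    have eP : ∀ k l : ℕ, ∫ ω, S ω ^ k * X a ω ^ l ∂P = (∫ ω, S ω ^ k ∂P) * ∫ ω, X a ω ^ l ∂P :=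
      fun k l => (indp k l).integral_fun_mul_eq_mul_integral
        (hSm.pow_const k).aestronglyMeasurable ((hm a).pow_const l).aestronglyMeasurable
    have S1 : ∫ ω, S ω ^ 1 ∂P = 0 := by simpa using i2
    have X1 : ∫ ω, X a ω ^ 1 ∂P = 0 := by simpa using h0 a
    have e2 : ∫ ω, (X a + S) ω ^ 2 ∂P = ∫ ω, X a ω ^ 2 ∂P + ∫ ω, S ω ^ 2 ∂P := by
      have : (fun ω => (X a + S) ω ^ 2) = fun ω => X a ω ^ 2 + S ω ^ 2 + 2 * (S ω ^ 1 * X a ω ^ 1) := by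
        funext ω; simp only [Pi.add_apply]; ring
      have p2 : Integrable (fun ω => X a ω ^ 2 + S ω ^ 2) P :=
        (intX 2 (by norm_num)).add (intS 2 (by norm_num))
      rw [this, integral_add p2
        ((intP 1 (by norm_num) 1 (by norm_num)).const_mul 2), integral_const_mul, eP, S1,
        integral_add (intX 2 (by norm_num)) (intS 2 (by norm_num))]
      ring
    have e4 : ∫ ω, (X a + S) ω ^ 4 ∂P = ∫ ω, X a ω ^ 4 ∂P + ∫ ω, S ω ^ 4 ∂P
        + 6 * ((∫ ω, S ω ^ 2 ∂P) * ∫ ω, X a ω ^ 2 ∂P) := by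
      have : (fun ω => (X a + S) ω ^ 4) = fun ω => X a ω ^ 4 + S ω ^ 4 + (6 * (S ω ^ 2 * X a ω ^ 2)
          + (4 * (S ω ^ 1 * X a ω ^ 3) + 4 * (S ω ^ 3 * X a ω ^ 1))) := by
        funext ω; simp only [Pi.add_apply]; ring
      have p22 := (intP 2 (by norm_num) 2 (by norm_num)).const_mul 6
      have p13 := (intP 1 (by norm_num) 3 (by norm_num)).const_mul 4
      have p31 := (intP 3 (by norm_num) 1 (by norm_num)).const_mul 4
      have x4 := intX 4 le_rfl
      have s4 := intS 4 le_rfl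
      have q1 : Integrable (fun ω => X a ω ^ 4 + S ω ^ 4) P := x4.add s4
      have q2 : Integrable (fun ω => 4 * (S ω ^ 1 * X a ω ^ 3) + 4 * (S ω ^ 3 * X a ω ^ 1)) P :=
        p13.add p31
      have q3 : Integrable (fun ω => 6 * (S ω ^ 2 * X a ω ^ 2) + (4 * (S ω ^ 1 * X a ω ^ 3)
          + 4 * (S ω ^ 3 * X a ω ^ 1))) P := p22.add q2
      rw [this, integral_add q1 q3, integral_add x4 s4,
        integral_add p22 q2, integral_add p13 p31, integral_const_mul, integral_const_mul,
        integral_const_mul, eP, eP, eP, S1, X1]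
      ring
    refine ⟨(h4 a).add i1, ?_, ?_, ?_⟩
    · simp only [Pi.add_apply]
      rw [integral_add (by simpa using intX 1 (by norm_num)) (by simpa using intS 1 (by norm_num)),
        h0, i2, add_zero]
    · rw [Finset.sum_insert has, ← i3, e2]
    · rw [Finset.sum_insert has, Finset.sum_insert has, e4]
      rw [i3]
      have n1 : 0 ≤ ∫ ω, X a ω ^ 2 ∂P := integral_nonneg fun ω => sq_nonneg _
      nlinarith

end FourthMoment

/-! ### Replacement of the blocks of a design in the soft minimum of the empirical risk -/

section BlockReplacement

open scoped Matrix

variable {J E : Type*} [Fintype J] [MeasurableSpace E]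

/-- Functions of disjoint sets of coordinates are independent under a product measure. -/
lemma indepFun_pi_of_dependsOn [Inhabited E] (κ : J → Measure E)
    [∀ j, IsProbabilityMeasure (κ j)] {F G : (J → E) → ℝ} (hF : Measurable F) (hG : Measurable G)
    (S T : Finset J) (hST : Disjoint S T)
    (hFS : ∀ x x', (∀ j ∈ S, x j = x' j) → F x = F x')
    (hGT : ∀ x x', (∀ j ∈ T, x j = x' j) → G x = G x') :
    F ⟂ᵢ[Measure.pi κ] G := by
  classical
  have h : iIndepFun (fun (j : J) (x : J → E) => x j) (Measure.pi κ) :=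
    iIndepFun_pi (X := fun _ y => y) fun j => aemeasurable_id
  have h2 := h.indepFun_finset S T hST fun j => measurable_pi_apply j
  -- Filling the coordinates outside `U` with a default value exhibits `F` and `G` as functions of
  -- the restricted families; by `hFS` and `hGT` the filling is immaterial.
  set ext : (U : Finset J) → (U → E) → J → E :=
    fun U r j => if hj : j ∈ U then r ⟨j, hj⟩ else default with hext
  have hm : ∀ U, Measurable (ext U) := by
    intro U
    refine measurable_pi_lambda _ fun j => ?_
    by_cases hj : j ∈ U
    · simpa [hext, hj] using measurable_pi_apply _
    · simp [hext, hj]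
  have h3 := h2.comp (hF.comp (hm S)) (hG.comp (hm T))
  have e1 : (F ∘ ext S) ∘ (fun (x : J → E) (j : S) => x j) = F := by
    funext x
    exact hFS _ _ fun j hj => by simp [hext, hj]
  have e2 : (G ∘ ext T) ∘ (fun (x : J → E) (j : T) => x j) = G := by
    funext x
    exact hGT _ _ fun j hj => by simp [hext, hj]
  rwa [e1, e2] at h3

variable {p : ℕ}

lemma dotProduct_mem_matchedFunctions {μ ν : Measure (Fin p → ℝ)}
    (h : ∀ j, (fun y : Fin p → ℝ => y j) ∈ matchedFunctions μ ν) (u : Fin p → ℝ) :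
    (fun y : Fin p → ℝ => y ⬝ᵥ u) ∈ matchedFunctions μ ν := by
  have e : (fun y : Fin p → ℝ => y ⬝ᵥ u) = ∑ j, u j • (fun y : Fin p → ℝ => y j) := by
    funext y
    simp [dotProduct, mul_comm]
  rw [e]
  exact Submodule.sum_mem _ fun j _ => Submodule.smul_mem _ _ (h j)

lemma dotProduct_mul_mem_matchedFunctions {μ ν : Measure (Fin p → ℝ)}
    (h : ∀ j k, (fun y : Fin p → ℝ => y j * y k) ∈ matchedFunctions μ ν) (u u' : Fin p → ℝ) :
    (fun y : Fin p → ℝ => (y ⬝ᵥ u) * (y ⬝ᵥ u')) ∈ matchedFunctions μ ν := by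
  have e : (fun y : Fin p → ℝ => (y ⬝ᵥ u) * (y ⬝ᵥ u'))
      = ∑ j, ∑ k, (u j * u' k) • (fun y : Fin p → ℝ => y j * y k) := by
    funext y
    simp only [dotProduct, Finset.sum_mul_sum, Finset.sum_apply, Pi.smul_apply, smul_eq_mul]
    exact Finset.sum_congr rfl fun j _ => Finset.sum_congr rfl fun k _ => by ring
  rw [e]
  exact Submodule.sum_mem _ fun j _ => Submodule.sum_mem _ fun k _ => Submodule.smul_mem _ _ (h j k)

lemma abs_dotProduct_le {u y : Fin p → ℝ} {L : ℝ} (hu : ∀ j, |u j| ≤ L) :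
    |y ⬝ᵥ u| ≤ L * ∑ j, |y j| := by
  rw [Finset.mul_sum]
  refine (Finset.abs_sum_le_sum_abs _ _).trans (Finset.sum_le_sum fun j _ => ?_)
  rw [abs_mul, mul_comm]
  exact mul_le_mul_of_nonneg_right (hu j) (abs_nonneg _)

/-- Three times differentiable losses whose second and third derivatives are bounded by `C`, and
whose first derivative is controlled by a function `D` that increases with the loss. -/
structure SmoothLosses {I : Type*} (ℓ : I → ℕ → ℝ → ℝ) (D : I → ℝ → ℝ) (C s : ℝ) (a : I → ℝ) :
    Prop where
  hasDerivAt : ∀ i, ∀ k < 3, ∀ x, HasDerivAt (ℓ i k) (ℓ i (k + 1) x) x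
  abs_second_le : ∀ i x, |ℓ i 2 x| ≤ C
  abs_third_le : ∀ i x, |ℓ i 3 x| ≤ C
  abs_first_pow_le : ∀ i x, |ℓ i 1 x| ^ 3 ≤ D i x
  mono : ∀ i x y, ℓ i 0 x ≤ ℓ i 0 y → D i x ≤ D i y
  le : ∀ i x, D i x ≤ a i + s * x ^ 4

/-- Moment bounds for the law of a block; those involving more than third moments are only needed
when `s ≠ 0`. -/
structure BlockMoments {ι : Type*} (κ : Measure (Fin p → ℝ)) (w : ι → Fin p → ℝ)
    (L s t3 t7 s2 s4 : ℝ) : Prop where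
  integrable_three : Integrable (fun y => (L * ∑ j, |y j|) ^ 3) κ
  integral_three_le : ∫ y, (L * ∑ j, |y j|) ^ 3 ∂κ ≤ t3
  integrable_seven : s ≠ 0 → Integrable (fun y => (L * ∑ j, |y j|) ^ 7) κ
  integral_seven_le : s ≠ 0 → ∫ y, (L * ∑ j, |y j|) ^ 7 ∂κ ≤ t7
  memLp : s ≠ 0 → ∀ v, MemLp (fun y => y ⬝ᵥ w v) (4 : ℕ) κ
  integral_eq_zero : s ≠ 0 → ∀ v, ∫ y, y ⬝ᵥ w v ∂κ = 0
  integral_sq_le : s ≠ 0 → ∀ v, ∫ y, (y ⬝ᵥ w v) ^ 2 ∂κ ≤ s2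
  integral_pow_four_le : s ≠ 0 → ∀ v, ∫ y, (y ⬝ᵥ w v) ^ 4 ∂κ ≤ s4

variable {I B ι : Type*} [Fintype I] [Fintype B]

lemma measurable_gibbsWeight [Fintype ι] {F : Type*} [MeasurableSpace F] {H : F → ι → ℝ}
    (hH : ∀ v, Measurable fun x => H x v) (v : ι) : Measurable fun x => gibbsWeight (H x) v := by
  unfold gibbsWeight
  exact (hH v).exp.div (Finset.measurable_fun_sum _ fun v _ => (hH v).exp)

lemma measurable_softmin [Fintype ι] {F : Type*} [MeasurableSpace F] {H : F → ι → ℝ} (β : ℝ)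
    (hH : ∀ v, Measurable fun x => H x v) : Measurable fun x => softmin β (H x) := by
  unfold softmin
  exact ((Finset.measurable_fun_sum _ fun v _ => ((hH v).const_mul (-β)).exp).log).const_mul _

/-- The penalised empirical risk at the weights `w v`, as a function of the blocks `x (i, b)` of the
rows of the design. -/
noncomputable def blockRisk (n : ℝ) (ℓ : I → ℝ → ℝ) (c : ι → ℝ) (w : ι → Fin p → ℝ)
    (x : I × B → Fin p → ℝ) (v : ι) : ℝ :=
  c v + (∑ i, ℓ i (∑ b, x (i, b) ⬝ᵥ w v)) / n

lemma measurable_blockRisk (n : ℝ) {ℓ : I → ℝ → ℝ} (hℓ : ∀ i, Measurable (ℓ i)) (c : ι → ℝ)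
    (w : ι → Fin p → ℝ) (v : ι) :
    Measurable fun x : I × B → Fin p → ℝ => blockRisk n ℓ c w x v := by
  unfold blockRisk
  refine measurable_const.add (Measurable.div_const ?_ n)
  refine Finset.measurable_fun_sum _ fun i _ => (hℓ i).comp ?_
  refine Finset.measurable_fun_sum _ fun b _ => ?_
  unfold dotProduct
  refine Finset.measurable_fun_sum _ fun j _ => Measurable.mul_const ?_ _
  exact (measurable_pi_apply j).comp (measurable_pi_apply (i, b))

set_option linter.unusedSectionVars false

variable [DecidableEq I] [DecidableEq B]

/-- The part of the risk that comes from the rows other than `i`. -/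
noncomputable def restRisk (n : ℝ) (ℓ : I → ℝ → ℝ) (c : ι → ℝ) (w : ι → Fin p → ℝ) (i : I)
    (x : I × B → Fin p → ℝ) (v : ι) : ℝ :=
  c v + (∑ i' ∈ Finset.univ.erase i, ℓ i' (∑ b, x (i', b) ⬝ᵥ w v)) / n

/-- The inner product of the row `a.1` with `w v`, without the block `a.2`. -/
noncomputable def restRow (w : ι → Fin p → ℝ) (a : I × B) (x : I × B → Fin p → ℝ) (v : ι) : ℝ :=
  ∑ j ∈ (Finset.univ.erase a.2).map ⟨fun b => (a.1, b), Prod.mk_right_injective a.1⟩, x j ⬝ᵥ w v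

/-- A block enters only the loss of its own row, and there additively in the argument. This is the
shape `c w + f (v w + y w) / n` to which `softmin_taylor` applies. -/
lemma blockRisk_update (n : ℝ) (ℓ : I → ℝ → ℝ) (c : ι → ℝ) (w : ι → Fin p → ℝ) (a : I × B)
    (x : I × B → Fin p → ℝ) (y : Fin p → ℝ) (v : ι) :
    blockRisk n ℓ c w (Function.update x a y) v
      = restRisk n ℓ c w a.1 x v + ℓ a.1 (restRow w a x v + y ⬝ᵥ w v) / n := by
  obtain ⟨i, b⟩ := a
  unfold blockRisk restRisk restRow
  rw [← Finset.sum_erase_add _ _ (Finset.mem_univ i), ← Finset.sum_erase_add _ _ (Finset.mem_univ b)]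
  have e1 : ∑ i' ∈ Finset.univ.erase i, ℓ i' (∑ b', Function.update x (i, b) y (i', b') ⬝ᵥ w v)
      = ∑ i' ∈ Finset.univ.erase i, ℓ i' (∑ b', x (i', b') ⬝ᵥ w v) := by
    refine Finset.sum_congr rfl fun i' hi' => ?_
    congr 1
    refine Finset.sum_congr rfl fun b' _ => ?_
    rw [Function.update_of_ne]
    intro h
    exact Finset.ne_of_mem_erase hi' (congrArg Prod.fst h)
  have e2 : ∑ b' ∈ Finset.univ.erase b, Function.update x (i, b) y (i, b') ⬝ᵥ w v
      = ∑ b' ∈ Finset.univ.erase b, x (i, b') ⬝ᵥ w v := by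
    refine Finset.sum_congr rfl fun b' hb' => ?_
    rw [Function.update_of_ne]
    intro h
    exact Finset.ne_of_mem_erase hb' (congrArg Prod.snd h)
  rw [e1, e2, Function.update_self, Finset.sum_map]
  simp only [Function.Embedding.coeFn_mk]
  ring

lemma measurable_restRow (w : ι → Fin p → ℝ) (a : I × B) (v : ι) :
    Measurable fun x : I × B → Fin p → ℝ => restRow w a x v := by
  unfold restRow dotProduct
  refine Finset.measurable_fun_sum _ fun i _ => Finset.measurable_fun_sum _ fun j _ =>
    Measurable.mul_const ?_ _
  exact (measurable_pi_apply j).comp (measurable_pi_apply i)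

lemma measurable_restRisk (n : ℝ) {ℓ : I → ℝ → ℝ} (hℓ : ∀ i, Measurable (ℓ i)) (c : ι → ℝ)
    (w : ι → Fin p → ℝ) (i : I) (v : ι) :
    Measurable fun x : I × B → Fin p → ℝ => restRisk n ℓ c w i x v := by
  unfold restRisk
  refine measurable_const.add (Measurable.div_const ?_ n)
  refine Finset.measurable_fun_sum _ fun i _ => (hℓ i).comp ?_
  refine Finset.measurable_fun_sum _ fun b _ => ?_
  unfold dotProduct
  refine Finset.measurable_fun_sum _ fun j _ => Measurable.mul_const ?_ _
  exact (measurable_pi_apply j).comp (measurable_pi_apply (i, b))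

variable [Fintype ι] [Nonempty ι]

/-- The average of the fourth power of a row over the Gibbs measure of the other rows. -/
lemma integral_gibbs_restRow_le {κ : I × B → Measure (Fin p → ℝ)}
    [∀ j, IsProbabilityMeasure (κ j)] (β n : ℝ) {ℓ : I → ℝ → ℝ} (hℓ : ∀ i, Measurable (ℓ i))
    (c : ι → ℝ) {w : ι → Fin p → ℝ} {L s Z4 : ℝ} {t3 t7 s2 s4 : I × B → ℝ} (hs : s ≠ 0)
    (hκ : ∀ j, BlockMoments (κ j) w L s (t3 j) (t7 j) (s2 j) (s4 j))
    (hZ : ∀ i, ∑ b, s4 (i, b) + 3 * (∑ b, s2 (i, b)) ^ 2 ≤ Z4) (a : I × B) :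
    Integrable (fun x => gibbs (fun v => -β * restRisk n ℓ c w a.1 x v)
        (fun v => restRow w a x v ^ 4)) (Measure.pi κ) ∧
      ∫ x, gibbs (fun v => -β * restRisk n ℓ c w a.1 x v) (fun v => restRow w a x v ^ 4)
        ∂(Measure.pi κ) ≤ Z4 := by
  set π : ι → (I × B → Fin p → ℝ) → ℝ :=
    fun v x => gibbsWeight (fun v => -β * restRisk n ℓ c w a.1 x v) v with hπ
  have hπm : ∀ v, Measurable (π v) := fun v =>
    measurable_gibbsWeight (fun v => (measurable_restRisk n hℓ c w a.1 v).const_mul _) v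
  have hπ0 : ∀ v x, 0 ≤ π v x := fun v x => gibbsWeight_nonneg _ _
  have hπi : ∀ v, Integrable (π v) (Measure.pi κ) := fun v =>
    Integrable.of_bound (hπm v).aestronglyMeasurable 1 (Eventually.of_forall fun x => by
      rw [Real.norm_eq_abs, abs_of_nonneg (hπ0 v x)]; exact gibbsWeight_le_one _ _)
  -- fourth moments of a row
  have row : ∀ v, Integrable (fun x => restRow w a x v ^ 4) (Measure.pi κ) ∧
      ∫ x, restRow w a x v ^ 4 ∂(Measure.pi κ) ≤ Z4 := by
    intro v
    have hd : Measurable fun y : Fin p → ℝ => y ⬝ᵥ w v := by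
      unfold dotProduct
      exact Finset.measurable_fun_sum _ fun j _ => (measurable_pi_apply j).mul_const _
    set X : I × B → (I × B → Fin p → ℝ) → ℝ := fun j x => x j ⬝ᵥ w v with hX
    have hXm : ∀ j, Measurable (X j) := fun j => hd.comp (measurable_pi_apply j)
    have ind : iIndepFun X (Measure.pi κ) :=
      iIndepFun_pi (X := fun _ y => y ⬝ᵥ w v) fun j => hd.aemeasurable
    have mp : ∀ j, MeasurePreserving (Function.eval j) (Measure.pi κ) (κ j) := fun j =>
      measurePreserving_eval κ j
    have eint : ∀ j (k : ℕ), ∫ x, X j x ^ k ∂(Measure.pi κ) = ∫ y, (y ⬝ᵥ w v) ^ k ∂(κ j) := by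
      intro j k
      rw [← (mp j).map_eq, integral_map (mp j).measurable.aemeasurable
        (hd.pow_const k).aestronglyMeasurable]
    have h4 : ∀ j, MemLp (X j) (4 : ℕ) (Measure.pi κ) := fun j =>
      ((hκ j).memLp hs v).comp_measurePreserving (mp j)
    have h0 : ∀ j, ∫ x, X j x ∂(Measure.pi κ) = 0 := fun j => by
      have := eint j 1
      simp only [pow_one] at this
      rw [this, (hκ j).integral_eq_zero hs v]
    obtain ⟨m1, -, -, m4⟩ := fourth_moment_sum ind hXm h4 h0
      ((Finset.univ.erase a.2).map ⟨fun b => (a.1, b), Prod.mk_right_injective a.1⟩)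
    have e : ∀ x, restRow w a x v = (∑ j ∈ (Finset.univ.erase a.2).map
        ⟨fun b => (a.1, b), Prod.mk_right_injective a.1⟩, X j) x := fun x => by
      rw [Finset.sum_apply]; rfl
    simp only [e]
    refine ⟨m1.integrable_pow_of_le le_rfl, m4.trans ?_⟩
    simp only [Finset.sum_map, Function.Embedding.coeFn_mk, eint]
    refine le_trans ?_ (hZ a.1)
    have n2 : ∀ b, 0 ≤ ∫ y, (y ⬝ᵥ w v) ^ 2 ∂(κ (a.1, b)) := fun b =>
      integral_nonneg fun y => sq_nonneg _
    have n4 : ∀ b, 0 ≤ ∫ y, (y ⬝ᵥ w v) ^ 4 ∂(κ (a.1, b)) := fun b =>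
      integral_nonneg fun y => by positivity
    have b4 : ∑ b ∈ Finset.univ.erase a.2, ∫ y, (y ⬝ᵥ w v) ^ 4 ∂(κ (a.1, b))
        ≤ ∑ b, s4 (a.1, b) :=
      (Finset.sum_le_sum_of_subset_of_nonneg (Finset.subset_univ _) fun b _ _ => n4 b).trans
        (Finset.sum_le_sum fun b _ => (hκ _).integral_pow_four_le hs v)
    have b2 : ∑ b ∈ Finset.univ.erase a.2, ∫ y, (y ⬝ᵥ w v) ^ 2 ∂(κ (a.1, b))
        ≤ ∑ b, s2 (a.1, b) :=
      (Finset.sum_le_sum_of_subset_of_nonneg (Finset.subset_univ _) fun b _ _ => n2 b).trans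
        (Finset.sum_le_sum fun b _ => (hκ _).integral_sq_le hs v)
    have b2' := pow_le_pow_left₀ (Finset.sum_nonneg fun b _ => n2 b) b2 2
    linarith
  -- The weights see only the rows other than `a.1`, the fourth power only the row `a.1`. Hence the
  -- expectation factorises for each `v`, and the weights, which sum to one, disappear.
  have ind : ∀ v, π v ⟂ᵢ[Measure.pi κ] (fun x => restRow w a x v ^ 4) := by
    intro v
    refine indepFun_pi_of_dependsOn κ (hπm v) ((measurable_restRow w a v).pow_const 4)
      (Finset.univ.filter fun j => j.1 ≠ a.1) (Finset.univ.filter fun j => j.1 = a.1) ?_ ?_ ?_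
    · exact Finset.disjoint_left.2 fun j h1 h2 => by simp at h1 h2; exact h1 h2
    · intro x x' h
      have : restRisk n ℓ c w a.1 x = restRisk n ℓ c w a.1 x' := by
        funext v
        unfold restRisk
        congr 2
        refine Finset.sum_congr rfl fun i hi => ?_
        congr 1
        refine Finset.sum_congr rfl fun b _ => ?_
        rw [h (i, b) (by simpa using Finset.ne_of_mem_erase hi)]
      simp only [hπ, this]
    · intro x x' h
      simp only [restRow, Finset.sum_map, Function.Embedding.coeFn_mk]
      congr 1
      exact Finset.sum_congr rfl fun b _ => by rw [h (a.1, b) (by simp)]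
  have hint : ∀ v, Integrable (fun x => π v x * restRow w a x v ^ 4) (Measure.pi κ) := fun v =>
    (ind v).integrable_mul (hπi v) (row v).1
  refine ⟨integrable_finsetSum _ fun v _ => hint v, ?_⟩
  have e : ∫ x, gibbs (fun v => -β * restRisk n ℓ c w a.1 x v) (fun v => restRow w a x v ^ 4)
        ∂(Measure.pi κ) = ∑ v, (∫ x, π v x ∂(Measure.pi κ)) * ∫ x, restRow w a x v ^ 4 ∂(Measure.pi κ) := by
    unfold gibbs
    rw [integral_finsetSum _ fun v _ => hint v]
    refine Finset.sum_congr rfl fun v _ => ?_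
    exact (ind v).integral_fun_mul_eq_mul_integral (hπm v).aestronglyMeasurable
      ((measurable_restRow w a v).pow_const 4).aestronglyMeasurable
  rw [e]
  calc
    _ ≤ ∑ v, (∫ x, π v x ∂(Measure.pi κ)) * Z4 := Finset.sum_le_sum fun v _ =>
        mul_le_mul_of_nonneg_left (row v).2 (integral_nonneg fun x => hπ0 v x)
    _ = Z4 := by
        rw [← Finset.sum_mul, ← integral_finsetSum _ fun v _ => hπi v]
        simp only [hπ, sum_gibbsWeight]
        simp

/-- Replacing the laws of the blocks of the design by laws with the same first two moments changes
the expectation of a smooth function of the soft minimum of the risk by little. -/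
theorem abs_integral_softmin_blockRisk_sub_le (μ ν : I × B → Measure (Fin p → ℝ))
    [∀ j, IsProbabilityMeasure (μ j)] [∀ j, IsProbabilityMeasure (ν j)]
    (hmatch1 : ∀ a j, (fun y : Fin p → ℝ => y j) ∈ matchedFunctions (μ a) (ν a))
    (hmatch2 : ∀ a j k, (fun y : Fin p → ℝ => y j * y k) ∈ matchedFunctions (μ a) (ν a))
    {n lam C K s L Z4 : ℝ} (hn : 1 ≤ n) (hlam : 1 ≤ lam) (hC : 0 ≤ C) (hK : 0 ≤ K) (hs : 0 ≤ s)
    {ℓ : I → ℕ → ℝ → ℝ} {D : I → ℝ → ℝ} {A : I → ℝ} (hA : ∀ i, 0 ≤ A i)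
    (hℓ : SmoothLosses ℓ D C s A)
    {g : ℕ → ℝ → ℝ} (hg : ∀ k < 3, ∀ x, HasDerivAt (g k) (g (k + 1) x) x)
    (hgK : ∀ k ≤ 3, ∀ x, |g k x| ≤ K) (c : ι → ℝ) {w : ι → Fin p → ℝ} (hL : 0 ≤ L)
    (hw : ∀ v j, |w v j| ≤ L) {t3 t7 s2 s4 : I × B → ℝ} (hZ0 : 0 ≤ Z4)
    (hμ : ∀ j, BlockMoments (μ j) w L s (t3 j) (t7 j) (s2 j) (s4 j))
    (hν : ∀ j, BlockMoments (ν j) w L s (t3 j) (t7 j) (s2 j) (s4 j))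
    (hZ : ∀ i, ∑ b, s4 (i, b) + 3 * (∑ b, s2 (i, b)) ^ 2 ≤ Z4) :
    |∫ x, g 0 (softmin (n * lam) (blockRisk n (fun i => ℓ i 0) c w x)) ∂(Measure.pi μ)
      - ∫ x, g 0 (softmin (n * lam) (blockRisk n (fun i => ℓ i 0) c w x)) ∂(Measure.pi ν)|
      ≤ 23 * K * (1 + C) * lam ^ 2 / n *
        ∑ a : I × B, (2 * t3 a * (1 + A a.1 + 8 * s * Z4) + 16 * s * t7 a) := by
  have hn0 : 0 < n := by linarith
  set C0 := 23 * K * (1 + C) * lam ^ 2 / n with hC0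
  have hC00 : 0 ≤ C0 := by positivity
  have hℓm : ∀ i, Measurable (ℓ i 0) := fun i =>
    (continuous_iff_continuousAt.2 fun x => (hℓ.hasDerivAt i 0 (by norm_num) x).continuousAt).measurable
  have hgm : Measurable (g 0) :=
    (continuous_iff_continuousAt.2 fun x => (hg 0 (by norm_num) x).continuousAt).measurable
  set f : (I × B → Fin p → ℝ) → ℝ :=
    fun x => g 0 (softmin (n * lam) (blockRisk n (fun i => ℓ i 0) c w x)) with hf
  have hfm : Measurable f := hgm.comp
    (measurable_softmin _ fun v => measurable_blockRisk n hℓm c w v)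
  set Y : (Fin p → ℝ) → ℝ := fun y => L * ∑ j, |y j| with hY
  have hY0 : ∀ y, 0 ≤ Y y := fun y => mul_nonneg hL (Finset.sum_nonneg fun j _ => abs_nonneg _)
  -- `V` is the part of `1 + Q` that is free of the inserted block. The other part, `8 s Y ^ 4`, is
  -- multiplied by `Y ^ 3` and becomes the seventh moment in `W`. The factor `8` comes from `(a + b)
  -- ^ 4 ≤ 8 (a ^ 4 + b ^ 4)`.
  set V : I × B → (I × B → Fin p → ℝ) → ℝ := fun a x => 1 + A a.1 + 8 * s *
    gibbs (fun v => -(n * lam) * restRisk n (fun i => ℓ i 0) c w a.1 x v)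
      (fun v => restRow w a x v ^ 4) with hV
  have main := abs_integral_pi_sub_le μ ν hfm (fun x => hgK 0 (by norm_num) _)
    (U := fun _ y => C0 * Y y ^ 3) (W := fun _ y => C0 * (8 * (s * Y y ^ 7))) (V := V)
    (v := fun a => 1 + A a.1 + 8 * s * Z4)
    (fun a => (hμ a).integrable_three.const_mul C0) (fun a => (hν a).integrable_three.const_mul C0)
    ?_ ?_ (fun a y => mul_nonneg hC00 (pow_nonneg (hY0 y) 3)) ?_ ?_
  · refine main.trans ?_
    rw [Finset.mul_sum]
    refine Finset.sum_le_sum fun a _ => ?_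
    have hb : ∀ (κ : Measure (Fin p → ℝ)), BlockMoments κ w L s (t3 a) (t7 a) (s2 a) (s4 a) →
        ∫ y, C0 * Y y ^ 3 ∂κ ≤ C0 * t3 a ∧ ∫ y, C0 * (8 * (s * Y y ^ 7)) ∂κ ≤ C0 * (8 * (s * t7 a)) := by
      intro κ hκ
      rw [integral_const_mul, integral_const_mul, integral_const_mul, integral_const_mul]
      refine ⟨mul_le_mul_of_nonneg_left hκ.integral_three_le hC00,
        mul_le_mul_of_nonneg_left (mul_le_mul_of_nonneg_left ?_ (by norm_num)) hC00⟩
      rcases eq_or_ne s 0 with h0 | h0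
      · simp [h0]
      · exact mul_le_mul_of_nonneg_left (hκ.integral_seven_le h0) hs
    obtain ⟨u1, v1⟩ := hb _ (hμ a)
    obtain ⟨u2, v2⟩ := hb _ (hν a)
    have hv0 : 0 ≤ 1 + A a.1 + 8 * s * Z4 := by have := hA a.1; positivity
    have := mul_le_mul_of_nonneg_right (add_le_add u1 u2) hv0
    refine (add_le_add this (add_le_add v1 v2)).trans_eq ?_
    ring
  · intro a
    rcases eq_or_ne s 0 with h0 | h0
    · simp [h0]
    · exact ((((hμ a).integrable_seven h0).const_mul s).const_mul 8).const_mul C0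
  · intro a
    rcases eq_or_ne s 0 with h0 | h0
    · simp [h0]
    · exact ((((hν a).integrable_seven h0).const_mul s).const_mul 8).const_mul C0
  · intro κ hκp hκ a
    rcases eq_or_ne s 0 with h0 | h0
    · simp [hV, h0]
    · have hκm : ∀ j, BlockMoments (κ j) w L s (t3 j) (t7 j) (s2 j) (s4 j) := by
        intro j
        rcases hκ j with h | h <;> rw [h]
        exacts [hμ j, hν j]
      obtain ⟨r1, r2⟩ := integral_gibbs_restRow_le (n * lam) n hℓm c h0 hκm hZ a
      refine ⟨(integrable_const _).add (r1.const_mul (8 * s)), ?_⟩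
      simp only [hV]
      rw [integral_add (integrable_const _) (r1.const_mul (8 * s)), integral_const_mul, integral_const]
      simp only [probReal_univ, one_smul]
      have := mul_le_mul_of_nonneg_left r2 (by positivity : 0 ≤ 8 * s)
      linarith
  · intro a x
    obtain ⟨T1, T2, hT⟩ := softmin_taylor hn hlam hC hK (hℓ.hasDerivAt a.1) (hℓ.abs_second_le a.1)
      (hℓ.abs_third_le a.1) hg hgK (restRisk n (fun i => ℓ i 0) c w a.1 x) (restRow w a x)
    refine ⟨fun y => ∑ v, T1 v * (y ⬝ᵥ w v) + ∑ v, ∑ v', T2 v v' * ((y ⬝ᵥ w v) * (y ⬝ᵥ w v')), ?_,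
      g 0 (softmin (n * lam) fun v => restRisk n (fun i => ℓ i 0) c w a.1 x v
        + ℓ a.1 0 (restRow w a x v) / n), fun y => ?_⟩
    · have e : (fun y : Fin p → ℝ => ∑ v, T1 v * (y ⬝ᵥ w v)
          + ∑ v, ∑ v', T2 v v' * ((y ⬝ᵥ w v) * (y ⬝ᵥ w v')))
          = ∑ v, T1 v • (fun y : Fin p → ℝ => y ⬝ᵥ w v)
            + ∑ v, ∑ v', T2 v v' • (fun y : Fin p → ℝ => (y ⬝ᵥ w v) * (y ⬝ᵥ w v')) := by
        funext y; simp [Finset.sum_apply]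
      rw [e]
      refine Submodule.add_mem _ (Submodule.sum_mem _ fun v _ => Submodule.smul_mem _ _
        (dotProduct_mem_matchedFunctions (hmatch1 a) _)) ?_
      exact Submodule.sum_mem _ fun v _ => Submodule.sum_mem _ fun v' _ => Submodule.smul_mem _ _
        (dotProduct_mul_mem_matchedFunctions (hmatch2 a) _ _)
    · have hyY : ∀ v, |y ⬝ᵥ w v| ≤ Y y := fun v => abs_dotProduct_le (hw v)
      have hfu : f (Function.update x a y) = g 0 (softmin (n * lam) fun v =>
          restRisk n (fun i => ℓ i 0) c w a.1 x v + ℓ a.1 0 (restRow w a x v + y ⬝ᵥ w v) / n) := by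
        simp only [hf]
        congr 2
        funext v
        rw [blockRisk_update]
      rw [hfu]
      refine (hT (fun v => y ⬝ᵥ w v) (Y y) (A a.1 + 8 * s * Y y ^ 4 + 8 * s *
        gibbs (fun v => -(n * lam) * restRisk n (fun i => ℓ i 0) c w a.1 x v)
          (fun v => restRow w a x v ^ 4)) hyY ?_).trans_eq ?_
      · intro t ht
        have hE : riskLogDensity (n * lam) n (ℓ a.1 0) (restRisk n (fun i => ℓ i 0) c w a.1 x)
            (fun v => restRow w a x v + t * (y ⬝ᵥ w v))
            = fun v => -(n * lam) * restRisk n (fun i => ℓ i 0) c w a.1 x v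
              - lam * ℓ a.1 0 (restRow w a x v + t * (y ⬝ᵥ w v)) := by
          funext v
          unfold riskLogDensity
          field_simp
          ring
        rw [hE]
        refine (gibbs_mono _ fun v => hℓ.abs_first_pow_le a.1 _).trans ?_
        -- Association: `D` increases with the loss of row `a.1`, so removing the tilt `exp (-lam
        -- ℓ)` of that loss can only raise the average. This decouples the Gibbs measure from the
        -- row whose derivative is being averaged.
        refine (gibbs_sub_le_of_monovary _ (fun v => lam * ℓ a.1 0 (restRow w a x v + t * (y ⬝ᵥ w v)))
          (fun v => D a.1 (restRow w a x v + t * (y ⬝ᵥ w v))) fun v v' h =>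
            hℓ.mono a.1 _ _ (le_of_mul_le_mul_left h (by linarith))).trans ?_
        have hpt : ∀ v, D a.1 (restRow w a x v + t * (y ⬝ᵥ w v))
            ≤ (A a.1 + 8 * s * Y y ^ 4) + 8 * s * restRow w a x v ^ 4 := by
          intro v
          refine (hℓ.le a.1 _).trans ?_
          have h1 : (restRow w a x v + t * (y ⬝ᵥ w v)) ^ 4
              ≤ 8 * (restRow w a x v ^ 4 + (t * (y ⬝ᵥ w v)) ^ 4) := by
            nlinarith [sq_nonneg (restRow w a x v ^ 2 - (t * (y ⬝ᵥ w v)) ^ 2),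
              mul_nonneg (sq_nonneg (restRow w a x v - t * (y ⬝ᵥ w v)))
                (add_nonneg (sq_nonneg (restRow w a x v + t * (y ⬝ᵥ w v)))
                  (add_nonneg (sq_nonneg (restRow w a x v)) (sq_nonneg (t * (y ⬝ᵥ w v)))))]
          have h2 : (t * (y ⬝ᵥ w v)) ^ 4 ≤ Y y ^ 4 := by
            have e : (t * (y ⬝ᵥ w v)) ^ 4 = |t * (y ⬝ᵥ w v)| ^ 4 := by
              rw [← abs_pow, abs_of_nonneg (by positivity)]
            rw [e]
            refine pow_le_pow_left₀ (abs_nonneg _) ?_ 4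
            rw [abs_mul, abs_of_nonneg ht.1]
            exact (mul_le_of_le_one_left (abs_nonneg _) ht.2).trans (hyY v)
          have := mul_le_mul_of_nonneg_left (h1.trans (mul_le_mul_of_nonneg_left
            (add_le_add_right h2 _) (by norm_num))) hs
          linarith
        refine (gibbs_mono _ hpt).trans_eq ?_
        rw [gibbs_add, gibbs_const, gibbs_mul]
      · simp only [hV, hC0]
        field_simp
        ring

end BlockReplacement

/-! ### Discretisation and measurability of the minimal risk -/

section Discretisation

variable {p : ℕ}

/-- A finite convex function on `ℝ^p` is continuous, hence bounded below on the compact cube.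
Convexity of the regulariser serves no other purpose. -/
lemma bddBelow_image_of_convexOn {R : (Fin p → ℝ) → ℝ} (hR : ConvexOn ℝ Set.univ R)
    {S : Set (Fin p → ℝ)} {L : ℝ} (hS : ∀ w ∈ S, ∀ j, w j ∈ Set.Icc (-L) L) :
    BddBelow (R '' S) := by
  have hc : Continuous R := hR.locallyLipschitz.continuous
  have hK : IsCompact (Set.Icc (fun _ : Fin p => -L) (fun _ => L)) := isCompact_Icc
  refine (hK.bddBelow_image hc.continuousOn).mono (Set.image_mono fun w hw => ?_)
  exact ⟨fun j => (hS w hw j).1, fun j => (hS w hw j).2⟩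

/-- The points `w v` of `S`, with the penalties `c v`, approximate the minimisation over `S` of `h + R`
for every `h` that varies little on the scale `δ`. -/
def IsSoftminNet (R : (Fin p → ℝ) → ℝ) (S : Set (Fin p → ℝ)) (δ : ℝ) {T : Finset (Fin p → ℤ)}
    (w : T → Fin p → ℝ) (c : T → ℝ) : Prop :=
  ∀ (h h' : (Fin p → ℝ) → ℝ) (η ε β : ℝ), 0 < β → (∀ u, 0 ≤ h u) →
    (∀ u ∈ S, ∀ u' ∈ S, (∀ j, |u j - u' j| ≤ δ) → |h u - h u'| ≤ η) →
    (∀ u, |h' u - h u| ≤ ε) →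
    |(⨅ u : S, (h u + R u)) - softmin β (fun v => c v + h' (w v))| ≤ η + ε + Real.log T.card / β

/-- The infimum of `h + R` over a bounded set is close to a soft minimum over a finite net, whatever
the regularity of `R`. -/
theorem exists_softmin_approx {R : (Fin p → ℝ) → ℝ} {S : Set (Fin p → ℝ)} (hSne : S.Nonempty)
    (hRS : BddBelow (R '' S)) {L : ℝ} (hS : ∀ w ∈ S, ∀ j, w j ∈ Set.Icc (-L) L) {δ : ℝ}
    (hδ : 0 < δ) :
    ∃ T : Finset (Fin p → ℤ), T.Nonempty ∧ Real.log T.card ≤ p * Real.log (2 * L / δ + 2) ∧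
      ∃ (w : T → Fin p → ℝ) (c : T → ℝ), (∀ v, w v ∈ S) ∧
        IsSoftminNet R S δ w c := by
  classical
  set cell : (Fin p → ℝ) → Fin p → ℤ := fun u j => ⌊u j / δ⌋ with hcell
  set T : Finset (Fin p → ℤ) := (Fintype.piFinset fun _ : Fin p => Finset.Icc ⌊-L / δ⌋ ⌊L / δ⌋).filter
    (fun v => ∃ u ∈ S, cell u = v) with hT
  have hcT : ∀ u ∈ S, cell u ∈ T := by
    intro u hu
    simp only [hT, Finset.mem_filter, Fintype.mem_piFinset, Finset.mem_Icc]
    refine ⟨fun j => ⟨Int.floor_le_floor ?_, Int.floor_le_floor ?_⟩, u, hu, rfl⟩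
    · exact div_le_div_of_nonneg_right (hS u hu j).1 hδ.le
    · exact div_le_div_of_nonneg_right (hS u hu j).2 hδ.le
  obtain ⟨u0, hu0⟩ := hSne
  have hTne : T.Nonempty := ⟨_, hcT u0 hu0⟩
  have hTu : ∀ v : T, ∃ u ∈ S, cell u = v := fun v => (Finset.mem_filter.1 v.2).2
  choose w hwS hwc using hTu
  have hclose : ∀ u u', cell u = cell u' → ∀ j, |u j - u' j| ≤ δ := by
    intro u u' h j
    have h1 : |u j / δ - u' j / δ| < 1 := Int.abs_sub_lt_one_of_floor_eq_floor (congrFun h j)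
    rw [← sub_div, abs_div, abs_of_pos hδ, div_lt_one hδ] at h1
    exact h1.le
  -- The penalty is the infimum of `R` over the cell, not `R (w v)`. As `h` changes by at most `η`
  -- inside a cell, the infimum of `h + R` there is within `η` of `h (w v)` plus this penalty,
  -- however irregular `R` is.
  refine ⟨T, hTne, ?_, w, fun v => sInf (R '' {u ∈ S | cell u = v}), hwS, ?_⟩
  -- Without coordinates `hS` does not force `0 ≤ L`, so the count of cells has to be done
  -- separately.
  · rcases Nat.eq_zero_or_pos p with hp | hp
    · subst hp
      have : T.card ≤ 1 := Finset.card_le_one.2 fun a _ b _ => Subsingleton.elim a b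
      have h1 : (T.card : ℝ) ≤ 1 := by exact_mod_cast this
      simpa using Real.log_nonpos (Nat.cast_nonneg _) h1
    have hL0 : 0 ≤ L := by
      have := hS u0 hu0 ⟨0, hp⟩
      linarith [this.1, this.2]
    have hcard : T.card ≤ (Finset.Icc ⌊-L / δ⌋ ⌊L / δ⌋).card ^ p := by
      refine (Finset.card_filter_le _ _).trans ?_
      simp
    have hIcc : ((Finset.Icc ⌊-L / δ⌋ ⌊L / δ⌋).card : ℝ) ≤ 2 * L / δ + 2 := by
      rw [Int.card_Icc]
      have h1 : ⌊-L / δ⌋ ≤ ⌊L / δ⌋ :=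
        Int.floor_le_floor (div_le_div_of_nonneg_right (by linarith) hδ.le)
      have h2 : ((⌊L / δ⌋ + 1 - ⌊-L / δ⌋).toNat : ℝ) = ((⌊L / δ⌋ + 1 - ⌊-L / δ⌋ : ℤ) : ℝ) := by
        rw [← Int.cast_natCast, Int.toNat_of_nonneg (by omega)]
      rw [h2]
      push_cast
      have h3 := Int.floor_le (L / δ)
      have h4 := Int.lt_floor_add_one (-L / δ)
      have h5 : 2 * L / δ = L / δ - -L / δ := by ring
      linarith
    have hpos : (0 : ℝ) < T.card := by exact_mod_cast hTne.card_pos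
    have h1 : (T.card : ℝ) ≤ (2 * L / δ + 2) ^ p := by
      calc (T.card : ℝ) ≤ ((Finset.Icc ⌊-L / δ⌋ ⌊L / δ⌋).card : ℝ) ^ p := by exact_mod_cast hcard
        _ ≤ _ := pow_le_pow_left₀ (Nat.cast_nonneg _) hIcc p
    refine (Real.log_le_log hpos h1).trans_eq ?_
    rw [Real.log_pow]
  · intro h h' η ε β hβ h0 hη hε
    have : Nonempty T := hTne.to_subtype
    have : Nonempty S := ⟨⟨u0, hu0⟩⟩
    have hbdd : BddBelow (Set.range fun u : S => h u + R u) := by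
      obtain ⟨m, hm⟩ := hRS
      refine ⟨m, ?_⟩
      rintro _ ⟨u, rfl⟩
      have := hm ⟨u, u.2, rfl⟩
      have := h0 u
      linarith
    set m := ⨅ u : S, (h u + R u) with hm
    set c : T → ℝ := fun v => sInf (R '' {u ∈ S | cell u = v}) with hc
    have up : ∀ v, m ≤ h (w v) + c v + η := by
      intro v
      have : m - h (w v) - η ≤ c v := by
        refine le_csInf ⟨_, w v, ⟨hwS v, hwc v⟩, rfl⟩ ?_
        rintro _ ⟨u, ⟨huS, huc⟩, rfl⟩
        have h1 : m ≤ h u + R u := ciInf_le hbdd ⟨u, huS⟩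
        have h2 := (abs_le.1 (hη u huS (w v) (hwS v) (hclose _ _ (huc.trans (hwc v).symm)))).2
        linarith
      linarith
    have lo : ∀ m', (∀ v, m' ≤ h (w v) + c v) → m' - η ≤ m := by
      intro m' hm'
      refine le_ciInf fun u => ?_
      have h1 := hm' ⟨cell u, hcT u u.2⟩
      have h2 : c ⟨cell u, hcT u u.2⟩ ≤ R u :=
        csInf_le (hRS.mono (Set.image_mono fun _ h => h.1)) ⟨u, ⟨u.2, rfl⟩, rfl⟩
      have h3 := (abs_le.1 (hη _ (hwS ⟨cell u, hcT u u.2⟩) u u.2 (hclose _ _ (hwc _)))).2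
      linarith
    have hcard : Real.log (Fintype.card T) = Real.log T.card := by simp
    rw [abs_le]
    constructor
    · have h1 := lo (softmin β (fun v => c v + h' (w v)) - ε) fun v => by
        have h2 := softmin_le hβ (fun v => c v + h' (w v)) v
        have h3 := (abs_le.1 (hε (w v))).2
        linarith
      have h4 : 0 ≤ Real.log T.card / β :=
        div_nonneg (Real.log_nonneg (by exact_mod_cast hTne.card_pos)) hβ.le
      linarith
    · have h1 := le_softmin hβ (H := fun v => c v + h' (w v)) (m := m - η - ε) fun v => by
        have h2 := up v
        have h3 := (abs_le.1 (hε (w v))).1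
        linarith
      rw [hcard] at h1
      linarith

/-- The infimum runs over an arbitrary set, but a strict sublevel set of it is a union of open sets,
since for a fixed weight the risk is continuous in the design and the noise jointly. -/
lemma measurable_minRisk {n : ℕ} {ell0 : ℝ → ℝ} (hc : Continuous ell0) (h0 : ∀ u, 0 ≤ ell0 u)
    {R : (Fin p → ℝ) → ℝ} {S : Set (Fin p → ℝ)} (hSne : S.Nonempty) (hRS : BddBelow (R '' S)) :
    Measurable fun z : (Fin n → Fin p → ℝ) × (Fin n → ℝ) => minRisk (noisyLoss ell0 z.2) R S z.1 := by
  have : Nonempty S := hSne.to_subtype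
  refine measurable_of_Iio fun a => ?_
  have hbdd : ∀ z : (Fin n → Fin p → ℝ) × (Fin n → ℝ),
      BddBelow (Set.range fun w : S => empRisk (noisyLoss ell0 z.2) R z.1 w) := by
    intro z
    obtain ⟨m, hm⟩ := hRS
    refine ⟨m, ?_⟩
    rintro _ ⟨u, rfl⟩
    have h1 := hm ⟨u, u.2, rfl⟩
    have h2 : 0 ≤ Av fun i => noisyLoss ell0 z.2 i (∑ j, z.1 i j * (u : Fin p → ℝ) j) :=
      mul_nonneg (by positivity) (Finset.sum_nonneg fun i _ => h0 _)
    simp only [empRisk]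
    linarith
  have e : (fun z : (Fin n → Fin p → ℝ) × (Fin n → ℝ) => minRisk (noisyLoss ell0 z.2) R S z.1) ⁻¹'
      Set.Iio a = ⋃ w : S, {z | empRisk (noisyLoss ell0 z.2) R z.1 w < a} := by
    ext z
    simp only [Set.mem_preimage, Set.mem_Iio, Set.mem_iUnion, Set.mem_ofPred_eq]
    exact ciInf_lt_iff (hbdd z)
  rw [e]
  refine (isOpen_iUnion fun w => isOpen_lt ?_ continuous_const).measurableSet
  unfold empRisk Av noisyLoss
  refine (continuous_const.mul (continuous_finsetSum _ fun i _ => hc.comp ?_)).add continuous_const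
  fun_prop

end Discretisation

/-! ### Laws and moments of the blocks of a design -/

section BlockLaws

open scoped Matrix

set_option linter.unusedSectionVars false

variable {Ω : Type*} [MeasurableSpace Ω] {P : Measure Ω} [IsProbabilityMeasure P] {p : ℕ}

/-- The vector `u` restricted to the cell `b` of the partition given by the fibres of `c`. -/
def maskBlock {B : Type*} [DecidableEq B] (c : Fin p → B) (b : B) (u : Fin p → ℝ) : Fin p → ℝ :=
  fun j => if c j = b then u j else 0

section MaskBlock

variable {B : Type*} [DecidableEq B] (c : Fin p → B)

lemma measurable_maskBlock (b : B) : Measurable (maskBlock c b) := by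
  refine measurable_pi_lambda _ fun j => ?_
  unfold maskBlock
  by_cases h : c j = b
  · simpa [h] using measurable_pi_apply j
  · simp [h]

lemma maskBlock_dotProduct (b : B) (u w : Fin p → ℝ) :
    maskBlock c b u ⬝ᵥ w = u ⬝ᵥ maskBlock c b w := by
  unfold dotProduct maskBlock
  exact Finset.sum_congr rfl fun j _ => by split_ifs <;> simp

lemma sum_maskBlock_dotProduct [Fintype B] (u w : Fin p → ℝ) :
    ∑ b, maskBlock c b u ⬝ᵥ w = u ⬝ᵥ w := by
  unfold dotProduct maskBlock
  rw [Finset.sum_comm]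
  exact Finset.sum_congr rfl fun j _ => by simp

lemma sum_abs_maskBlock (b : B) (u : Fin p → ℝ) :
    ∑ j, |maskBlock c b u j| = ∑ j ∈ Finset.univ.filter (fun j => c j = b), |u j| := by
  rw [Finset.sum_filter]
  exact Finset.sum_congr rfl fun j _ => by unfold maskBlock; split_ifs <;> simp

lemma sum_card_fibre [Fintype B] :
    ∑ b, (Finset.univ.filter (fun j => c j = b)).card = p := by
  have := Finset.card_eq_sum_card_fiberwise (f := c) (s := Finset.univ) (t := Finset.univ)
    (fun _ _ => Finset.mem_coe.2 (Finset.mem_univ _))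
  simpa using this.symm

/-- The law of the family of all blocks of all rows of a design is a product measure. -/
lemma map_blocks_eq_pi [Fintype B] {n : ℕ} {X : Ω → Fin n → Fin p → ℝ} (hm : Measurable X)
    (hrow : iIndepFun (fun i ω => X ω i) P)
    (hblk : ∀ i, iIndepFun (fun (b : B) (ω : Ω) (j : {j : Fin p // c j = b}) => X ω i j) P) :
    P.map (fun ω (a : Fin n × B) => maskBlock c a.2 (X ω a.1))
      = Measure.pi fun a : Fin n × B => P.map fun ω => maskBlock c a.2 (X ω a.1) := by
  have hXi : ∀ i, Measurable fun ω => X ω i := fun i => (measurable_pi_apply i).comp hm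
  have hm' : ∀ i b, Measurable fun ω => maskBlock c b (X ω i) := fun i b =>
    (measurable_maskBlock c b).comp (hXi i)
  have h1 : iIndepFun (fun i ω (b : B) => maskBlock c b (X ω i)) P :=
    hrow.comp (fun _ u b => maskBlock c b u) fun _ =>
      measurable_pi_lambda _ fun b => measurable_maskBlock c b
  have h2 : ∀ i, iIndepFun (fun (b : B) ω => maskBlock c b (X ω i)) P := by
    intro i
    have := (hblk i).comp (fun b (r : {j : Fin p // c j = b} → ℝ) (j : Fin p) =>
      if h : c j = b then r ⟨j, h⟩ else 0) fun b => by
        refine measurable_pi_lambda _ fun j => ?_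
        by_cases h : c j = b
        · simpa [h] using measurable_pi_apply _
        · simp [h]
    convert this using 2 with b
    funext ω j
    simp [maskBlock]
  have h3 := iIndepFun_uncurry' (X := fun i b ω => maskBlock c b (X ω i)) hm' h1 h2
  exact (iIndepFun_iff_map_fun_eq_pi_map fun a : Fin n × B => (hm' a.1 a.2).aemeasurable).1 h3

end MaskBlock

/-- Moment bounds for a row of a design of `n` rows. -/
structure RowMoments (P : Measure Ω) (n : ℕ) (Sig : Matrix (Fin p) (Fin p) ℝ) (A s : ℝ)
    (u : Ω → Fin p → ℝ) : Prop where
  measurable : Measurable u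
  mean : ∀ j, Integrable (fun ω => u ω j) P ∧ ∫ ω, u ω j ∂P = 0
  second : ∀ j k, Integrable (fun ω => u ω j * u ω k) P ∧ ∫ ω, u ω j * u ω k ∂P = Sig j k / n
  memLp_three : ∀ j, MemLp (fun ω => u ω j) (3 : ℕ) P
  three_le : ∀ j, ∫ ω, |u ω j| ^ 3 ∂P ≤ A / √n ^ 3
  memLp_seven : s ≠ 0 → ∀ j, MemLp (fun ω => u ω j) (7 : ℕ) P
  four_le : s ≠ 0 → ∀ j, ∫ ω, |u ω j| ^ 4 ∂P ≤ A / √n ^ 4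
  seven_le : s ≠ 0 → ∀ j, ∫ ω, |u ω j| ^ 7 ∂P ≤ A / √n ^ 7

variable {n : ℕ} {Sig : Matrix (Fin p) (Fin p) ℝ} {A s : ℝ}

lemma RowMoments.integral_dotProduct_sq {u : Ω → Fin p → ℝ} (hu : RowMoments P n Sig A s u)
    (w : Fin p → ℝ) : ∫ ω, (u ω ⬝ᵥ w) ^ 2 ∂P = (w ⬝ᵥ Sig *ᵥ w) / n := by
  have e : ∀ ω, (u ω ⬝ᵥ w) ^ 2 = ∑ j, ∑ k, (w j * w k) * (u ω j * u ω k) := by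
    intro ω
    simp only [dotProduct, sq, Finset.sum_mul_sum]
    exact Finset.sum_congr rfl fun j _ => Finset.sum_congr rfl fun k _ => by ring
  simp only [e]
  rw [integral_finsetSum _ fun j _ => integrable_finsetSum _ fun k _ => (hu.second j k).1.const_mul _]
  simp only [dotProduct, Matrix.mulVec, Finset.mul_sum, Finset.sum_div]
  refine Finset.sum_congr rfl fun j _ => ?_
  rw [integral_finsetSum _ fun k _ => (hu.second j k).1.const_mul _]
  refine Finset.sum_congr rfl fun k _ => ?_
  rw [integral_const_mul, (hu.second j k).2]
  ring

/-- Power mean inequality. Only the factor `card ^ m` is bounded through `d`; the last `F.card` is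
kept, because the cell sizes sum to `p`, whereas `d` times the number of cells may be much larger.
-/
lemma integral_pow_sum_abs_le {u : Ω → Fin p → ℝ} {m d : ℕ} {L a : ℝ} (hL : 0 ≤ L)
    (F : Finset (Fin p)) (hF : F.card ≤ d)
    (hint : ∀ j, Integrable (fun ω => |u ω j| ^ (m + 1)) P)
    (hle : ∀ j, ∫ ω, |u ω j| ^ (m + 1) ∂P ≤ a) (hm : Measurable u) :
    Integrable (fun ω => (L * ∑ j ∈ F, |u ω j|) ^ (m + 1)) P ∧
      ∫ ω, (L * ∑ j ∈ F, |u ω j|) ^ (m + 1) ∂P ≤ L ^ (m + 1) * d ^ m * (F.card * a) := by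
  have hpt : ∀ ω, (L * ∑ j ∈ F, |u ω j|) ^ (m + 1)
      ≤ L ^ (m + 1) * d ^ m * ∑ j ∈ F, |u ω j| ^ (m + 1) := by
    intro ω
    rw [mul_pow, mul_assoc]
    refine mul_le_mul_of_nonneg_left ?_ (by positivity)
    refine (pow_sum_le_card_mul_sum_pow (fun j _ => abs_nonneg _) m).trans ?_
    refine mul_le_mul_of_nonneg_right ?_ (Finset.sum_nonneg fun j _ => by positivity)
    exact pow_le_pow_left₀ (Nat.cast_nonneg _) (by exact_mod_cast hF) m
  have hS : Integrable (fun ω => L ^ (m + 1) * d ^ m * ∑ j ∈ F, |u ω j| ^ (m + 1)) P :=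
    (integrable_finsetSum _ fun j _ => hint j).const_mul _
  have h0 : ∀ ω, 0 ≤ (L * ∑ j ∈ F, |u ω j|) ^ (m + 1) := fun ω =>
    pow_nonneg (mul_nonneg hL (Finset.sum_nonneg fun j _ => abs_nonneg _)) _
  have hmeas : Measurable fun ω => (L * ∑ j ∈ F, |u ω j|) ^ (m + 1) := by
    refine (Measurable.const_mul ?_ L).pow_const _
    exact Finset.measurable_fun_sum _ fun j _ => ((measurable_pi_apply j).comp hm).abs
  refine ⟨hS.mono' hmeas.aestronglyMeasurable (Eventually.of_forall fun ω => ?_), ?_⟩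
  · rw [Real.norm_eq_abs, abs_of_nonneg (h0 ω)]; exact hpt ω
  · refine (integral_mono_of_nonneg (Eventually.of_forall h0) hS (Eventually.of_forall hpt)).trans ?_
    rw [integral_const_mul, integral_finsetSum _ fun j _ => hint j]
    refine mul_le_mul_of_nonneg_left ?_ (by positivity)
    refine (Finset.sum_le_sum fun j _ => hle j).trans_eq ?_
    simp

/-- The second moment is taken through the bound on the quadratic form of `Sig`, which costs no
power of `d`; summed over the cells it gives a row variance of at most `M p L² / n`. The other
moments use the power mean bound. -/
lemma RowMoments.blockMoments {u : Ω → Fin p → ℝ} (hu : RowMoments P n Sig A s u) {M : ℝ}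
    (hM : 0 ≤ M) (hq : ∀ w : Fin p → ℝ, w ⬝ᵥ Sig *ᵥ w ≤ M * (w ⬝ᵥ w)) {B ι : Type*} [DecidableEq B]
    (c : Fin p → B) (b : B) {d : ℕ} (hd : (Finset.univ.filter (fun j => c j = b)).card ≤ d) {L : ℝ}
    (hL : 0 ≤ L) {w : ι → Fin p → ℝ} (hw : ∀ v j, |w v j| ≤ L) :
    BlockMoments (P.map fun ω => maskBlock c b (u ω)) w L s
      (L ^ 3 * d ^ 2 * ((Finset.univ.filter (fun j => c j = b)).card * (A / √n ^ 3)))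
      (L ^ 7 * d ^ 6 * ((Finset.univ.filter (fun j => c j = b)).card * (A / √n ^ 7)))
      (M * ((Finset.univ.filter (fun j => c j = b)).card * L ^ 2) / n)
      (L ^ 4 * d ^ 3 * ((Finset.univ.filter (fun j => c j = b)).card * (A / √n ^ 4))) := by
  have hm : Measurable fun ω => maskBlock c b (u ω) := (measurable_maskBlock c b).comp hu.measurable
  have hY : Measurable fun y : Fin p → ℝ => L * ∑ j, |y j| :=
    Measurable.const_mul (Finset.measurable_fun_sum _ fun j _ => (measurable_pi_apply j).abs) L
  have hdot : ∀ v, Measurable fun y : Fin p → ℝ => y ⬝ᵥ w v := fun v => by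
    unfold dotProduct
    exact Finset.measurable_fun_sum _ fun j _ => (measurable_pi_apply j).mul_const _
  have hYe : ∀ k : ℕ, (fun ω => (L * ∑ j, |maskBlock c b (u ω) j|) ^ k)
      = fun ω => (L * ∑ j ∈ Finset.univ.filter (fun j => c j = b), |u ω j|) ^ k := fun k => by
    funext ω; rw [sum_abs_maskBlock]
  have k3 := integral_pow_sum_abs_le (m := 2) hL _ hd
    (fun j => (hu.memLp_three j).integrable_abs_pow_of_le le_rfl) hu.three_le hu.measurable
  have k4 : s ≠ 0 → _ := fun hs => integral_pow_sum_abs_le (m := 3) hL _ hd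
    (fun j => (hu.memLp_seven hs j).integrable_abs_pow_of_le (by norm_num)) (hu.four_le hs)
    hu.measurable
  have k7 : s ≠ 0 → _ := fun hs => integral_pow_sum_abs_le (m := 6) hL _ hd
    (fun j => (hu.memLp_seven hs j).integrable_abs_pow_of_le le_rfl) (hu.seven_le hs) hu.measurable
  have hdle : ∀ v ω, |maskBlock c b (u ω) ⬝ᵥ w v|
      ≤ L * ∑ j ∈ Finset.univ.filter (fun j => c j = b), |u ω j| := fun v ω => by
    rw [← sum_abs_maskBlock]; exact abs_dotProduct_le (hw v)
  refine ⟨?_, ?_, ?_, ?_, ?_, ?_, ?_, ?_⟩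
  · rw [integrable_map_measure (hY.pow_const 3).aestronglyMeasurable hm.aemeasurable,
      Function.comp_def, hYe 3]
    exact k3.1
  · rw [integral_map hm.aemeasurable (hY.pow_const 3).aestronglyMeasurable, hYe 3]
    exact k3.2
  · intro hs
    rw [integrable_map_measure (hY.pow_const 7).aestronglyMeasurable hm.aemeasurable,
      Function.comp_def, hYe 7]
    exact (k7 hs).1
  · intro hs
    rw [integral_map hm.aemeasurable (hY.pow_const 7).aestronglyMeasurable, hYe 7]
    exact (k7 hs).2
  · intro hs v
    rw [memLp_map_measure_iff (hdot v).aestronglyMeasurable hm.aemeasurable]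
    have e : ((fun y : Fin p → ℝ => y ⬝ᵥ w v) ∘ fun ω => maskBlock c b (u ω))
        = fun ω => ∑ j, maskBlock c b (w v) j * u ω j := by
      funext ω
      simp only [Function.comp, maskBlock_dotProduct]
      unfold dotProduct
      exact Finset.sum_congr rfl fun j _ => mul_comm _ _
    rw [e]
    exact memLp_finsetSum _ fun j _ =>
      ((hu.memLp_seven hs j).mono_exponent (by norm_num)).const_mul _
  · intro hs v
    rw [integral_map hm.aemeasurable (hdot v).aestronglyMeasurable]
    simp only [maskBlock_dotProduct]
    unfold dotProduct
    rw [integral_finsetSum _ fun j _ => (hu.mean j).1.mul_const _]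
    exact Finset.sum_eq_zero fun j _ => by rw [integral_mul_const, (hu.mean j).2, zero_mul]
  · intro hs v
    rw [integral_map hm.aemeasurable ((hdot v).pow_const 2).aestronglyMeasurable]
    simp only [maskBlock_dotProduct]
    rw [hu.integral_dotProduct_sq]
    refine div_le_div_of_nonneg_right ((hq _).trans (mul_le_mul_of_nonneg_left ?_ hM))
      (Nat.cast_nonneg _)
    calc
      _ = ∑ j ∈ Finset.univ.filter (fun j => c j = b), w v j ^ 2 := by
          rw [Finset.sum_filter]
          unfold dotProduct maskBlock
          exact Finset.sum_congr rfl fun j _ => by split_ifs <;> simp [sq]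
      _ ≤ ∑ j ∈ Finset.univ.filter (fun j => c j = b), L ^ 2 := Finset.sum_le_sum fun j _ => by
          rw [← sq_abs]; exact pow_le_pow_left₀ (abs_nonneg _) (hw v j) 2
      _ = _ := by simp
  · intro hs v
    rw [integral_map hm.aemeasurable ((hdot v).pow_const 4).aestronglyMeasurable]
    refine (integral_mono_of_nonneg (Eventually.of_forall fun ω => by positivity) (k4 hs).1
      (Eventually.of_forall fun ω => ?_)).trans (k4 hs).2
    have e : (maskBlock c b (u ω) ⬝ᵥ w v) ^ 4 = |maskBlock c b (u ω) ⬝ᵥ w v| ^ 4 := by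
      rw [← abs_pow, abs_of_nonneg (by positivity)]
    simp only [e]
    exact pow_le_pow_left₀ (abs_nonneg _) (hdle v ω) 4

/-- Outside the cell both vectors vanish; inside it both are centred with covariance `Sig / n`.
Taking a whole cell as the unit of exchange leaves the dependence inside it harmless. -/
lemma RowMoments.matched {u u' : Ω → Fin p → ℝ} (hu : RowMoments P n Sig A s u)
    (hu' : RowMoments P n Sig A s u') {B : Type*} [DecidableEq B] (c : Fin p → B) (b : B) :
    (∀ j, (fun y : Fin p → ℝ => y j) ∈ matchedFunctions (P.map fun ω => maskBlock c b (u ω))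
        (P.map fun ω => maskBlock c b (u' ω))) ∧
      ∀ j k, (fun y : Fin p → ℝ => y j * y k) ∈ matchedFunctions
        (P.map fun ω => maskBlock c b (u ω)) (P.map fun ω => maskBlock c b (u' ω)) := by
  have hm : ∀ {u : Ω → Fin p → ℝ}, RowMoments P n Sig A s u →
      Measurable fun ω => maskBlock c b (u ω) := fun hu =>
    (measurable_maskBlock c b).comp hu.measurable
  have h1 : ∀ {u : Ω → Fin p → ℝ}, RowMoments P n Sig A s u → ∀ j,
      Integrable (fun y : Fin p → ℝ => y j) (P.map fun ω => maskBlock c b (u ω)) ∧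
      ∫ y, y j ∂(P.map fun ω => maskBlock c b (u ω)) = 0 := by
    intro u hu j
    rw [integrable_map_measure (measurable_pi_apply j).aestronglyMeasurable (hm hu).aemeasurable,
      integral_map (hm hu).aemeasurable (measurable_pi_apply j).aestronglyMeasurable]
    by_cases h : c j = b
    · simpa [maskBlock, h, Function.comp_def] using hu.mean j
    · simp [maskBlock, h, Function.comp_def]
  have h2 : ∀ {u : Ω → Fin p → ℝ}, RowMoments P n Sig A s u → ∀ j k,
      Integrable (fun y : Fin p → ℝ => y j * y k) (P.map fun ω => maskBlock c b (u ω)) ∧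
      ∫ y, y j * y k ∂(P.map fun ω => maskBlock c b (u ω))
        = if c j = b ∧ c k = b then Sig j k / n else 0 := by
    intro u hu j k
    have hjk : Measurable fun y : Fin p → ℝ => y j * y k :=
      (measurable_pi_apply j).mul (measurable_pi_apply k)
    rw [integrable_map_measure hjk.aestronglyMeasurable (hm hu).aemeasurable,
      integral_map (hm hu).aemeasurable hjk.aestronglyMeasurable]
    by_cases h : c j = b
    · by_cases h' : c k = b
      · simpa [maskBlock, h, h', Function.comp_def] using hu.second j k
      · simp [maskBlock, h', Function.comp_def]
    · simp [maskBlock, h, Function.comp_def]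
  refine ⟨fun j => ⟨(h1 hu j).1, (h1 hu' j).1, ?_⟩, fun j k => ⟨(h2 hu j k).1, (h2 hu' j k).1, ?_⟩⟩
  · rw [(h1 hu j).2, (h1 hu' j).2]
  · rw [(h2 hu j k).2, (h2 hu' j k).2]

end BlockLaws

/-! ### Rows of the covariate and of the Gaussian design -/

section Rows

open scoped Matrix

set_option linter.unusedSectionVars false

variable {Ω : Type*} [MeasurableSpace Ω] {P : Measure Ω} [IsProbabilityMeasure P] {p : ℕ}

lemma quadForm_le_of_eigenvalues_le {Sig : Matrix (Fin p) (Fin p) ℝ} (hS : Sig.IsHermitian) {M : ℝ}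
    (h : ∀ j, hS.eigenvalues j ≤ M) (w : Fin p → ℝ) : w ⬝ᵥ Sig *ᵥ w ≤ M * (w ⬝ᵥ w) := by
  open scoped MatrixOrder in
  have h1 : Sig ≤ algebraMap ℝ _ M := by
    refine le_algebraMap_of_spectrum_le (fun x hx => ?_) hS.isSelfAdjoint
    rw [hS.spectrum_real_eq_range_eigenvalues] at hx
    obtain ⟨j, rfl⟩ := hx
    exact h j
  have h2 := (Matrix.le_iff.1 h1).dotProduct_mulVec_nonneg w
  simp only [star_trivial, Matrix.sub_mulVec, dotProduct_sub, Algebra.algebraMap_eq_smul_one,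
    Matrix.smul_mulVec, Matrix.one_mulVec, dotProduct_smul, smul_eq_mul] at h2
  linarith

lemma integral_abs_pow_le_of_eLpNorm_le {f : Ω → ℝ} (hf : AEStronglyMeasurable f P) {n q m : ℕ}
    (hn : 1 ≤ n) (hm : m ≤ q) (hm0 : m ≠ 0) {M : ℝ} (hM : 0 ≤ M)
    (h : eLpNorm (fun ω => √(n : ℝ) * f ω) (q : ℝ≥0∞) P ≤ ENNReal.ofReal M) :
    MemLp f (m : ℕ) P ∧ ∫ ω, |f ω| ^ m ∂P ≤ M ^ m / √n ^ m := by
  have hsn : 0 < √(n : ℝ) := Real.sqrt_pos.2 (by exact_mod_cast hn)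
  have h1 : eLpNorm (fun ω => √(n : ℝ) * f ω) (m : ℝ≥0∞) P ≤ ENNReal.ofReal M :=
    (eLpNorm_le_eLpNorm_of_exponent_le (by exact_mod_cast hm) (hf.const_mul _)).trans h
  have h2 : MemLp (fun ω => √(n : ℝ) * f ω) (m : ℕ) P :=
    ⟨hf.const_mul _, h1.trans_lt ENNReal.ofReal_lt_top⟩
  have h3 : MemLp f (m : ℕ) P := by
    have := h2.const_mul (√(n : ℝ))⁻¹
    convert this using 2 with ω
    field_simp
  refine ⟨h3, ?_⟩
  rw [h2.eLpNorm_eq_integral_rpow_norm (by exact_mod_cast hm0) (by simp)] at h1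
  rw [ENNReal.ofReal_le_ofReal_iff hM] at h1
  simp only [ENNReal.toReal_natCast, Real.rpow_natCast] at h1
  have h0 : 0 ≤ ∫ ω, ‖√(n : ℝ) * f ω‖ ^ m ∂P := integral_nonneg fun ω => by positivity
  have h4 : ∫ ω, ‖√(n : ℝ) * f ω‖ ^ m ∂P ≤ M ^ m := by
    have := pow_le_pow_left₀ (by positivity) h1 m
    rwa [← Real.rpow_natCast _ m, ← Real.rpow_mul h0, inv_mul_cancel₀ (by exact_mod_cast hm0),
      Real.rpow_one] at this
  have e : (fun ω => ‖√(n : ℝ) * f ω‖ ^ m) = fun ω => √(n : ℝ) ^ m * |f ω| ^ m := by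
    funext ω
    rw [Real.norm_eq_abs, abs_mul, abs_of_pos hsn, mul_pow]
  rw [e, integral_const_mul] at h4
  rwa [le_div_iff₀ (by positivity), mul_comm]

/-- The `m`-th absolute moment of the standard Gaussian law. -/
noncomputable def gaussianAbsMoment (m : ℕ) : ℝ := ∫ x, |x| ^ m ∂(gaussianReal 0 1)

lemma gaussianAbsMoment_nonneg (m : ℕ) : 0 ≤ gaussianAbsMoment m :=
  integral_nonneg fun _ => by positivity

lemma integral_abs_pow_gaussianReal (v : ℝ≥0) (m : ℕ) :
    ∫ x, |x| ^ m ∂(gaussianReal 0 v) = √(v : ℝ) ^ m * gaussianAbsMoment m := by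
  have h : (gaussianReal 0 1).map (√(v : ℝ) * ·) = gaussianReal 0 v := by
    rw [gaussianReal_map_const_mul]
    congr 1
    · simp
    · ext
      simp [Real.sq_sqrt]
  rw [← h, integral_map (by fun_prop) (by fun_prop)]
  simp only [abs_mul, mul_pow, abs_of_nonneg (Real.sqrt_nonneg _)]
  rw [integral_const_mul, gaussianAbsMoment]

/-- A bound for the third, fourth and seventh moments of the rows of both designs. -/
noncomputable def momentConst (M : ℝ) : ℝ :=
  max 1 M ^ 7 * (1 + gaussianAbsMoment 3 + gaussianAbsMoment 4 + gaussianAbsMoment 7)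

lemma le_momentConst {M : ℝ} {m : ℕ} (hm : m ≤ 7) : max 1 M ^ m ≤ momentConst M := by
  have h1 : (1 : ℝ) ≤ max 1 M := le_max_left _ _
  refine (pow_le_pow_right₀ h1 hm).trans (le_mul_of_one_le_right (by positivity) ?_)
  have := gaussianAbsMoment_nonneg 3
  have := gaussianAbsMoment_nonneg 4
  have := gaussianAbsMoment_nonneg 7
  linarith

lemma momentConst_nonneg (M : ℝ) : 0 ≤ momentConst M :=
  (by positivity : (0 : ℝ) ≤ max 1 M ^ 0).trans (le_momentConst (by norm_num))

lemma IsCovariateDesign.rowMoments {n : ℕ} {Sig : Matrix (Fin p) (Fin p) ℝ}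
    {X : Ω → Fin n → Fin p → ℝ} (hX : IsCovariateDesign P Sig X) {M s : ℝ} {q : ℕ} (hq : 3 ≤ q)
    (hqs : s ≠ 0 → 7 ≤ q) (i : Fin n)
    (hmom : ∀ j, eLpNorm (fun ω => √(n : ℝ) * X ω i j) (q : ℝ≥0∞) P ≤ ENNReal.ofReal M) :
    RowMoments P n Sig (momentConst M) s (fun ω => X ω i) := by
  have hn : 1 ≤ n := i.pos
  have hm : ∀ j, Measurable fun ω => X ω i j := fun j =>
    (measurable_pi_apply j).comp ((measurable_pi_apply i).comp hX.measurable)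
  have key : ∀ {m : ℕ}, m ≤ q → m ≠ 0 → m ≤ 7 → ∀ j, MemLp (fun ω => X ω i j) (m : ℕ) P ∧
      ∫ ω, |X ω i j| ^ m ∂P ≤ momentConst M / √n ^ m := by
    intro m hmq hm0 hm7 j
    have := integral_abs_pow_le_of_eLpNorm_le (hm j).aestronglyMeasurable hn hmq hm0
      (M := max 1 M) (by positivity)
      ((hmom j).trans (ENNReal.ofReal_le_ofReal (le_max_right _ _)))
    exact ⟨this.1, this.2.trans (div_le_div_of_nonneg_right (le_momentConst hm7) (by positivity))⟩
  exact ⟨(measurable_pi_apply i).comp hX.measurable, hX.mean i, hX.second i,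
    fun j => (key hq (by norm_num) (by norm_num) j).1, fun j => (key hq (by norm_num) (by norm_num) j).2,
    fun hs j => (key (hqs hs) (by norm_num) (by norm_num) j).1,
    fun hs j => (key ((by norm_num : 4 ≤ 7).trans (hqs hs)) (by norm_num) (by norm_num) j).2,
    fun hs j => (key (hqs hs) (by norm_num) (by norm_num) j).2⟩

/-! ### Moments and block independence of the Gaussian rows -/

section Gaussian

variable {n : ℕ} {Sig : Matrix (Fin p) (Fin p) ℝ} {G : Ω → Fin n → Fin p → ℝ}

lemma IsGaussianDesign.hasGaussianLaw (hG : IsGaussianDesign P Sig G) (i : Fin n) :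
    HasGaussianLaw (fun ω => WithLp.toLp 2 (G ω i)) P := by
  constructor
  rw [hG.law i]
  infer_instance

lemma IsGaussianDesign.map_eval (hG : IsGaussianDesign P Sig G) (hS : Sig.PosDef) (i : Fin n)
    (j : Fin p) : P.map (fun ω => G ω i j) = gaussianReal 0 (Sig j j / n).toNNReal := by
  have hS' : ((1 / (n : ℝ)) • Sig).PosSemidef := hS.posSemidef.smul (by positivity)
  have hmp := measurePreserving_eval_multivariateGaussian (μ := 0) hS' (i := j)
  have hm : Measurable fun ω => WithLp.toLp 2 (G ω i) :=
    (by fun_prop : Measurable fun u : Fin p → ℝ => WithLp.toLp 2 u).comp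
      ((measurable_pi_apply i).comp hG.measurable)
  have := hmp.map_eq
  rw [← hG.law i, Measure.map_map hmp.measurable hm] at this
  simp only [Matrix.smul_apply, smul_eq_mul, one_div, inv_mul_eq_div] at this
  exact this

lemma IsGaussianDesign.memLp (hG : IsGaussianDesign P Sig G) (hS : Sig.PosDef) (i : Fin n)
    (j : Fin p) (m : ℕ) : MemLp (fun ω => G ω i j) (m : ℕ) P := by
  have hm : Measurable fun ω => G ω i j :=
    (measurable_pi_apply j).comp ((measurable_pi_apply i).comp hG.measurable)
  have h := memLp_id_gaussianReal' (μ := 0) (v := (Sig j j / n).toNNReal) m (by simp)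
  rw [← hG.map_eval hS i j, memLp_map_measure_iff aestronglyMeasurable_id hm.aemeasurable] at h
  exact h

lemma IsGaussianDesign.integral_eq_zero (hG : IsGaussianDesign P Sig G) (hS : Sig.PosDef)
    (i : Fin n) (j : Fin p) : ∫ ω, G ω i j ∂P = 0 := by
  have hm : Measurable fun ω => G ω i j :=
    (measurable_pi_apply j).comp ((measurable_pi_apply i).comp hG.measurable)
  have h := integral_id_gaussianReal (μ := 0) (v := (Sig j j / n).toNNReal)
  rw [← hG.map_eval hS i j, integral_map hm.aemeasurable (by fun_prop)] at h
  exact h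

lemma IsGaussianDesign.covariance_eq (hG : IsGaussianDesign P Sig G) (hS : Sig.PosDef)
    (i : Fin n) (j k : Fin p) : cov[fun ω => G ω i j, fun ω => G ω i k; P] = Sig j k / n := by
  have hS' : ((1 / (n : ℝ)) • Sig).PosSemidef := hS.posSemidef.smul (by positivity)
  have h := covariance_eval_multivariateGaussian (μ := 0) hS' j k
  have hm : Measurable fun ω => WithLp.toLp 2 (G ω i) :=
    (by fun_prop : Measurable fun u : Fin p → ℝ => WithLp.toLp 2 u).comp
      ((measurable_pi_apply i).comp hG.measurable)
  rw [← hG.law i, covariance_map (by fun_prop) (by fun_prop) hm.aemeasurable] at h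
  simp only [Matrix.smul_apply, smul_eq_mul, one_div, inv_mul_eq_div] at h
  exact h

lemma IsGaussianDesign.rowMoments (hG : IsGaussianDesign P Sig G) (hS : Sig.PosDef) {M : ℝ} (s : ℝ)
    (hq : ∀ w : Fin p → ℝ, w ⬝ᵥ Sig *ᵥ w ≤ M * (w ⬝ᵥ w)) (i : Fin n) :
    RowMoments P n Sig (momentConst M) s (fun ω => G ω i) := by
  have hn : 1 ≤ n := i.pos
  have hn0 : (0 : ℝ) < n := by exact_mod_cast hn
  have hm : ∀ j, Measurable fun ω => G ω i j := fun j =>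
    (measurable_pi_apply j).comp ((measurable_pi_apply i).comp hG.measurable)
  have hSj : ∀ j, Sig j j ≤ max 1 M := by
    intro j
    have := hq (Pi.single j 1)
    simp at this
    exact this.trans (le_max_right _ _)
  have key : ∀ {m : ℕ}, m ≤ 7 → gaussianAbsMoment m ≤
      1 + gaussianAbsMoment 3 + gaussianAbsMoment 4 + gaussianAbsMoment 7 → ∀ j,
      ∫ ω, |G ω i j| ^ m ∂P ≤ momentConst M / √n ^ m := by
    intro m hm7 hmm j
    have e : ∫ ω, |G ω i j| ^ m ∂P = ∫ x, |x| ^ m ∂(gaussianReal 0 (Sig j j / n).toNNReal) := by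
      rw [← hG.map_eval hS i j, integral_map (hm j).aemeasurable (by fun_prop)]
    rw [e, integral_abs_pow_gaussianReal]
    have h1 : (1 : ℝ) ≤ max 1 M := le_max_left _ _
    have h2 : √((Sig j j / n).toNNReal : ℝ) ≤ max 1 M / √n := by
      rw [Real.coe_toNNReal']
      refine Real.sqrt_le_iff.2 ⟨by positivity, ?_⟩
      rw [div_pow, Real.sq_sqrt hn0.le]
      refine max_le (div_le_div_of_nonneg_right ((hSj j).trans ?_) hn0.le) (by positivity)
      nlinarith
    have h3 : √((Sig j j / n).toNNReal : ℝ) ^ m ≤ max 1 M ^ 7 / √n ^ m := by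
      refine (pow_le_pow_left₀ (Real.sqrt_nonneg _) h2 m).trans ?_
      rw [div_pow]
      exact div_le_div_of_nonneg_right (pow_le_pow_right₀ h1 hm7) (by positivity)
    refine (mul_le_mul h3 hmm (gaussianAbsMoment_nonneg m) (by positivity)).trans_eq ?_
    rw [momentConst]; ring
  have g3 := gaussianAbsMoment_nonneg 3
  have g4 := gaussianAbsMoment_nonneg 4
  have g7 := gaussianAbsMoment_nonneg 7
  have hL2 : ∀ j, MemLp (fun ω => G ω i j) 2 P := fun j => by
    have := hG.memLp hS i j 2
    exact_mod_cast this
  refine ⟨(measurable_pi_apply i).comp hG.measurable, fun j => ⟨?_, hG.integral_eq_zero hS i j⟩,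
    fun j k => ⟨(hL2 j).integrable_mul (hL2 k), ?_⟩, fun j => hG.memLp hS i j 3,
    key (by norm_num) (by linarith), fun _ j => hG.memLp hS i j 7,
    fun _ => key (by norm_num) (by linarith), fun _ => key (by norm_num) (by linarith)⟩
  · exact (hL2 j).integrable (by norm_num)
  · have := hG.covariance_eq hS i j k
    rw [covariance_eq_sub (hL2 j) (hL2 k), hG.integral_eq_zero hS, zero_mul, sub_zero] at this
    exact this

/-- If the blocks of the covariate design are independent, so are those of the Gaussian design. -/
lemma IsGaussianDesign.iIndepFun_blocks (hG : IsGaussianDesign P Sig G) (hS : Sig.PosDef)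
    {X : Ω → Fin n → Fin p → ℝ} (hX : IsCovariateDesign P Sig X) {k : ℕ} (c : Fin p → Fin k)
    (hblk : ∀ i, iIndepFun (fun (b : Fin k) (ω : Ω) (j : {j : Fin p // c j = b}) => X ω i j) P)
    (i : Fin n) :
    iIndepFun (fun (b : Fin k) (ω : Ω) (j : {j : Fin p // c j = b}) => G ω i j) P := by
  have hXm : ∀ j, Measurable fun ω => X ω i j := fun j =>
    (measurable_pi_apply j).comp ((measurable_pi_apply i).comp hX.measurable)
  refine HasGaussianLaw.iIndepFun_of_covariance_eval
    (X := fun (b : Fin k) (j : {j : Fin p // c j = b}) ω => G ω i j) ?_ ?_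
  · let T : EuclideanSpace ℝ (Fin p) →L[ℝ] ((b : Fin k) → {j : Fin p // c j = b} → ℝ) :=
      ContinuousLinearMap.pi fun b => ContinuousLinearMap.pi fun j => EuclideanSpace.proj (j : Fin p)
    exact (hG.hasGaussianLaw i).map_fun T
  · intro b b' hbb j j'
    -- The two designs share their second moments, so a covariance across cells is read off from
    -- `X`, where it vanishes by independence and centring.
    rw [hG.covariance_eq hS, ← (hX.second i j j').2]
    have h1 := (hblk i).indepFun hbb
    have h2 : (fun ω => X ω i j) ⟂ᵢ[P] (fun ω => X ω i j') :=
      h1.comp (φ := fun r : {j : Fin p // c j = b} → ℝ => r j)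
        (ψ := fun r : {j : Fin p // c j = b'} → ℝ => r j') (measurable_pi_apply j)
        (measurable_pi_apply j')
    rw [h2.integral_fun_mul_eq_mul_integral (hXm _).aestronglyMeasurable
      (hXm _).aestronglyMeasurable, (hX.mean i j).2, zero_mul]

end Gaussian

end Rows

/-! ### Comparison of two designs for a fixed noise vector -/

section FixedNoise

open scoped Matrix

variable {Ω : Type*} [MeasurableSpace Ω] {P : Measure Ω} {n p k : ℕ}

/-- A design with independent rows, independent blocks in each row, and bounded moments. -/
structure BlockDesign (P : Measure Ω) (Sig : Matrix (Fin p) (Fin p) ℝ) (A0 s : ℝ)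
    (c : Fin p → Fin k) (X : Ω → Fin n → Fin p → ℝ) : Prop where
  measurable : Measurable X
  indep : iIndepFun (fun i ω => X ω i) P
  blocks : ∀ i, iIndepFun (fun (b : Fin k) (ω : Ω) (j : {j : Fin p // c j = b}) => X ω i j) P
  rows : ∀ i, RowMoments P n Sig A0 s (fun ω => X ω i)

set_option linter.unusedSectionVars false

variable [IsProbabilityMeasure P] {Sig : Matrix (Fin p) (Fin p) ℝ} {A0 s : ℝ} {c : Fin p → Fin k}

lemma abs_Av_sub_le {f f' b : Fin n → ℝ} (h : ∀ i, |f i - f' i| ≤ b i) : |Av f - Av f'| ≤ Av b := by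
  unfold Av
  rw [← mul_sub, abs_mul, abs_of_nonneg (by positivity : (0 : ℝ) ≤ 1 / n), ← Finset.sum_sub_distrib]
  exact mul_le_mul_of_nonneg_left
    ((Finset.abs_sum_le_sum_abs _ _).trans (Finset.sum_le_sum fun i _ => h i)) (by positivity)

lemma Av_mono {f f' : Fin n → ℝ} (h : ∀ i, f i ≤ f' i) : Av f ≤ Av f' :=
  mul_le_mul_of_nonneg_left (Finset.sum_le_sum fun i _ => h i) (by positivity)

lemma Av_const (hn : 1 ≤ n) (a : ℝ) : Av (fun _ : Fin n => a) = a := by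
  have : (n : ℝ) ≠ 0 := by positivity
  simp [Av, this]

lemma Av_add (f f' : Fin n → ℝ) : Av (fun i => f i + f' i) = Av f + Av f' := by
  simp [Av, Finset.sum_add_distrib, mul_add]

lemma Av_mul (a : ℝ) (f : Fin n → ℝ) : Av (fun i => a * f i) = a * Av f := by
  simp only [Av, ← Finset.mul_sum]; ring

lemma Av_nonneg {f : Fin n → ℝ} (h : ∀ i, 0 ≤ f i) : 0 ≤ Av f :=
  mul_nonneg (by positivity) (Finset.sum_nonneg fun i _ => h i)

lemma le_one_add_sq (x : ℝ) : x ≤ 1 + x ^ 2 := by nlinarith [sq_nonneg (x - 1)]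

lemma sq_sum_abs_le (x : Fin p → ℝ) : (∑ j, |x j|) ^ 2 ≤ p * ∑ j, x j ^ 2 := by
  have := pow_sum_le_card_mul_sum_pow (s := Finset.univ) (f := fun j => |x j|)
    (fun j _ => abs_nonneg _) 1
  simpa using this

/-- With `N = ∑ |x i j|` the two arguments differ by at most `δ N` and are at most `L N` in size.
Then `N ≤ 1 + N²` and `N² ≤ p ∑ x²` reduce everything to second moments of the row. -/
lemma abs_Av_loss_sub_le {ℓ : Fin n → ℝ → ℝ} {s L δ : ℝ} {A : Fin n → ℝ} (hA : ∀ i, 0 ≤ A i)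
    (hs : 0 ≤ s) (hL : 0 ≤ L) (hδ : 0 ≤ δ)
    (hmod : ∀ i z z', |ℓ i z - ℓ i z'| ≤ |z - z'| * (A i + s * (|z| + |z'|)))
    (x : Fin n → Fin p → ℝ) {u u' : Fin p → ℝ} (hu : ∀ j, |u j| ≤ L) (hu' : ∀ j, |u' j| ≤ L)
    (huu : ∀ j, |u j - u' j| ≤ δ) :
    |Av (fun i => ℓ i (∑ j, x i j * u j)) - Av (fun i => ℓ i (∑ j, x i j * u' j))|
      ≤ Av fun i => δ * (A i * (1 + p * ∑ j, x i j ^ 2) + 2 * s * L * (p * ∑ j, x i j ^ 2)) := by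
  refine abs_Av_sub_le fun i => (hmod i _ _).trans ?_
  set N := ∑ j, |x i j| with hN
  set Q := (p : ℝ) * ∑ j, x i j ^ 2 with hQ
  have hN0 : 0 ≤ N := Finset.sum_nonneg fun j _ => abs_nonneg _
  have hNQ : N ^ 2 ≤ Q := sq_sum_abs_le _
  have hz : |∑ j, x i j * u j| ≤ L * N := abs_dotProduct_le hu
  have hz' : |∑ j, x i j * u' j| ≤ L * N := abs_dotProduct_le hu'
  have hzz : |∑ j, x i j * u j - ∑ j, x i j * u' j| ≤ δ * N := by
    rw [← Finset.sum_sub_distrib]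
    have e : ∑ j, (x i j * u j - x i j * u' j) = x i ⬝ᵥ (u - u') := by
      simp [dotProduct, mul_sub]
    rw [e]
    exact abs_dotProduct_le (u := u - u') huu
  set z := ∑ j, x i j * u j
  set z' := ∑ j, x i j * u' j
  have h2 : A i + s * (|z| + |z'|) ≤ A i + 2 * s * (L * N) := by
    have := mul_le_mul_of_nonneg_left (add_le_add hz hz') hs
    linarith
  have h3 : 0 ≤ A i + s * (|z| + |z'|) := add_nonneg (hA i) (by positivity)
  have h5 : N ≤ 1 + Q := by linarith [le_one_add_sq N]
  calc
    _ ≤ δ * N * (A i + 2 * s * (L * N)) := mul_le_mul hzz h2 h3 (by positivity)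
    _ = δ * (A i * N + 2 * s * L * N ^ 2) := by ring
    _ ≤ _ := mul_le_mul_of_nonneg_left (add_le_add (mul_le_mul_of_nonneg_left h5 (hA i))
        (mul_le_mul_of_nonneg_left hNQ (by positivity))) hδ

/-- The factor `1 / n` of the variance is thrown away: this is multiplied by the mesh `n⁻³`, which
leaves room. -/
lemma BlockDesign.integral_sum_sq_le {X : Ω → Fin n → Fin p → ℝ} (hX : BlockDesign P Sig A0 s c X)
    {M : ℝ} (hM : 0 ≤ M) (hq : ∀ w : Fin p → ℝ, w ⬝ᵥ Sig *ᵥ w ≤ M * (w ⬝ᵥ w)) (i : Fin n) :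
    Integrable (fun ω => (p : ℝ) * ∑ j, X ω i j ^ 2) P ∧
      ∫ ω, (p : ℝ) * ∑ j, X ω i j ^ 2 ∂P ≤ p ^ 2 * M := by
  have h := (hX.rows i).second
  have e : ∀ ω, ∑ j, X ω i j ^ 2 = ∑ j, X ω i j * X ω i j := fun ω =>
    Finset.sum_congr rfl fun j _ => sq _
  have hn : (1 : ℝ) ≤ n := by exact_mod_cast i.pos
  simp only [e]
  refine ⟨(integrable_finsetSum _ fun j _ => (h j j).1).const_mul _, ?_⟩
  rw [integral_const_mul, integral_finsetSum _ fun j _ => (h j j).1]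
  have hj : ∀ j, ∫ ω, X ω i j * X ω i j ∂P ≤ M := by
    intro j
    rw [(h j j).2]
    have h1 := hq (Pi.single j 1)
    simp at h1
    exact (div_le_div_of_nonneg_right h1 (by positivity)).trans (div_le_self hM hn)
  calc (p : ℝ) * ∑ j, ∫ ω, X ω i j * X ω i j ∂P ≤ p * ∑ j : Fin p, M :=
        mul_le_mul_of_nonneg_left (Finset.sum_le_sum fun j _ => hj j) (Nat.cast_nonneg _)
    _ = p ^ 2 * M := by simp; ring

/-- The bound for the change of the smoothed, discretised risk under a change of the design. -/
noncomputable def replacementError (n p d : ℕ) (lam C K A0 s L M a : ℝ) : ℝ :=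
  23 * K * (1 + C) * lam ^ 2 * (2 * (L ^ 3 * d ^ 2 * (p * (A0 / √n ^ 3))) *
      (1 + a + 8 * s * (L ^ 4 * d ^ 3 * (p * (A0 / √n ^ 4)) + 3 * (M * (p * L ^ 2) / n) ^ 2))
    + 16 * s * (L ^ 7 * d ^ 6 * (p * (A0 / √n ^ 7))))

/-- The bound for the error made by smoothing and discretising the minimal risk. -/
noncomputable def smoothingError (n p : ℕ) (lam K s L M a δ ε : ℝ) : ℝ :=
  K * (δ * (a * (1 + p ^ 2 * M) + 2 * s * L * (p ^ 2 * M)) + ε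
    + p * Real.log (2 * L / δ + 2) / (n * lam))

/-- The three errors are the oscillation of the loss within a cell of the net, the smoothing error
`ε`, and the entropy of the net divided by the inverse temperature. -/
lemma abs_minRisk_sub_softmin_le (hn : 1 ≤ n) {ell0 : ℝ → ℝ} (hpos : ∀ u, 0 ≤ ell0 u)
    (ξ : Fin n → ℝ) {ℓ : Fin n → ℝ → ℝ} {ε lam L δ : ℝ} {A : Fin n → ℝ}
    (hA : ∀ i, 0 ≤ A i) (hs : 0 ≤ s) (hlam : 1 ≤ lam) (hL : 0 ≤ L) (hδ : 0 < δ)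
    (hℓε : ∀ i z, |ℓ i z - noisyLoss ell0 ξ i z| ≤ ε)
    (hmod : ∀ i z z', |noisyLoss ell0 ξ i z - noisyLoss ell0 ξ i z'|
      ≤ |z - z'| * (A i + s * (|z| + |z'|)))
    {R : (Fin p → ℝ) → ℝ} {S : Set (Fin p → ℝ)} (hS : ∀ w ∈ S, ∀ j, w j ∈ Set.Icc (-L) L)
    {T : Finset (Fin p → ℤ)} (hTcard : Real.log T.card ≤ p * Real.log (2 * L / δ + 2))
    {w : T → Fin p → ℝ} {cst : T → ℝ} (happ : IsSoftminNet R S δ w cst)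
    (x : Fin n → Fin p → ℝ) :
    |minRisk (noisyLoss ell0 ξ) R S x
      - softmin (n * lam) (blockRisk n ℓ cst w fun a : Fin n × Fin k => maskBlock c a.2 (x a.1))|
      ≤ Av (fun i => δ * (A i * (1 + p * ∑ j, x i j ^ 2) + 2 * s * L * (p * ∑ j, x i j ^ 2)))
        + (ε + p * Real.log (2 * L / δ + 2) / (n * lam)) := by
  have hn0 : (0 : ℝ) < n := by exact_mod_cast hn
  have hβ : 0 < n * lam := by positivity
  have p1 : ∀ u : Fin p → ℝ, 0 ≤ Av fun i => noisyLoss ell0 ξ i (∑ j, x i j * u j) :=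
    fun u => Av_nonneg fun i => hpos _
  have p3 : ∀ u : Fin p → ℝ, |Av (fun i => ℓ i (∑ j, x i j * u j))
      - Av (fun i => noisyLoss ell0 ξ i (∑ j, x i j * u j))| ≤ ε := by
    intro u
    have h2 := abs_Av_sub_le (f := fun i => ℓ i (∑ j, x i j * u j))
      (f' := fun i => noisyLoss ell0 ξ i (∑ j, x i j * u j)) (b := fun _ => ε)
      (fun i => hℓε i _)
    rwa [Av_const hn ε] at h2
  have h1 := happ (fun u => Av fun i => noisyLoss ell0 ξ i (∑ j, x i j * u j))
    (fun u => Av fun i => ℓ i (∑ j, x i j * u j))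
    (Av (fun i => δ * (A i * (1 + p * ∑ j, x i j ^ 2) + 2 * s * L * (p * ∑ j, x i j ^ 2))))
    ε (n * lam) hβ p1
    (fun u hu u' hu' huu => abs_Av_loss_sub_le hA hs hL hδ.le hmod x
      (fun j => abs_le.2 (hS u hu j)) (fun j => abs_le.2 (hS u' hu' j)) huu) p3
  have e : blockRisk n ℓ cst w (fun a : Fin n × Fin k => maskBlock c a.2 (x a.1))
      = fun v => cst v + Av fun i => ℓ i (∑ j, x i j * w v j) := by
    funext v
    simp only [blockRisk, Av, sum_maskBlock_dotProduct]
    simp only [dotProduct]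
    ring
  rw [e]
  have h4 : Real.log T.card / (n * lam) ≤ p * Real.log (2 * L / δ + 2) / (n * lam) :=
    div_le_div_of_nonneg_right hTcard hβ.le
  simp only [minRisk, empRisk]
  linarith

lemma measurable_minRisk_comp {ell0 : ℝ → ℝ} (hcont : Continuous ell0) (hpos : ∀ u, 0 ≤ ell0 u)
    {R : (Fin p → ℝ) → ℝ} {S : Set (Fin p → ℝ)} (hSne : S.Nonempty) (hRS : BddBelow (R '' S))
    {X : Ω → Fin n → Fin p → ℝ} (hX : Measurable X) {ξ : Ω → Fin n → ℝ} (hξ : Measurable ξ) :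
    Measurable fun ω => minRisk (noisyLoss ell0 (ξ ω)) R S (X ω) := by
  have h := (measurable_minRisk (n := n) hcont hpos hSne hRS).comp (hX.prodMk hξ)
  simpa only [Function.comp_def] using h

lemma BlockDesign.integral_Av_modulus_le (hn : 1 ≤ n) {X : Ω → Fin n → Fin p → ℝ}
    (hX : BlockDesign P Sig A0 s c X)
    {M : ℝ} (hM : 0 ≤ M) (hq : ∀ w : Fin p → ℝ, w ⬝ᵥ Sig *ᵥ w ≤ M * (w ⬝ᵥ w))
    {L δ : ℝ} {A : Fin n → ℝ} (hA : ∀ i, 0 ≤ A i) (hs : 0 ≤ s) (hL : 0 ≤ L) (hδ : 0 < δ) :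
    Integrable (fun ω => Av fun i => δ * (A i * (1 + p * ∑ j, X ω i j ^ 2)
      + 2 * s * L * (p * ∑ j, X ω i j ^ 2))) P ∧
    ∫ ω, Av (fun i => δ * (A i * (1 + p * ∑ j, X ω i j ^ 2)
      + 2 * s * L * (p * ∑ j, X ω i j ^ 2))) ∂P
      ≤ δ * (Av A * (1 + p ^ 2 * M) + 2 * s * L * (p ^ 2 * M)) := by
  have key : ∀ i, ∃ q : Ω → ℝ, (∀ ω, (p : ℝ) * ∑ j, X ω i j ^ 2 = q ω) ∧ Integrable q P ∧
      ∫ ω, q ω ∂P ≤ p ^ 2 * M := fun i =>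
    ⟨_, fun _ => rfl, hX.integral_sum_sq_le hM hq i⟩
  choose q hqe i1 i2 using key
  simp only [hqe]
  have hbi : ∀ i, Integrable (fun ω => δ * (A i * (1 + q i ω) + 2 * s * L * q i ω)) P ∧
      ∫ ω, δ * (A i * (1 + q i ω) + 2 * s * L * q i ω) ∂P
        ≤ δ * (A i * (1 + p ^ 2 * M) + 2 * s * L * (p ^ 2 * M)) := by
    intro i
    have i3 : Integrable (fun ω => A i * (1 + q i ω)) P :=
      ((integrable_const 1).add (i1 i)).const_mul _
    have i4 : Integrable (fun ω => 2 * s * L * q i ω) P := (i1 i).const_mul _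
    refine ⟨(i3.add i4).const_mul δ, ?_⟩
    rw [integral_const_mul, integral_add i3 i4, integral_const_mul, integral_const_mul,
      integral_add (integrable_const _) (i1 i), integral_const]
    simp only [probReal_univ, one_smul]
    have := i2 i
    gcongr
    exact hA i
  have e : δ * (Av A * (1 + p ^ 2 * M) + 2 * s * L * (p ^ 2 * M))
      = Av fun i => δ * (A i * (1 + p ^ 2 * M) + 2 * s * L * (p ^ 2 * M)) := by
    rw [Av_mul, Av_add, Av_const hn]
    simp only [mul_comm (A _)]
    rw [Av_mul, mul_comm (Av A)]
  rw [e]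
  unfold Av
  rw [integral_const_mul, integral_finsetSum _ fun i _ => (hbi i).1]
  exact ⟨(integrable_finsetSum _ fun i _ => (hbi i).1).const_mul _,
    mul_le_mul_of_nonneg_left (Finset.sum_le_sum fun i _ => (hbi i).2) (by positivity)⟩

lemma BlockDesign.abs_integral_minRisk_sub_softmin_le (hn : 1 ≤ n) {X : Ω → Fin n → Fin p → ℝ}
    (hX : BlockDesign P Sig A0 s c X)
    {M : ℝ} (hM : 0 ≤ M) (hq : ∀ w : Fin p → ℝ, w ⬝ᵥ Sig *ᵥ w ≤ M * (w ⬝ᵥ w))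
    {ell0 : ℝ → ℝ} (hcont : Continuous ell0) (hpos : ∀ u, 0 ≤ ell0 u) (ξ : Fin n → ℝ)
    {ℓ : Fin n → ℝ → ℝ} {ε lam K L δ : ℝ} {A : Fin n → ℝ}
    (hA : ∀ i, 0 ≤ A i) (hs : 0 ≤ s) (hlam : 1 ≤ lam) (hK : 0 ≤ K)
    (hL : 0 ≤ L) (hδ : 0 < δ)
    (hℓm : ∀ i, Measurable (ℓ i)) (hℓε : ∀ i z, |ℓ i z - noisyLoss ell0 ξ i z| ≤ ε)
    (hmod : ∀ i z z', |noisyLoss ell0 ξ i z - noisyLoss ell0 ξ i z'|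
      ≤ |z - z'| * (A i + s * (|z| + |z'|)))
    {g : ℝ → ℝ} (hgm : Measurable g) (hgK : ∀ x, |g x| ≤ K) (hgL : ∀ x y, |g x - g y| ≤ K * |x - y|)
    {R : (Fin p → ℝ) → ℝ} {S : Set (Fin p → ℝ)}
    (hSne : S.Nonempty) (hRS : BddBelow (R '' S)) (hS : ∀ w ∈ S, ∀ j, w j ∈ Set.Icc (-L) L)
    {T : Finset (Fin p → ℤ)} (hTcard : Real.log T.card ≤ p * Real.log (2 * L / δ + 2))
    {w : T → Fin p → ℝ} {cst : T → ℝ} (happ : IsSoftminNet R S δ w cst) :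
    |∫ ω, g (minRisk (noisyLoss ell0 ξ) R S (X ω)) ∂P
      - ∫ x, g (softmin (n * lam) (blockRisk n ℓ cst w x))
        ∂(Measure.pi (fun a : Fin n × Fin k => P.map fun ω => maskBlock c a.2 (X ω a.1)))|
      ≤ smoothingError n p lam K s L M (Av A) δ ε := by
  have hfm : Measurable fun x : Fin n × Fin k → Fin p → ℝ =>
      g (softmin (n * lam) (blockRisk n ℓ cst w x)) := hgm.comp
    (measurable_softmin _ fun v => measurable_blockRisk n hℓm cst w v)
  have hXm : ∀ i, Measurable fun ω => X ω i := fun i => (measurable_pi_apply i).comp hX.measurable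
  have hbm : Measurable fun ω (a : Fin n × Fin k) => maskBlock c a.2 (X ω a.1) :=
    measurable_pi_lambda _ fun a => (measurable_maskBlock c a.2).comp (hXm a.1)
  have hrm : Measurable fun ω => g (minRisk (noisyLoss ell0 ξ) R S (X ω)) :=
    hgm.comp (measurable_minRisk_comp hcont hpos hSne hRS hX.measurable measurable_const)
  have hi1 : Integrable (fun ω => g (minRisk (noisyLoss ell0 ξ) R S (X ω))) P :=
    Integrable.of_bound hrm.aestronglyMeasurable K (Eventually.of_forall fun ω => hgK _)
  have hi2 : Integrable (fun ω => g (softmin (n * lam) (blockRisk n ℓ cst w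
      fun a : Fin n × Fin k => maskBlock c a.2 (X ω a.1)))) P :=
    Integrable.of_bound (hfm.comp hbm).aestronglyMeasurable K (Eventually.of_forall fun ω => hgK _)
  rw [← map_blocks_eq_pi c hX.measurable hX.indep hX.blocks,
    integral_map hbm.aemeasurable hfm.aestronglyMeasurable, ← integral_sub hi1 hi2]
  obtain ⟨j1, j2⟩ := hX.integral_Av_modulus_le hn hM hq hA hs hL hδ
  have hpt := fun ω => (hgL _ _).trans (mul_le_mul_of_nonneg_left
    (abs_minRisk_sub_softmin_le (c := c) hn hpos ξ hA hs hlam hL hδ hℓε hmod hS hTcard happ (X ω))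
      hK)
  have hfin := (j1.add (integrable_const (ε + p * Real.log (2 * L / δ + 2) / (n * lam)))).const_mul K
  refine (abs_integral_le_integral_abs.trans (integral_mono (hi1.sub hi2).abs hfin hpt)).trans ?_
  simp only [Pi.add_apply]
  rw [integral_const_mul, integral_add j1 (integrable_const _), integral_const]
  simp only [probReal_univ, one_smul, smoothingError]
  refine mul_le_mul_of_nonneg_left ?_ hK
  linarith

lemma BlockDesign.abs_integral_softmin_sub_le (hn : 1 ≤ n) {X G : Ω → Fin n → Fin p → ℝ}
    (hX : BlockDesign P Sig A0 s c X) (hG : BlockDesign P Sig A0 s c G)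
    {M : ℝ} (hM : 0 ≤ M) (hq : ∀ w : Fin p → ℝ, w ⬝ᵥ Sig *ᵥ w ≤ M * (w ⬝ᵥ w)) {d : ℕ}
    (hd : ∀ b, (Finset.univ.filter (fun j => c j = b)).card ≤ d)
    {ℓ : Fin n → ℕ → ℝ → ℝ} {D : Fin n → ℝ → ℝ} {C lam K L : ℝ} {A : Fin n → ℝ}
    (hA : ∀ i, 0 ≤ A i) (hA0 : 0 ≤ A0) (hs : 0 ≤ s) (hC : 0 ≤ C) (hlam : 1 ≤ lam) (hK : 0 ≤ K)
    (hL : 0 ≤ L) (hℓ : SmoothLosses ℓ D C s A)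
    {g : ℕ → ℝ → ℝ} (hg : ∀ k < 3, ∀ x, HasDerivAt (g k) (g (k + 1) x) x)
    (hgK : ∀ k ≤ 3, ∀ x, |g k x| ≤ K) {ι : Type*} [Fintype ι] [Nonempty ι] (cst : ι → ℝ)
    {w : ι → Fin p → ℝ} (hw : ∀ v j, |w v j| ≤ L) :
    |∫ x, g 0 (softmin (n * lam) (blockRisk n (fun i => ℓ i 0) cst w x))
        ∂(Measure.pi (fun a : Fin n × Fin k => P.map fun ω => maskBlock c a.2 (X ω a.1)))
      - ∫ x, g 0 (softmin (n * lam) (blockRisk n (fun i => ℓ i 0) cst w x))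
        ∂(Measure.pi (fun a : Fin n × Fin k => P.map fun ω => maskBlock c a.2 (G ω a.1)))|
      ≤ replacementError n p d lam C K A0 s L M (Av A) := by
  have hnR : (1 : ℝ) ≤ n := by exact_mod_cast hn
  have hn0 : (0 : ℝ) < n := by linarith
  have hprob : ∀ {X : Ω → Fin n → Fin p → ℝ}, BlockDesign P Sig A0 s c X → ∀ a : Fin n × Fin k,
      IsProbabilityMeasure (P.map fun ω => maskBlock c a.2 (X ω a.1)) := fun {X} hX a =>
    Measure.isProbabilityMeasure_map ((measurable_maskBlock c a.2).comp
      ((measurable_pi_apply a.1).comp hX.measurable)).aemeasurable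
  have := hprob hX
  have := hprob hG
  set m : Fin k → ℝ := fun b => ((Finset.univ.filter (fun j => c j = b)).card : ℝ) with hm
  have hmsum : ∑ b, m b = p := by
    have := sum_card_fibre c
    rw [hm, ← Nat.cast_sum, this]
  have hsum : ∀ a b : ℝ, ∑ i, a * (m i * b) = a * (p * b) := fun a b => by
    rw [← Finset.mul_sum, ← Finset.sum_mul, hmsum]
  have rep := abs_integral_softmin_blockRisk_sub_le 
    (fun a : Fin n × Fin k => P.map fun ω => maskBlock c a.2 (X ω a.1))
    (fun a : Fin n × Fin k => P.map fun ω => maskBlock c a.2 (G ω a.1))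
    (fun a => ((hX.rows a.1).matched (hG.rows a.1) c a.2).1)
    (fun a => ((hX.rows a.1).matched (hG.rows a.1) c a.2).2)
    (Z4 := L ^ 4 * d ^ 3 * (p * (A0 / √n ^ 4)) + 3 * (M * (p * L ^ 2) / n) ^ 2)
    hnR hlam hC hK hs hA hℓ hg hgK cst hL hw (by positivity)
    (fun a => (hX.rows a.1).blockMoments hM hq c a.2 (hd a.2) hL hw)
    (fun a => (hG.rows a.1).blockMoments hM hq c a.2 (hd a.2) hL hw)
    (fun i => by
      have e1 := hsum (L ^ 4 * d ^ 3) (A0 / √n ^ 4)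
      have e2 : ∑ b, M * (m b * L ^ 2) / n = M * (p * L ^ 2) / n := by
        rw [← Finset.sum_div, hsum]
      simp only [hm] at e1 e2
      rw [e1, e2])
  have e3 : 23 * K * (1 + C) * lam ^ 2 / n *
        ∑ a : Fin n × Fin k, (2 * (L ^ 3 * d ^ 2 * (m a.2 * (A0 / √n ^ 3))) * (1 + A a.1
          + 8 * s * (L ^ 4 * d ^ 3 * (p * (A0 / √n ^ 4)) + 3 * (M * (p * L ^ 2) / n) ^ 2))
          + 16 * s * (L ^ 7 * d ^ 6 * (m a.2 * (A0 / √n ^ 7))))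
      = replacementError n p d lam C K A0 s L M (Av A) := by
    set Z := L ^ 4 * d ^ 3 * (p * (A0 / √n ^ 4)) + 3 * (M * (p * L ^ 2) / n) ^ 2 with hZ
    rw [Fintype.sum_prod_type]
    have e4 : ∀ i, ∑ b, (2 * (L ^ 3 * d ^ 2 * (m b * (A0 / √n ^ 3))) * (1 + A i + 8 * s * Z)
          + 16 * s * (L ^ 7 * d ^ 6 * (m b * (A0 / √n ^ 7))))
        = 2 * (L ^ 3 * d ^ 2 * (p * (A0 / √n ^ 3))) * (1 + A i + 8 * s * Z)
          + 16 * s * (L ^ 7 * d ^ 6 * (p * (A0 / √n ^ 7))) := by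
      intro i
      rw [Finset.sum_add_distrib, ← Finset.sum_mul, ← Finset.mul_sum, hsum, ← Finset.mul_sum, hsum]
    simp only [e4]
    rw [Finset.sum_add_distrib, ← Finset.mul_sum, Finset.sum_add_distrib, Finset.sum_add_distrib,
      replacementError]
    simp only [Finset.sum_const, Finset.card_univ, Fintype.card_fin, nsmul_eq_mul, mul_one]
    have e5 : ∑ i, A i = n * Av A := by unfold Av; field_simp
    rw [e5, ← hZ]
    field_simp
  simp only [hm] at e3
  rw [e3] at rep
  exact rep

theorem abs_integral_minRisk_sub_le (hn : 1 ≤ n) {X G : Ω → Fin n → Fin p → ℝ}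
    (hX : BlockDesign P Sig A0 s c X) (hG : BlockDesign P Sig A0 s c G)
    {M : ℝ} (hM : 0 ≤ M) (hq : ∀ w : Fin p → ℝ, w ⬝ᵥ Sig *ᵥ w ≤ M * (w ⬝ᵥ w)) {d : ℕ}
    (hd : ∀ b, (Finset.univ.filter (fun j => c j = b)).card ≤ d)
    {ell0 : ℝ → ℝ} (hcont : Continuous ell0) (hpos : ∀ u, 0 ≤ ell0 u) (ξ : Fin n → ℝ)
    {ℓ : Fin n → ℕ → ℝ → ℝ} {D : Fin n → ℝ → ℝ} {C ε lam K L δ : ℝ} {A : Fin n → ℝ}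
    (hA : ∀ i, 0 ≤ A i) (hA0 : 0 ≤ A0) (hs : 0 ≤ s) (hC : 0 ≤ C) (hlam : 1 ≤ lam) (hK : 0 ≤ K)
    (hL : 0 ≤ L) (hδ : 0 < δ)
    (hℓ : SmoothLosses ℓ D C s A) (hℓε : ∀ i z, |ℓ i 0 z - noisyLoss ell0 ξ i z| ≤ ε)
    (hmod : ∀ i z z', |noisyLoss ell0 ξ i z - noisyLoss ell0 ξ i z'|
      ≤ |z - z'| * (A i + s * (|z| + |z'|)))
    {g : ℕ → ℝ → ℝ} (hg : ∀ k < 3, ∀ x, HasDerivAt (g k) (g (k + 1) x) x)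
    (hgK : ∀ k ≤ 3, ∀ x, |g k x| ≤ K) {R : (Fin p → ℝ) → ℝ} {S : Set (Fin p → ℝ)}
    (hSne : S.Nonempty) (hRS : BddBelow (R '' S)) (hS : ∀ w ∈ S, ∀ j, w j ∈ Set.Icc (-L) L) :
    |∫ ω, g 0 (minRisk (noisyLoss ell0 ξ) R S (X ω)) ∂P
      - ∫ ω, g 0 (minRisk (noisyLoss ell0 ξ) R S (G ω)) ∂P|
      ≤ 2 * smoothingError n p lam K s L M (Av A) δ ε
        + replacementError n p d lam C K A0 s L M (Av A) := by
  obtain ⟨T, hTne, hTcard, w, cst, hwS, happ⟩ := exists_softmin_approx hSne hRS hS hδ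
  have : Nonempty T := hTne.to_subtype
  have hw : ∀ v j, |w v j| ≤ L := fun v j => abs_le.2 (hS _ (hwS v) j)
  have hℓm : ∀ i, Measurable (ℓ i 0) := fun i =>
    (continuous_iff_continuousAt.2 fun x => (hℓ.hasDerivAt i 0 (by norm_num) x).continuousAt).measurable
  have hgm : Measurable (g 0) :=
    (continuous_iff_continuousAt.2 fun x => (hg 0 (by norm_num) x).continuousAt).measurable
  have hgL : ∀ x y, |g 0 x - g 0 y| ≤ K * |x - y| := fun x y =>
    Convex.norm_image_sub_le_of_norm_hasDerivWithin_le (s := Set.univ)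
      (fun z _ => (hg 0 (by norm_num) z).hasDerivWithinAt) (fun z _ => hgK 1 (by norm_num) z)
      convex_univ (Set.mem_univ y) (Set.mem_univ x)
  have approx : ∀ {X : Ω → Fin n → Fin p → ℝ}, BlockDesign P Sig A0 s c X → _ := fun hX =>
    hX.abs_integral_minRisk_sub_softmin_le hn hM hq hcont hpos ξ hA hs hlam hK hL hδ hℓm hℓε hmod hgm
      (hgK 0 (by norm_num)) hgL hSne hRS hS hTcard happ
  have aX := approx hX
  have aG := approx hG
  rw [abs_sub_comm] at aG
  have rep := hX.abs_integral_softmin_sub_le hn hG hM hq hd hA hA0 hs hC hlam hK hL hℓ hg hgK cst hw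
  have t1 := abs_sub_le (∫ ω, g 0 (minRisk (noisyLoss ell0 ξ) R S (X ω)) ∂P)
    (∫ x, g 0 (softmin (n * lam) (blockRisk n (fun i => ℓ i 0) cst w x))
        ∂(Measure.pi (fun a : Fin n × Fin k => P.map fun ω => maskBlock c a.2 (X ω a.1))))
    (∫ x, g 0 (softmin (n * lam) (blockRisk n (fun i => ℓ i 0) cst w x))
        ∂(Measure.pi (fun a : Fin n × Fin k => P.map fun ω => maskBlock c a.2 (G ω a.1))))
  have t2 := abs_sub_le (∫ ω, g 0 (minRisk (noisyLoss ell0 ξ) R S (X ω)) ∂P)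
    (∫ x, g 0 (softmin (n * lam) (blockRisk n (fun i => ℓ i 0) cst w x))
        ∂(Measure.pi (fun a : Fin n × Fin k => P.map fun ω => maskBlock c a.2 (G ω a.1))))
    (∫ ω, g 0 (minRisk (noisyLoss ell0 ξ) R S (G ω)) ∂P)
  linarith

end FixedNoise

/-! ### Smoothing of the losses -/

section MovingAverage

/-- The average of `f` over `[u, u + r]`. -/
noncomputable def movingAverage (r : ℝ) (f : ℝ → ℝ) (u : ℝ) : ℝ := ∫ t in (0 : ℝ)..1, f (u + r * t)

/-- The difference quotient of `f` with step `r`. -/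
noncomputable def diffQuotient (r : ℝ) (f : ℝ → ℝ) (u : ℝ) : ℝ := (f (u + r) - f u) / r

/-- `f` is Lipschitz with the real constant `Λ`. -/
def HasLipschitzBound (Λ : ℝ) (f : ℝ → ℝ) : Prop := ∀ u v, |f u - f v| ≤ Λ * |u - v|

variable {f : ℝ → ℝ} {Λ r : ℝ}

lemma HasLipschitzBound.continuous (hf : HasLipschitzBound Λ f) : Continuous f :=
  (LipschitzWith.of_dist_le' (K := Λ) fun u v => hf u v).continuous

lemma continuous_shift (hf : Continuous f) (u : ℝ) : Continuous fun t => f (u + r * t) :=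
  hf.comp (by fun_prop)

lemma HasLipschitzBound.movingAverage (hf : HasLipschitzBound Λ f) :
    HasLipschitzBound Λ (movingAverage r f) := by
  intro u v
  unfold _root_.movingAverage
  rw [← intervalIntegral.integral_sub ((continuous_shift hf.continuous u).intervalIntegrable _ _)
    ((continuous_shift hf.continuous v).intervalIntegrable _ _)]
  have h := intervalIntegral.norm_integral_le_of_norm_le_const (a := (0 : ℝ)) (b := 1)
    (C := Λ * |u - v|) (f := fun t => f (u + r * t) - f (v + r * t)) (fun t _ => by
      have := hf (u + r * t) (v + r * t)
      simpa using this)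
  simpa using h

/-- Stated for an approximation `f'` of `f`, so that it can be iterated: each averaging adds `Λ r`
to the error. -/
lemma abs_movingAverage_sub_le {f' : ℝ → ℝ} (hf : HasLipschitzBound Λ f) (hΛ : 0 ≤ Λ) (hr : 0 ≤ r)
    {η : ℝ} (hf' : Continuous f') (h : ∀ u, |f' u - f u| ≤ η) (u : ℝ) :
    |movingAverage r f' u - f u| ≤ η + Λ * r := by
  have e : movingAverage r f' u - f u = ∫ t in (0 : ℝ)..1, (f' (u + r * t) - f u) := by
    rw [intervalIntegral.integral_sub ((continuous_shift hf' u).intervalIntegrable _ _)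
      (by simp)]
    simp [movingAverage]
  rw [e]
  have h := intervalIntegral.norm_integral_le_of_norm_le_const (a := (0 : ℝ)) (b := 1)
    (C := η + Λ * r) (f := fun t => f' (u + r * t) - f u) (fun t ht => by
      rw [Set.uIoc_of_le zero_le_one] at ht
      have h1 := h (u + r * t)
      have h2 := hf (u + r * t) u
      rw [add_sub_cancel_left, abs_of_nonneg (mul_nonneg hr ht.1.le)] at h2
      have h3 : Λ * (r * t) ≤ Λ * r := mul_le_mul_of_nonneg_left (mul_le_of_le_one_right hr ht.2) hΛ
      exact (abs_sub_le _ (f (u + r * t)) _).trans (by linarith))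
  simpa using h

/-- After the substitution the average is a difference of primitives divided by `r`. So each
averaging buys one derivative, and that derivative is again explicit. -/
lemma hasDerivAt_movingAverage (hr : 0 < r) (hf : Continuous f) (u : ℝ) :
    HasDerivAt (movingAverage r f) (diffQuotient r f u) u := by
  have e : movingAverage r f = fun u => r⁻¹ * ((∫ t in (0 : ℝ)..(u + r), f t) - ∫ t in (0 : ℝ)..u, f t) := by
    funext u
    rw [intervalIntegral.integral_interval_sub_left (hf.intervalIntegrable _ _)
      (hf.intervalIntegrable _ _), movingAverage, intervalIntegral.integral_comp_add_mul _ hr.ne']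
    simp
  rw [e]
  have h (v : ℝ) : HasDerivAt (fun u => ∫ t in (0 : ℝ)..u, f t) (f v) v :=
    intervalIntegral.integral_hasDerivAt_right (hf.intervalIntegrable _ _)
      hf.stronglyMeasurable.stronglyMeasurableAtFilter hf.continuousAt
  have h2 := (((h (u + r)).comp_add_const u r).sub (h u)).const_mul r⁻¹
  refine h2.congr_deriv ?_
  unfold diffQuotient
  ring

lemma HasDerivAt.diffQuotient {f' : ℝ → ℝ} (hf : ∀ u, HasDerivAt f (f' u) u) (u : ℝ) :
    HasDerivAt (diffQuotient r f) (_root_.diffQuotient r f' u) u :=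
  (((hf (u + r)).comp_add_const u r).sub (hf u)).div_const r

lemma HasLipschitzBound.abs_diffQuotient_le (hf : HasLipschitzBound Λ f) (hr : 0 < r) (u : ℝ) :
    |diffQuotient r f u| ≤ Λ := by
  have h := hf (u + r) u
  rw [add_sub_cancel_left, abs_of_pos hr] at h
  rw [diffQuotient, abs_div, abs_of_pos hr]
  exact (div_le_iff₀ hr).2 h

lemma abs_diffQuotient_le (hr : 0 < r) {B : ℝ} (hf : ∀ u, |f u| ≤ B) (u : ℝ) :
    |diffQuotient r f u| ≤ 2 * B / r := by
  rw [diffQuotient, abs_div, abs_of_pos hr]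
  refine div_le_div_of_nonneg_right ?_ hr.le
  have := abs_sub (f (u + r)) (f u)
  linarith [hf (u + r), hf u]

end MovingAverage

/-- A nonnegative loss whose translates can be smoothed up to an arbitrarily small error, with
a cubic derivative bound that grows with the noise unless `s = 0`. -/
structure SmoothableLoss (ell0 : ℝ → ℝ) (A1 s : ℝ) : Prop where
  continuous : Continuous ell0
  nonneg : ∀ u, 0 ≤ ell0 u
  A1_nonneg : 0 ≤ A1
  s_nonneg : 0 ≤ s
  modulus : ∀ {n : ℕ} (ξ : Fin n → ℝ) i z z', |noisyLoss ell0 ξ i z - noisyLoss ell0 ξ i z'|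
    ≤ |z - z'| * (A1 + s * |ξ i| ^ 3 + s * (|z| + |z'|))
  smooth : ∀ ε : ℝ, 0 < ε → ∃ C : ℝ, 0 ≤ C ∧ ∀ {n : ℕ} (ξ : Fin n → ℝ),
    ∃ (ℓ : Fin n → ℕ → ℝ → ℝ) (D : Fin n → ℝ → ℝ),
      SmoothLosses ℓ D C s (fun i => A1 + s * |ξ i| ^ 3) ∧
      ∀ i z, |ℓ i 0 z - noisyLoss ell0 ξ i z| ≤ ε

/-- Three moving averages give three derivatives. The first stays bounded by `Λ`, so the constant `D
= Λ ^ 3` serves and `s = 0`; the next two are bounded by powers of `1 / r`, which is harmless as `r`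
depends only on `ε` and `Λ`. In the constant, `Λ` serves the modulus and `Λ ^ 3` the cubic bound. -/
theorem SmoothableLoss.of_lipschitz {f : ℝ → ℝ} {Λ : ℝ} (hΛ : 0 ≤ Λ) (hf : HasLipschitzBound Λ f)
    (hpos : ∀ u, 0 ≤ f u) : SmoothableLoss f (Λ + Λ ^ 3) 0 where
  continuous := hf.continuous
  nonneg := hpos
  A1_nonneg := by positivity
  s_nonneg := le_rfl
  modulus := by
    intro n ξ i z z'
    have h := hf (z - ξ i) (z' - ξ i)
    rw [sub_sub_sub_cancel_right] at h
    simp only [zero_mul, add_zero]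
    unfold noisyLoss
    nlinarith [mul_nonneg (abs_nonneg (z - z')) (pow_nonneg hΛ 3)]
  smooth := by
    intro ε hε
    -- Three averagings cost `3 Λ r`; the `+ 1` in the witness allows `Λ = 0`.
    obtain ⟨r, hr, hrε⟩ : ∃ r : ℝ, 0 < r ∧ 3 * Λ * r ≤ ε := by
      refine ⟨ε / (3 * Λ + 1), by positivity, ?_⟩
      rw [mul_div_assoc', div_le_iff₀ (by positivity)]
      nlinarith
    set f1 := movingAverage r f with hf1
    set f2 := movingAverage r f1 with hf2
    have l1 : HasLipschitzBound Λ f1 := hf.movingAverage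
    have l2 : HasLipschitzBound Λ f2 := l1.movingAverage
    have b2 : ∀ {h : ℝ → ℝ}, HasLipschitzBound Λ h → ∀ u,
        |diffQuotient r (diffQuotient r h) u| ≤ 2 * Λ / r := fun hh u =>
      abs_diffQuotient_le hr (hh.abs_diffQuotient_le hr) u
    have b3 : ∀ u, |diffQuotient r (diffQuotient r (diffQuotient r f)) u| ≤ 2 * (2 * Λ / r) / r :=
      fun u => abs_diffQuotient_le hr (b2 hf) u
    -- Each differentiation turns one averaging into a difference quotient.
    set F : ℕ → ℝ → ℝ := fun k => match k with
      | 0 => movingAverage r f2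
      | 1 => diffQuotient r f2
      | 2 => diffQuotient r (diffQuotient r f1)
      | _ => diffQuotient r (diffQuotient r (diffQuotient r f)) with hF
    have hFd : ∀ k < 3, ∀ x, HasDerivAt (F k) (F (k + 1) x) x := by
      intro k hk x
      interval_cases k
      · exact hasDerivAt_movingAverage hr l2.continuous x
      · exact HasDerivAt.diffQuotient (fun u => hasDerivAt_movingAverage hr l1.continuous u) x
      · exact HasDerivAt.diffQuotient (HasDerivAt.diffQuotient
          (fun u => hasDerivAt_movingAverage hr hf.continuous u)) x
    have e1 := abs_movingAverage_sub_le (η := 0) hf hΛ hr.le hf.continuous (by simp)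
    have e2 := abs_movingAverage_sub_le hf hΛ hr.le l1.continuous e1
    have e3 := abs_movingAverage_sub_le hf hΛ hr.le l2.continuous e2
    refine ⟨2 * Λ / r + 2 * (2 * Λ / r) / r, by positivity, fun {n} ξ =>
      ⟨fun i k z => F k (z - ξ i), fun _ _ => Λ ^ 3, ⟨?_, ?_, ?_, ?_, ?_, ?_⟩, ?_⟩⟩
    · intro i k hk x
      exact (hFd k hk (x - ξ i)).comp_sub_const x (ξ i)
    · intro i x
      refine (b2 l1 (x - ξ i)).trans (le_add_of_nonneg_right (by positivity))
    · intro i x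
      refine (b3 (x - ξ i)).trans (le_add_of_nonneg_left (by positivity))
    · intro i x
      exact pow_le_pow_left₀ (abs_nonneg _) (l2.abs_diffQuotient_le hr _) 3
    · exact fun _ _ _ _ => le_rfl
    · intro i x
      simp only [zero_mul, add_zero]
      linarith
    · intro i z
      exact (e3 (z - ξ i)).trans (by linarith)

/-! ### The absolute, Huber and squared losses -/

lemma hasLipschitzBound_absoluteLoss : HasLipschitzBound 1 absoluteLoss := fun u v => by
  rw [one_mul]
  exact abs_abs_sub_abs_le_abs_sub u v

/-- The Huber loss is the maximum of the affine functions with slopes in `[-η, η]` that support the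
parabola. -/
lemma huberLoss_isGreatest {η : ℝ} (hη : 0 < η) (u : ℝ) :
    (∀ s, |s| ≤ η → s * u - s ^ 2 / 2 ≤ huberLoss η u) ∧
      ∃ s, |s| ≤ η ∧ huberLoss η u = s * u - s ^ 2 / 2 := by
  unfold huberLoss
  split_ifs with h
  · exact ⟨fun s _ => by nlinarith [sq_nonneg (s - u)], u, h, by ring⟩
  · push Not at h
    constructor
    · intro s hs
      have h1 : s * u ≤ |s| * |u| := (le_abs_self _).trans (abs_mul s u).le
      rw [← sq_abs s]
      nlinarith [mul_nonneg (sub_nonneg.2 hs) (sub_nonneg.2 h.le), sq_nonneg (η - |s|)]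
    · rcases le_total 0 u with hu | hu
      · exact ⟨η, (abs_of_pos hη).le, by rw [abs_of_nonneg hu]⟩
      · exact ⟨-η, by rw [abs_neg, abs_of_pos hη], by rw [abs_of_nonpos hu]; ring⟩

/-- A maximum of affine functions with slopes at most `η` in modulus is `η`-Lipschitz: the slope
that is optimal at `u` is a competitor at `v`. -/
lemma hasLipschitzBound_huberLoss {η : ℝ} (hη : 0 < η) : HasLipschitzBound η (huberLoss η) := by
  have key : ∀ u v, huberLoss η u - huberLoss η v ≤ η * |u - v| := by
    intro u v
    obtain ⟨s, hs, e⟩ := (huberLoss_isGreatest hη u).2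
    have h1 := (huberLoss_isGreatest hη v).1 s hs
    have h2 : s * (u - v) ≤ η * |u - v| := (le_abs_self _).trans
      ((abs_mul _ _).le.trans (mul_le_mul_of_nonneg_right hs (abs_nonneg _)))
    linarith
  intro u v
  rw [abs_le]
  have h1 := key u v
  have h2 := key v u
  rw [abs_sub_comm] at h2
  constructor <;> linarith

lemma huberLoss_nonneg {η : ℝ} (hη : 0 < η) (u : ℝ) : 0 ≤ huberLoss η u := by
  simpa using (huberLoss_isGreatest hη u).1 0 (by simpa using hη.le)

/-- No smoothing is needed. `D = 8 |z - ξ i| ^ 3` is the cube of the derivative and an increasing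
function of the loss; `(a + b) ^ 3 ≤ 4 (a ^ 3 + b ^ 3)` and `|x| ^ 3 ≤ 1 + x ^ 4` bound it by `32 +
32 |ξ i| ^ 3 + 32 x ^ 4`. -/
theorem smoothableLoss_squaredLoss : SmoothableLoss squaredLoss 32 32 where
  continuous := by unfold squaredLoss; fun_prop
  nonneg := fun u => sq_nonneg u
  A1_nonneg := by norm_num
  s_nonneg := by norm_num
  modulus := by
    intro n ξ i z z'
    have e : noisyLoss squaredLoss ξ i z - noisyLoss squaredLoss ξ i z'
        = (z - z') * (z + z' - 2 * ξ i) := by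
      unfold noisyLoss squaredLoss; ring
    rw [e, abs_mul]
    refine mul_le_mul_of_nonneg_left ?_ (abs_nonneg _)
    have h1 := abs_sub (z + z') (2 * ξ i)
    have h2 := abs_add_le z z'
    rw [abs_mul, abs_two] at h1
    have h3 : |ξ i| ≤ 1 + |ξ i| ^ 3 := by
      rcases le_total |ξ i| 1 with h | h
      · linarith [pow_nonneg (abs_nonneg (ξ i)) 3]
      · linarith [le_self_pow₀ h (three_ne_zero)]
    linarith [abs_nonneg z, abs_nonneg z', abs_nonneg (ξ i)]
  smooth := by
    intro ε hε
    refine ⟨2, by norm_num, fun {n} ξ => ⟨fun i k z => match k with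
      | 0 => (z - ξ i) ^ 2
      | 1 => 2 * (z - ξ i)
      | 2 => 2
      | _ => 0, fun i z => 8 * |z - ξ i| ^ 3, ⟨?_, ?_, ?_, ?_, ?_, ?_⟩, ?_⟩⟩
    · intro i k hk x
      have h0 : HasDerivAt (fun z => z - ξ i) 1 x := (hasDerivAt_id x).sub_const _
      interval_cases k
      · exact (h0.fun_pow 2).congr_deriv (by simp)
      · simpa using h0.const_mul 2
      · exact hasDerivAt_const x 2
    · intro i x; simp
    · intro i x; simp
    · intro i x
      simp only [abs_mul, abs_two, mul_pow]
      norm_num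
    · intro i x y h
      have := pow_le_pow_left₀ (abs_nonneg _) (sq_le_sq.1 h) 3
      simpa using this
    · intro i x
      have h1 : |x - ξ i| ≤ |x| + |ξ i| := abs_sub _ _
      have h2 := pow_le_pow_left₀ (abs_nonneg _) h1 3
      have h3 : (|x| + |ξ i|) ^ 3 ≤ 4 * (|x| ^ 3 + |ξ i| ^ 3) := by
        nlinarith [mul_nonneg (add_nonneg (abs_nonneg x) (abs_nonneg (ξ i)))
          (sq_nonneg (|x| - |ξ i|))]
      have h4 : |x| ^ 3 ≤ 1 + x ^ 4 := by
        rw [← Even.pow_abs (by decide : Even 4) x]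
        rcases le_total |x| 1 with h | h
        · linarith [pow_le_one₀ (n := 3) (abs_nonneg x) h, pow_nonneg (abs_nonneg x) 4]
        · linarith [pow_le_pow_right₀ h (by norm_num : 3 ≤ 4)]
      linarith
    · intro i z
      simp [noisyLoss, squaredLoss, hε.le]

lemma IsExampleLoss.smoothableLoss {ell0 : ℝ → ℝ} (h : IsExampleLoss ell0) :
    ∃ A1 s, SmoothableLoss ell0 A1 s ∧ (s ≠ 0 → ell0 = squaredLoss) := by
  rcases h with rfl | rfl | ⟨η, hη, rfl⟩
  · exact ⟨_, _, smoothableLoss_squaredLoss, fun _ => rfl⟩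
  · exact ⟨_, _, .of_lipschitz zero_le_one hasLipschitzBound_absoluteLoss fun u => abs_nonneg u,
      fun h => absurd rfl h⟩
  · exact ⟨_, _, .of_lipschitz hη.le (hasLipschitzBound_huberLoss hη) (huberLoss_nonneg hη),
      fun h => absurd rfl h⟩

/-! ### Consequences of the regularity assumption for the squared loss -/

section SquaredLoss

lemma not_forall_rpow_le {a C : ℝ} (ha : 0 < a) : ¬ ∀ U : ℝ, 1 ≤ U → U ^ a ≤ C := by
  intro h
  obtain ⟨U, hU, hUC⟩ := (((tendsto_rpow_atTop ha).eventually_gt_atTop C).and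
    (eventually_ge_atTop 1)).exists
  exact absurd (h U hUC) (not_le.2 hU)

variable {n : ℕ} {ξ : Fin n → ℝ} {q : Fin 4 → ℝ} {Lc : Fin n → ℝ} {ρbar : ℝ}
  {Dℓ Mℓ : Set.Ioo (0 : ℝ) ρbar → ℝ}

/-- Quadratic growth at infinity is incompatible with a smaller exponent: `U ^ (2 - q 0)` would stay
bounded. -/
lemma LossAssumption.two_le_q_zero
    (h : LossAssumption (noisyLoss squaredLoss ξ) q Lc ρbar Dℓ Mℓ) (i : Fin n) : 2 ≤ q 0 := by
  by_contra! hq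
  have h0 := h.q_nonneg 0
  refine not_forall_rpow_le (a := 2 - q 0) (C := 4 * Lc i + 2 * ξ i ^ 2) (by linarith) fun U hU => ?_
  have hU0 : 0 < U := by linarith
  have h1 := h.growth i U
  rw [div_le_iff₀ (by positivity), abs_of_pos hU0] at h1
  have h2 : (U - ξ i) ^ 2 ≤ Lc i * (1 + U ^ q 0) := by
    simpa [noisyLoss, squaredLoss] using h1
  have h3 : 1 ≤ U ^ q 0 := Real.one_le_rpow hU h0
  have hL := h.one_le_Lc i
  have h4 : U ^ 2 ≤ U ^ q 0 * (4 * Lc i + 2 * ξ i ^ 2) := by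
    nlinarith [sq_nonneg (U - 2 * ξ i), mul_nonneg (sub_nonneg.2 h3) (sq_nonneg (ξ i)),
      mul_nonneg (sub_nonneg.2 h3) (zero_le_one.trans hL)]
  rw [Real.rpow_sub hU0, div_le_iff₀ (by positivity), mul_comm]
  exact_mod_cast h4

/-- A smooth function within `1` of the parabola must rise by about `U ^ 2` over an interval of
length `U`, while its derivative there is at most of order `U ^ (2 q₁)`. The mean value inequality
then bounds `U ^ (1 - 2 q₁)`. -/
lemma LossAssumption.half_le_q_one
    (h : LossAssumption (noisyLoss squaredLoss ξ) q Lc ρbar Dℓ Mℓ) (i : Fin n) : 1 / 2 ≤ q 1 := by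
  by_contra! hq
  have h0 := h.q_nonneg 1
  obtain ⟨ℓs, hℓs⟩ := h.approx
  set ρ : Set.Ioo (0 : ℝ) ρbar := ⟨ρbar / 2, by have := h.ρbar_pos; constructor <;> linarith⟩
  obtain ⟨hpos, hC3, happ, hder⟩ := hℓs ρ i
  set f := ℓs ρ i
  set D := Dℓ ρ with hD
  have hD1 : 1 ≤ D := h.one_le_D ρ
  have hM1 : Mℓ ρ ≤ 1 := h.M_le_one ρ
  have hf : ∀ u, |f (u + ξ i) - u ^ 2| ≤ 1 := fun u => by
    simpa [noisyLoss, squaredLoss] using (happ (u + ξ i)).trans hM1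
  have hd : ∀ x, |deriv f x| ≤ D * (1 + f x ^ q 1) := by
    intro x
    have h1 := hder 1 (by decide) x
    rw [div_le_iff₀ (by positivity), abs_of_nonneg (hpos x)] at h1
    simpa [iteratedDeriv_one] using h1
  have hdiff : Differentiable ℝ f := hC3.differentiable (by norm_num)
  refine not_forall_rpow_le (a := 1 - 2 * q 1) (C := 6 * D) (by linarith) fun U hU => ?_
  have hU0 : 0 < U := by linarith
  have hUq : 1 ≤ U ^ (2 * q 1) := Real.one_le_rpow hU (by linarith)
  have hb : ∀ x ∈ Set.Icc (0 : ℝ) U, f (x + ξ i) ^ q 1 ≤ 2 * U ^ (2 * q 1) := by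
    intro x hx
    have h1 := (abs_le.1 (hf x)).2
    have h2 : f (x + ξ i) ≤ 2 * U ^ 2 := by nlinarith [hx.1, hx.2]
    calc f (x + ξ i) ^ q 1 ≤ (2 * U ^ 2) ^ q 1 := Real.rpow_le_rpow (hpos _) h2 h0
      _ = 2 ^ q 1 * U ^ (2 * q 1) := by
        rw [Real.mul_rpow (by norm_num) (by positivity), Real.rpow_mul hU0.le, Real.rpow_two]
      _ ≤ 2 * U ^ (2 * q 1) := by
        refine mul_le_mul_of_nonneg_right ?_ (by linarith)
        calc (2 : ℝ) ^ q 1 ≤ 2 ^ (1 : ℝ) := Real.rpow_le_rpow_of_exponent_le (by norm_num) (by linarith)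
          _ = 2 := Real.rpow_one 2
  have hmv := Convex.norm_image_sub_le_of_norm_hasDerivWithin_le (s := Set.Icc 0 U)
    (f := fun x => f (x + ξ i)) (f' := fun x => deriv f (x + ξ i)) (C := D * (3 * U ^ (2 * q 1)))
    (fun x _ => ((hdiff (x + ξ i)).hasDerivAt.comp_add_const x (ξ i)).hasDerivWithinAt)
    (fun x hx => (hd _).trans (mul_le_mul_of_nonneg_left (by linarith [hb x hx]) (by linarith)))
    (convex_Icc 0 U) (Set.left_mem_Icc.2 hU0.le) (Set.right_mem_Icc.2 hU0.le)
  simp only [Real.norm_eq_abs, sub_zero, abs_of_pos hU0] at hmv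
  have h1 := (le_abs_self _).trans hmv
  have h2 := (abs_le.1 (hf U)).1
  have h3 := (abs_le.1 (hf 0)).2
  have h4 : 1 ≤ D * U * U ^ (2 * q 1) :=
    one_le_mul_of_one_le_of_one_le (one_le_mul_of_one_le_of_one_le hD1 hU) hUq
  have h5 : U * U ≤ 6 * D * U ^ (2 * q 1) * U := by nlinarith
  rw [Real.rpow_sub hU0, div_le_iff₀ (by positivity), Real.rpow_one]
  exact le_of_mul_le_mul_right h5 hU0

lemma LossAssumption.three_halves_le_qBold
    (h : LossAssumption (noisyLoss squaredLoss ξ) q Lc ρbar Dℓ Mℓ) (i : Fin n) : 3 / 2 ≤ qBold q :=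
  le_max_of_le_left (by linarith [h.half_le_q_one i])

/-- From `q₀ 𝐪 ≥ 2 · 3/2 = 3` the ceiling of the half is at least `2`. This makes the power `7` of
`L` admissible, as `7 ≤ q̄₀ + 3`, and raises the moment order to at least `16`, which covers the
seventh moments. -/
lemma LossAssumption.four_le_qBar
    (h : LossAssumption (noisyLoss squaredLoss ξ) q Lc ρbar Dℓ Mℓ) (i : Fin n) : 4 ≤ qBar q := by
  have h1 : 3 ≤ q 0 * qBold q := by
    nlinarith [h.two_le_q_zero i, h.three_halves_le_qBold i]
  have h2 : 1 < ⌈q 0 * qBold q / 2⌉₊ := by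
    rw [Nat.lt_ceil]; push_cast; linarith
  unfold qBar
  omega

/-- The growth bound at `x = 0`, where `0 ^ q₀ = 0` because `q₀ ≥ 2`, gives `ξ² ≤ L_{ℓ_i}`; raise it
to the power `3/2 ≤ 𝐪`. Thus tightness of the averaged `L_{ℓ_i}^𝐪` passes to the cubed noise. -/
lemma LossAssumption.abs_pow_three_le
    (h : LossAssumption (noisyLoss squaredLoss ξ) q Lc ρbar Dℓ Mℓ) (i : Fin n) :
    |ξ i| ^ 3 ≤ Lc i ^ qBold q := by
  have h0 := h.two_le_q_zero i
  have hL := h.one_le_Lc i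
  have h1 := h.growth i 0
  rw [abs_zero, Real.zero_rpow (by linarith)] at h1
  have h2 : |ξ i| ^ 2 ≤ Lc i := by simpa [noisyLoss, squaredLoss] using h1
  calc |ξ i| ^ 3 = (|ξ i| ^ 2) ^ (3 / 2 : ℝ) := by
        rw [← Real.rpow_natCast, ← Real.rpow_natCast, ← Real.rpow_mul (abs_nonneg _)]
        norm_num
    _ ≤ Lc i ^ (3 / 2 : ℝ) := Real.rpow_le_rpow (by positivity) h2 (by norm_num)
    _ ≤ _ := Real.rpow_le_rpow_of_exponent_le hL (h.three_halves_le_qBold i)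

end SquaredLoss

lemma four_le_qStar (q : Fin 4 → ℝ) : 4 ≤ qStar q := by
  have : 2 ≤ (qBar q + 4) / 2 := by omega
  exact Nat.pow_le_pow_right (n := 2) (by norm_num) this

lemma seven_le_qStar {q : Fin 4 → ℝ} (h : 4 ≤ qBar q) : 7 ≤ qStar q := by
  have : 4 ≤ (qBar q + 4) / 2 := by omega
  have := Nat.pow_le_pow_right (n := 2) (by norm_num) this
  unfold qStar
  omega

/-! ### Random noise -/

section RandomNoise

/-- Freezing the noise: the joint law is a product. The outer integral is pulled back to `Ω`, so
that for `X` and `G` the inner integrals can be compared at the same value of the noise. -/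
lemma integral_eq_integral_integral_of_indepFun {Ω E F : Type*} [MeasurableSpace Ω]
    [MeasurableSpace E] [MeasurableSpace F] {P : Measure Ω} [IsProbabilityMeasure P] {X : Ω → E}
    {ξ : Ω → F} (hX : Measurable X) (hξ : Measurable ξ) (h : IndepFun X ξ P) {f : E × F → ℝ}
    (hf : Measurable f) {K : ℝ} (hK : ∀ z, |f z| ≤ K) :
    ∫ ω, f (X ω, ξ ω) ∂P = ∫ ω', (∫ ω, f (X ω, ξ ω') ∂P) ∂P ∧
      Integrable (fun ω' => ∫ ω, f (X ω, ξ ω') ∂P) P := by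
  have := Measure.isProbabilityMeasure_map (μ := P) hX.aemeasurable
  have := Measure.isProbabilityMeasure_map (μ := P) hξ.aemeasurable
  have e := (indepFun_iff_map_prod_eq_prod_map_map hX.aemeasurable hξ.aemeasurable).1 h
  have hfi : Integrable f ((P.map X).prod (P.map ξ)) :=
    Integrable.of_bound hf.aestronglyMeasurable K (Eventually.of_forall hK)
  have e2 : ∀ y, ∫ x, f (x, y) ∂(P.map X) = ∫ ω, f (X ω, y) ∂P := fun y =>
    integral_map hX.aemeasurable (hf.comp measurable_prodMk_right).aestronglyMeasurable
  have hI := hfi.integral_prod_right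
  simp only [e2] at hI
  have hsm : AEStronglyMeasurable (fun y => ∫ ω, f (X ω, y) ∂P) (P.map ξ) := hI.aestronglyMeasurable
  constructor
  · rw [← integral_map (φ := fun ω => (X ω, ξ ω)) (hX.prodMk hξ).aemeasurable
      hf.aestronglyMeasurable, e, integral_prod_symm _ hfi]
    simp only [e2]
    exact integral_map hξ.aemeasurable hsm
  · exact hI.comp_measurable hξ

lemma smoothingError_mono {n p : ℕ} {lam K s L M a a' δ ε : ℝ} (hK : 0 ≤ K) (hM : 0 ≤ M)
    (hδ : 0 ≤ δ) (h : a ≤ a') :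
    smoothingError n p lam K s L M a δ ε ≤ smoothingError n p lam K s L M a' δ ε := by
  unfold smoothingError
  gcongr

lemma replacementError_mono {n p d : ℕ} {lam C K A0 s L M a a' : ℝ} (hK : 0 ≤ K) (hC : 0 ≤ C)
    (hA0 : 0 ≤ A0) (hL : 0 ≤ L) (h : a ≤ a') :
    replacementError n p d lam C K A0 s L M a ≤ replacementError n p d lam C K A0 s L M a' := by
  unfold replacementError
  gcongr

lemma smoothingError_nonneg {n p : ℕ} {lam K s L M a δ ε : ℝ} (hK : 0 ≤ K) (hM : 0 ≤ M) (hs : 0 ≤ s)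
    (hL : 0 ≤ L) (hlam : 0 ≤ lam) (ha : 0 ≤ a) (hδ : 0 ≤ δ) (hε : 0 ≤ ε) :
    0 ≤ smoothingError n p lam K s L M a δ ε := by
  have : 0 ≤ Real.log (2 * L / δ + 2) := Real.log_nonneg (by
    have : 0 ≤ 2 * L / δ := by positivity
    linarith)
  unfold smoothingError
  positivity

lemma replacementError_nonneg {n p d : ℕ} {lam C K A0 s L M a : ℝ} (hK : 0 ≤ K) (hC : 0 ≤ C)
    (hA0 : 0 ≤ A0) (hs : 0 ≤ s) (hL : 0 ≤ L) (ha : 0 ≤ a) :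
    0 ≤ replacementError n p d lam C K A0 s L M a := by
  unfold replacementError
  positivity

variable {Ω : Type*} [MeasurableSpace Ω] {P : Measure Ω} [IsProbabilityMeasure P] {n p k : ℕ}

open scoped Matrix

/-- For frozen noise the bounds increase with the average of `A1 + s |ξ_i|³`, so below the level `a`
they are at most their value at `a`; above it the trivial bound `2 K` is used. For this, `C` and `ε`
in `hsmooth` have to be uniform in the noise. -/
theorem abs_integral_minRisk_randomNoise_sub_le (hn : 1 ≤ n) {Sig : Matrix (Fin p) (Fin p) ℝ}
    {A0 s : ℝ} {c : Fin p → Fin k} {X G : Ω → Fin n → Fin p → ℝ}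
    (hX : BlockDesign P Sig A0 s c X) (hG : BlockDesign P Sig A0 s c G)
    {ξ : Ω → Fin n → ℝ} (hξ : Measurable ξ) (hXξ : IndepFun X ξ P) (hGξ : IndepFun G ξ P)
    {M : ℝ} (hM : 0 ≤ M) (hq : ∀ w : Fin p → ℝ, w ⬝ᵥ Sig *ᵥ w ≤ M * (w ⬝ᵥ w)) {d : ℕ}
    (hd : ∀ b, (Finset.univ.filter (fun j => c j = b)).card ≤ d)
    {ell0 : ℝ → ℝ} {A1 : ℝ} (hell : SmoothableLoss ell0 A1 s)
    {C ε lam K L δ a : ℝ} (hA0 : 0 ≤ A0) (hC : 0 ≤ C) (hlam : 1 ≤ lam) (hK : 0 ≤ K)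
    (hL : 0 ≤ L) (hδ : 0 < δ) (hε : 0 ≤ ε) (ha : 0 ≤ a)
    (hsmooth : ∀ ξ : Fin n → ℝ, ∃ (ℓ : Fin n → ℕ → ℝ → ℝ) (D : Fin n → ℝ → ℝ),
      SmoothLosses ℓ D C s (fun i => A1 + s * |ξ i| ^ 3) ∧
      ∀ i z, |ℓ i 0 z - noisyLoss ell0 ξ i z| ≤ ε)
    {g : ℕ → ℝ → ℝ} (hg : ∀ k < 3, ∀ x, HasDerivAt (g k) (g (k + 1) x) x)
    (hgK : ∀ k ≤ 3, ∀ x, |g k x| ≤ K) {R : (Fin p → ℝ) → ℝ} {S : Set (Fin p → ℝ)}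
    (hSne : S.Nonempty) (hRS : BddBelow (R '' S)) (hS : ∀ w ∈ S, ∀ j, w j ∈ Set.Icc (-L) L) :
    |∫ ω, g 0 (minRisk (noisyLoss ell0 (ξ ω)) R S (X ω)) ∂P
      - ∫ ω, g 0 (minRisk (noisyLoss ell0 (ξ ω)) R S (G ω)) ∂P|
      ≤ 2 * smoothingError n p lam K s L M a δ ε + replacementError n p d lam C K A0 s L M a
        + 2 * K * P.real {ω | a < Av fun i => A1 + s * |ξ ω i| ^ 3} := by
  have hs := hell.s_nonneg
  have hA : ∀ (e : Fin n → ℝ) i, 0 ≤ A1 + s * |e i| ^ 3 := fun e i =>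
    add_nonneg hell.A1_nonneg (mul_nonneg hs (by positivity))
  have hgm : Measurable (g 0) :=
    (continuous_iff_continuousAt.2 fun x => (hg 0 (by norm_num) x).continuousAt).measurable
  obtain ⟨f, hf, hfK, hfe⟩ : ∃ f : (Fin n → Fin p → ℝ) × (Fin n → ℝ) → ℝ, Measurable f ∧
      (∀ z, |f z| ≤ K) ∧ ∀ x e, g 0 (minRisk (noisyLoss ell0 e) R S x) = f (x, e) :=
    ⟨fun z => g 0 (minRisk (noisyLoss ell0 z.2) R S z.1),
      hgm.comp (measurable_minRisk hell.continuous hell.nonneg hSne hRS),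
      fun z => hgK 0 (by norm_num) _, fun x e => rfl⟩
  set err := 2 * smoothingError n p lam K s L M a δ ε + replacementError n p d lam C K A0 s L M a
    with herr
  have herr0 : 0 ≤ err := add_nonneg (mul_nonneg zero_le_two
    (smoothingError_nonneg hK hM hs hL (by linarith) ha hδ.le hε))
    (replacementError_nonneg hK hC hA0 hs hL ha)
  set bad : Set Ω := {ω | a < Av fun i => A1 + s * |ξ ω i| ^ 3} with hbad
  have hbadm : MeasurableSet bad := by
    refine measurableSet_lt measurable_const ?_
    unfold Av
    fun_prop
  simp only [hfe]
  obtain ⟨eX, iX⟩ := integral_eq_integral_integral_of_indepFun hX.measurable hξ hXξ hf hfK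
  obtain ⟨eG, iG⟩ := integral_eq_integral_integral_of_indepFun hG.measurable hξ hGξ hf hfK
  rw [eX, eG, ← integral_sub iX iG]
  have hpt : ∀ ω', |∫ ω, f (X ω, ξ ω') ∂P - ∫ ω, f (G ω, ξ ω') ∂P|
      ≤ err + bad.indicator (fun _ => 2 * K) ω' := by
    intro ω'
    by_cases hω : ω' ∈ bad
    · rw [Set.indicator_of_mem hω]
      have hb : ∀ Y : Ω → Fin n → Fin p → ℝ, |∫ ω, f (Y ω, ξ ω') ∂P| ≤ K := fun Y => by
        have := norm_integral_le_of_norm_le_const (μ := P) (f := fun ω => f (Y ω, ξ ω')) (C := K)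
          (Eventually.of_forall fun ω => hfK _)
        simpa using this
      have h1 := abs_sub (∫ ω, f (X ω, ξ ω') ∂P) (∫ ω, f (G ω, ξ ω') ∂P)
      linarith [hb X, hb G]
    · rw [Set.indicator_of_notMem hω, add_zero]
      have hle : Av (fun i => A1 + s * |ξ ω' i| ^ 3) ≤ a := not_lt.1 hω
      obtain ⟨ℓ, D, hℓ, hℓε⟩ := hsmooth (ξ ω')
      have h1 := abs_integral_minRisk_sub_le hn hX hG hM hq hd hell.continuous hell.nonneg (ξ ω')
        (hA (ξ ω')) hA0 hs hC hlam hK hL hδ hℓ hℓε (hell.modulus (ξ ω')) hg hgK hSne hRS hS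
      simp only [hfe] at h1
      refine h1.trans (add_le_add (mul_le_mul_of_nonneg_left ?_ zero_le_two) ?_)
      · exact smoothingError_mono hK hM hδ.le hle
      · exact replacementError_mono hK hC hA0 hL hle
  have hfin : Integrable (fun ω' => err + bad.indicator (fun _ => 2 * K) ω') P :=
    (integrable_const _).add ((integrable_const _).indicator hbadm)
  refine (abs_integral_le_integral_abs.trans (integral_mono (iX.sub iG).abs hfin hpt)).trans ?_
  rw [integral_add (integrable_const _) ((integrable_const _).indicator hbadm), integral_const,
    integral_indicator_const _ hbadm]
  simp only [probReal_univ, smul_eq_mul]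
  linarith

end RandomNoise

/-! ### Asymptotics of the error bounds -/

section Asymptotic

lemma tendsto_log_natCast : Tendsto (fun n : ℕ => Real.log n) atTop atTop :=
  Real.tendsto_log_atTop.comp tendsto_natCast_atTop_atTop

/-- The mesh `n⁻³` beats `p² L`, because `L = o(n)`. The entropy is at most `5 T n log n`, against
an inverse temperature `n log² n`; this is where a power of the logarithm above the first is needed
in `lam`. Only the smoothing error survives. -/
lemma tendsto_smoothingError {p : ℕ → ℕ} {L : ℕ → ℝ} {T K s M a ε : ℝ} (hT : 0 ≤ T)
    (hs : 0 ≤ s) (hM : 0 ≤ M) (ha : 0 ≤ a) (hp : ∀ n : ℕ, 1 ≤ n → (p n : ℝ) ≤ T * n)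
    (hL1 : ∀ n, 1 ≤ L n) (hL : L =o[atTop] fun n : ℕ => (n : ℝ)) :
    Tendsto (fun n : ℕ => smoothingError n (p n) (Real.log n ^ 2) K s (L n) M a ((n : ℝ) ^ 3)⁻¹ ε)
      atTop (𝓝 (K * ε)) := by
  have hinv : Tendsto (fun n : ℕ => ((n : ℝ))⁻¹) atTop (𝓝 0) :=
    tendsto_inv_atTop_zero.comp tendsto_natCast_atTop_atTop
  have hLn : Tendsto (fun n : ℕ => L n / n) atTop (𝓝 0) := hL.tendsto_div_nhds_zero
  have hlog : Tendsto (fun n : ℕ => (Real.log n)⁻¹) atTop (𝓝 0) :=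
    tendsto_inv_atTop_zero.comp tendsto_log_natCast
  have t1 : Tendsto (fun n : ℕ => ((n : ℝ) ^ 3)⁻¹ * (a * (1 + (p n : ℝ) ^ 2 * M)
      + 2 * s * L n * ((p n : ℝ) ^ 2 * M))) atTop (𝓝 0) := by
    have hup : Tendsto (fun n : ℕ => a * (1 + T ^ 2 * M) * (n : ℝ)⁻¹ + 2 * s * (T ^ 2 * M) * (L n / n))
        atTop (𝓝 0) := by
      simpa using (hinv.const_mul (a * (1 + T ^ 2 * M))).add (hLn.const_mul (2 * s * (T ^ 2 * M)))
    refine squeeze_zero' (Eventually.of_forall fun n => ?_) ?_ hup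
    · have := (zero_lt_one.trans_le (hL1 n)).le
      positivity
    · filter_upwards [eventually_ge_atTop 1] with n hn
      have hnR : (1 : ℝ) ≤ n := by exact_mod_cast hn
      have hn0 : (0 : ℝ) < n := by linarith
      have hL0 := (zero_lt_one.trans_le (hL1 n)).le
      have hp2 : (p n : ℝ) ^ 2 ≤ T ^ 2 * n ^ 2 := by
        rw [← mul_pow]; exact pow_le_pow_left₀ (Nat.cast_nonneg _) (hp n hn) 2
      have h1 : (1 : ℝ) ≤ (n : ℝ) ^ 2 := one_le_pow₀ hnR
      calc _ ≤ ((n : ℝ) ^ 3)⁻¹ * (a * (n ^ 2 + (T ^ 2 * n ^ 2) * M)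
          + 2 * s * L n * ((T ^ 2 * n ^ 2) * M)) := by gcongr
        _ = _ := by field_simp
  have t2 : Tendsto (fun n : ℕ => p n * Real.log (2 * L n / ((n : ℝ) ^ 3)⁻¹ + 2)
      / (n * Real.log n ^ 2)) atTop (𝓝 0) := by
    have hup : Tendsto (fun n : ℕ => 5 * T * (Real.log n)⁻¹) atTop (𝓝 0) := by
      simpa using hlog.const_mul (5 * T)
    refine squeeze_zero' (Eventually.of_forall fun n => ?_) ?_ hup
    · have := (zero_lt_one.trans_le (hL1 n)).le
      have : 0 ≤ Real.log (2 * L n / ((n : ℝ) ^ 3)⁻¹ + 2) := Real.log_nonneg (by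
        have : 0 ≤ 2 * L n / ((n : ℝ) ^ 3)⁻¹ := by positivity
        linarith)
      positivity
    · filter_upwards [eventually_ge_atTop 4, hL.bound zero_lt_one,
        tendsto_log_natCast.eventually_ge_atTop 1] with n hn hLb hlog1
      have hnR : (4 : ℝ) ≤ n := by exact_mod_cast hn
      have hn0 : (0 : ℝ) < n := by linarith
      have hL0 := zero_lt_one.trans_le (hL1 n)
      have hLb' : L n ≤ n := by simpa [abs_of_pos hL0] using hLb
      have h1 : 2 * L n / ((n : ℝ) ^ 3)⁻¹ + 2 ≤ (n : ℝ) ^ 5 := by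
        rw [div_inv_eq_mul]
        have h3 : (1 : ℝ) ≤ (n : ℝ) ^ 4 := one_le_pow₀ (by linarith)
        have h4 : L n * (n : ℝ) ^ 3 ≤ n * n ^ 3 := mul_le_mul_of_nonneg_right hLb' (by positivity)
        nlinarith
      have h2 : Real.log (2 * L n / ((n : ℝ) ^ 3)⁻¹ + 2) ≤ 5 * Real.log n := by
        refine (Real.log_le_log (by positivity) h1).trans_eq ?_
        rw [Real.log_pow]; norm_num
      rw [div_le_iff₀ (by positivity)]
      calc _ ≤ (T * n) * (5 * Real.log n) := mul_le_mul (hp n (by omega)) h2 (Real.log_nonneg (by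
            have : 0 ≤ 2 * L n / ((n : ℝ) ^ 3)⁻¹ := by positivity
            linarith)) (by positivity)
        _ = _ := by field_simp
  have := ((t1.add_const ε).add t2).const_mul K
  simpa [smoothingError] using this

/-- Under `d ^ 4 ≤ n` the higher powers of `d` are absorbed: `d³ p / n²` stays bounded in the fourth
moment of a row, and `d⁶ p n^(-7/2)` is at most of order `d² / √n`. Both terms then have the same
power of `d`, and `L³` versus `L⁷` is the only difference. -/
lemma replacementError_le {n p d : ℕ} {T lam C K A0 s L M a : ℝ} (hn : 1 ≤ n) (hp : (p : ℝ) ≤ T * n)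
    (hT : 0 ≤ T) (hd : d ^ 4 ≤ n) (hC : 0 ≤ C) (hK : 0 ≤ K) (hA0 : 0 ≤ A0) (hs : 0 ≤ s) (hL : 0 ≤ L)
    (ha : 0 ≤ a) :
    replacementError n p d lam C K A0 s L M a ≤ 23 * K * (1 + C) * (A0 * T) *
      (2 * (1 + a) * (lam ^ 2 * L ^ 3 * d ^ 2 / √n)
        + 16 * s * (A0 * T + 3 * (M * T) ^ 2 + 1) * (lam ^ 2 * L ^ 7 * d ^ 2 / √n)) := by
  have hnR : (1 : ℝ) ≤ n := by exact_mod_cast hn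
  set r := √(n : ℝ) with hr
  have hr1 : 1 ≤ r := Real.one_le_sqrt.2 hnR
  have hr0 : 0 < r := by linarith
  have hrn : (n : ℝ) = r ^ 2 := (Real.sq_sqrt (by linarith)).symm
  have hd4 : (d : ℝ) ^ 4 ≤ r ^ 2 := by rw [← hrn]; exact_mod_cast hd
  have hd3 : (d : ℝ) ^ 3 ≤ r ^ 2 := by
    rw [← hrn]
    have : d ^ 3 ≤ d ^ 4 := by
      rcases Nat.eq_zero_or_pos d with h | h
      · simp [h]
      · exact Nat.pow_le_pow_right h (by norm_num)
    exact_mod_cast this.trans hd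
  rw [hrn] at hp
  have b3 : (p : ℝ) * (A0 / r ^ 3) ≤ A0 * T / r := by
    calc _ ≤ (T * r ^ 2) * (A0 / r ^ 3) := mul_le_mul_of_nonneg_right hp (by positivity)
      _ = _ := by field_simp
  have b4 : (d : ℝ) ^ 3 * (p * (A0 / r ^ 4)) ≤ A0 * T := by
    calc _ ≤ r ^ 2 * ((T * r ^ 2) * (A0 / r ^ 4)) := by gcongr
      _ = _ := by field_simp
  have b2 : (M * (p * L ^ 2) / n) ^ 2 ≤ (M * T) ^ 2 * L ^ 4 := by
    have e : (M * (p * L ^ 2) / n) ^ 2 = M ^ 2 * L ^ 4 * (p / n) ^ 2 := by ring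
    have h : (p : ℝ) / n ≤ T := by rw [div_le_iff₀ (by linarith), hrn]; exact hp
    have h2 : ((p : ℝ) / n) ^ 2 ≤ T ^ 2 := pow_le_pow_left₀ (by positivity) h 2
    rw [e]
    calc _ ≤ M ^ 2 * L ^ 4 * T ^ 2 := mul_le_mul_of_nonneg_left h2 (by positivity)
      _ = _ := by ring
  have b7 : (d : ℝ) ^ 6 * (p * (A0 / r ^ 7)) ≤ d ^ 2 * (A0 * T / r) := by
    calc (d : ℝ) ^ 6 * (p * (A0 / r ^ 7)) = d ^ 2 * (d ^ 4 * (p * (A0 / r ^ 7))) := by ring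
      _ ≤ d ^ 2 * (r ^ 4 * ((T * r ^ 2) * (A0 / r ^ 7))) := by
        have : (d : ℝ) ^ 4 ≤ r ^ 4 := hd4.trans (pow_le_pow_right₀ hr1 (by norm_num))
        gcongr
      _ = _ := by field_simp
  unfold replacementError
  rw [← hr]
  have hZ : L ^ 4 * d ^ 3 * (p * (A0 / r ^ 4)) + 3 * (M * (p * L ^ 2) / n) ^ 2
      ≤ L ^ 4 * (A0 * T + 3 * (M * T) ^ 2) := by
    have := mul_le_mul_of_nonneg_left b4 (by positivity : 0 ≤ L ^ 4)
    nlinarith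
  calc _ ≤ 23 * K * (1 + C) * lam ^ 2 * (2 * (L ^ 3 * d ^ 2 * (A0 * T / r)) *
      (1 + a + 8 * s * (L ^ 4 * (A0 * T + 3 * (M * T) ^ 2)))
    + 16 * s * (L ^ 7 * (d ^ 2 * (A0 * T / r)))) := by
        rw [mul_assoc (L ^ 7)]
        gcongr
    _ = _ := by
        field_simp
        ring

/-- The exponents of `n` and `log n` in the growth condition on `d` balance those of `L`. -/
lemma growth_balance {Q α κ N ℓ : ℝ} {m : ℕ} (hN : 1 ≤ N) (hℓ : 1 ≤ ℓ) (hα : 0 ≤ α) (hκ : 0 ≤ κ)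
    (hm : (m : ℝ) ≤ Q + 3) :
    ℓ ^ 4 * (N ^ α * ℓ ^ κ) ^ m * (N ^ (1 / 4 - (Q + 3) * α / 2) / ℓ ^ (6 + (2 * Q + 6) * κ)) ^ 2 / √N
      ≤ 1 := by
  have hN0 : 0 < N := by linarith
  have hℓ0 : 0 < ℓ := by linarith
  have e1 : (N ^ α) ^ m * (N ^ (1 / 4 - (Q + 3) * α / 2)) ^ 2 ≤ √N := by
    rw [← Real.rpow_mul_natCast hN0.le, ← Real.rpow_mul_natCast hN0.le, ← Real.rpow_add hN0,
      Real.sqrt_eq_rpow]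
    refine Real.rpow_le_rpow_of_exponent_le hN ?_
    push_cast
    nlinarith [mul_le_mul_of_nonneg_right hm hα]
  have e2 : ℓ ^ 4 * (ℓ ^ κ) ^ m ≤ (ℓ ^ (6 + (2 * Q + 6) * κ)) ^ 2 := by
    rw [← Real.rpow_mul_natCast hℓ0.le, ← Real.rpow_mul_natCast hℓ0.le, ← Real.rpow_natCast ℓ 4,
      ← Real.rpow_add hℓ0]
    refine Real.rpow_le_rpow_of_exponent_le hℓ ?_
    push_cast
    have hm0 : (0 : ℝ) ≤ m := Nat.cast_nonneg m
    nlinarith [mul_le_mul_of_nonneg_right hm hκ, mul_nonneg (hm0.trans hm) hκ]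
  rw [div_le_one (by positivity), mul_pow, div_pow]
  calc _ = ((N ^ α) ^ m * (N ^ (1 / 4 - (Q + 3) * α / 2)) ^ 2) *
        ((ℓ ^ 4 * (ℓ ^ κ) ^ m) / (ℓ ^ (6 + (2 * Q + 6) * κ)) ^ 2) := by ring
    _ ≤ √N * 1 := by
      refine mul_le_mul e1 ((div_le_one (by positivity)).2 e2) (by positivity) (by positivity)
    _ = _ := mul_one _

variable {Q α κ : ℝ} {L : ℕ → ℝ} {d : ℕ → ℕ}

lemma tendsto_log_pow_mul_div_sqrt (hα : 0 ≤ α) (hκ : 0 ≤ κ)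
    (hL : L =O[atTop] fun n : ℕ => (n : ℝ) ^ α * Real.log n ^ κ)
    (hd : (fun n : ℕ => (d n : ℝ)) =o[atTop] fun n : ℕ =>
      (n : ℝ) ^ (1 / 4 - (Q + 3) * α / 2) / Real.log n ^ (6 + (2 * Q + 6) * κ))
    {m : ℕ} (hm : (m : ℝ) ≤ Q + 3) :
    Tendsto (fun n : ℕ => (Real.log n ^ 2) ^ 2 * L n ^ m * d n ^ 2 / √n) atTop (𝓝 0) := by
  have h1 := ((((isBigO_refl (fun n : ℕ => Real.log n ^ 4) atTop).mul (hL.pow m)).mul_isLittleO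
    (hd.pow (n := 2) (by norm_num))).mul_isBigO
      (isBigO_refl (fun n : ℕ => (√(n : ℝ))⁻¹) atTop))
  have h2 : (fun n : ℕ => Real.log n ^ 4 * ((n : ℝ) ^ α * Real.log n ^ κ) ^ m *
      ((n : ℝ) ^ (1 / 4 - (Q + 3) * α / 2) / Real.log n ^ (6 + (2 * Q + 6) * κ)) ^ 2 * (√(n : ℝ))⁻¹)
      =O[atTop] fun _ : ℕ => (1 : ℝ) := by
    refine IsBigO.of_bound 1 ?_
    filter_upwards [eventually_ge_atTop 1, tendsto_log_natCast.eventually_ge_atTop 1] with n hn hl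
    have hnR : (1 : ℝ) ≤ n := by exact_mod_cast hn
    have h := growth_balance (Q := Q) hnR hl hα hκ hm
    rw [Real.norm_of_nonneg (by positivity), ← div_eq_mul_inv]
    simpa using h
  have h3 := (isLittleO_one_iff ℝ).1 (h1.trans_isBigO h2)
  refine h3.congr fun n => ?_
  rw [div_eq_mul_inv]
  ring

lemma isLittleO_natCast_of_growth (hα1 : α < 1)
    (hL : L =O[atTop] fun n : ℕ => (n : ℝ) ^ α * Real.log n ^ κ) :
    L =o[atTop] fun n : ℕ => (n : ℝ) := by
  refine hL.trans_isLittleO ?_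
  have h := (isLittleO_log_rpow_rpow_atTop κ (sub_pos.2 hα1)).comp_tendsto
    (tendsto_natCast_atTop_atTop (R := ℝ))
  have h2 := (isBigO_refl (fun n : ℕ => (n : ℝ) ^ α) atTop).mul_isLittleO h
  refine h2.congr' (Eventually.of_forall fun n => rfl) ?_
  filter_upwards [eventually_ge_atTop 1] with n hn
  have hn0 : (0 : ℝ) < n := by exact_mod_cast hn
  simp only [Function.comp]
  rw [← Real.rpow_add hn0]
  simp

lemma eventually_pow_four_le (hQ : 0 ≤ Q) (hα : 0 ≤ α) (hκ : 0 ≤ κ)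
    (hd : (fun n : ℕ => (d n : ℝ)) =o[atTop] fun n : ℕ =>
      (n : ℝ) ^ (1 / 4 - (Q + 3) * α / 2) / Real.log n ^ (6 + (2 * Q + 6) * κ)) :
    ∀ᶠ n in atTop, d n ^ 4 ≤ n := by
  filter_upwards [hd.bound zero_lt_one, eventually_ge_atTop 1,
    tendsto_log_natCast.eventually_ge_atTop 1] with n h hn hl
  have hnR : (1 : ℝ) ≤ n := by exact_mod_cast hn
  have hn0 : (0 : ℝ) < n := by linarith
  rw [one_mul, Real.norm_of_nonneg (Nat.cast_nonneg _), Real.norm_of_nonneg (by positivity)] at h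
  have h1 : (d n : ℝ) ≤ (n : ℝ) ^ (1 / 4 : ℝ) := h.trans
    ((div_le_self (by positivity) (Real.one_le_rpow hl (by positivity))).trans
      (Real.rpow_le_rpow_of_exponent_le hnR (by
        have : 0 ≤ (Q + 3) * α / 2 := by positivity
        linarith)))
  have h2 : (d n : ℝ) ^ 4 ≤ n := by
    refine (pow_le_pow_left₀ (Nat.cast_nonneg _) h1 4).trans_eq ?_
    rw [← Real.rpow_mul_natCast hn0.le]
    norm_num
  exact_mod_cast h2

/-- The power `3` of `L` is always covered by `Q + 3`; the power `7` occurs only for `s ≠ 0`, where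
`Q ≥ 4`. -/
lemma tendsto_replacementError {p : ℕ → ℕ} {T C K A0 s M a : ℝ}
    (hp : ∀ n : ℕ, 1 ≤ n → (p n : ℝ) ≤ T * n) (hT : 0 ≤ T) (hC : 0 ≤ C) (hK : 0 ≤ K)
    (hA0 : 0 ≤ A0) (hs : 0 ≤ s) (ha : 0 ≤ a) (hL1 : ∀ n, 1 ≤ L n) (hQ : 0 ≤ Q)
    (hQs : s ≠ 0 → 4 ≤ Q) (hα : 0 ≤ α) (hκ : 0 ≤ κ)
    (hL : L =O[atTop] fun n : ℕ => (n : ℝ) ^ α * Real.log n ^ κ)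
    (hd : (fun n : ℕ => (d n : ℝ)) =o[atTop] fun n : ℕ =>
      (n : ℝ) ^ (1 / 4 - (Q + 3) * α / 2) / Real.log n ^ (6 + (2 * Q + 6) * κ)) :
    Tendsto (fun n : ℕ => replacementError n (p n) (d n) (Real.log n ^ 2) C K A0 s (L n) M a) atTop
      (𝓝 0) := by
  have t3 := tendsto_log_pow_mul_div_sqrt hα hκ hL hd (m := 3) (by push_cast; linarith)
  have t7 : Tendsto (fun n : ℕ => 16 * s * (A0 * T + 3 * (M * T) ^ 2 + 1) *
      ((Real.log n ^ 2) ^ 2 * L n ^ 7 * d n ^ 2 / √n)) atTop (𝓝 0) := by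
    rcases eq_or_ne s 0 with rfl | hs0
    · simp
    · simpa using (tendsto_log_pow_mul_div_sqrt hα hκ hL hd (m := 7)
        (by push_cast; linarith [hQs hs0])).const_mul (16 * s * (A0 * T + 3 * (M * T) ^ 2 + 1))
  have hup := ((t3.const_mul (2 * (1 + a))).add t7).const_mul (23 * K * (1 + C) * (A0 * T))
  simp only [mul_zero, add_zero] at hup
  refine squeeze_zero' (Eventually.of_forall fun n => replacementError_nonneg hK hC hA0 hs
    (zero_le_one.trans (hL1 n)) ha) ?_ hup
  filter_upwards [eventually_ge_atTop 1, eventually_pow_four_le hQ hα hκ hd] with n hn hd4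
  exact replacementError_le hn (hp n hn) hT hd4 hC hK hA0 hs (zero_le_one.trans (hL1 n)) ha

end Asymptotic

/-! ### The main theorem -/

theorem corollary1
    -- probability spaces and dimensions, indexed by the sample size `n`
    {Ω : ℕ → Type*} [∀ n, MeasurableSpace (Ω n)]
    (P : ∀ n, Measure (Ω n)) [∀ n, IsProbabilityMeasure (P n)]
    (p : ℕ → ℕ) (τ : ℝ) (hτ : τ ∈ Set.Ioo (0 : ℝ) 1)
    (hreg : ∀ n : ℕ, 1 ≤ n → τ ≤ (p n : ℝ) / n ∧ (p n : ℝ) / n ≤ 1 / τ)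
    -- the loss, the noise, and the regularity assumption on the losses
    (ell0 : ℝ → ℝ) (hell : IsExampleLoss ell0)
    (ξ : ∀ n, Ω n → Fin n → ℝ) (hξ : ∀ n, Measurable (ξ n))
    (q : Fin 4 → ℝ) (Lc : ∀ n, Ω n → Fin n → ℝ)
    (ρbar : ℝ) (Dℓ Mℓ : Set.Ioo (0 : ℝ) ρbar → ℝ)
    (hloss : ∀ n ω, LossAssumption (noisyLoss ell0 (ξ n ω)) q (Lc n ω) ρbar Dℓ Mℓ)
    (hqbar : qBar q ≤ 6)
    (hAv : ∀ ε : ℝ, 0 < ε → ∃ C : ℝ, ∀ᶠ n in atTop,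
      P n {ω | C < Av (fun i => Lc n ω i ^ qBold q)} ≤ ENNReal.ofReal ε)
    -- the convex regularizer
    (R : ∀ n, (Fin (p n) → ℝ) → ℝ) (hR : ∀ n, ConvexOn ℝ Set.univ (R n))
    -- the covariates and their Gaussian analogue, both independent of the noise
    (Sig : ∀ n, Matrix (Fin (p n)) (Fin (p n)) ℝ) (hSig : ∀ n, (Sig n).PosDef)
    (X G : ∀ n, Ω n → Fin n → Fin (p n) → ℝ)
    (hX : ∀ n, IsCovariateDesign (P n) (Sig n) (X n))
    (hG : ∀ n, IsGaussianDesign (P n) (Sig n) (G n))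
    (hXξ : ∀ n, IndepFun (X n) (ξ n) (P n))
    (hGξ : ∀ n, IndepFun (G n) (ξ n) (P n))
    (M : ℝ)
    (hmom : ∀ (n : ℕ) (i : Fin n) (j : Fin (p n)),
      eLpNorm (fun ω => √(n : ℝ) * X n ω i j) (qStar q : ℝ≥0∞) (P n) ≤ ENNReal.ofReal M)
    (heig : ∀ (n : ℕ) (j : Fin (p n)), (hSig n).isHermitian.eigenvalues j ≤ M)
    -- block dependence and the growth conditions on `L_n` and `d`
    (d : ℕ → ℕ) (hblock : ∀ n, BlockDependent (P n) (d n) (X n))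
    (α κ : ℝ) (hα : α ∈ Set.Icc (0 : ℝ) (1 / (2 * (qBar q : ℝ) + 6))) (hκ : 0 ≤ κ)
    (L : ℕ → ℝ) (hL1 : ∀ n, 1 ≤ L n)
    (hL : L =O[atTop] fun n : ℕ => (n : ℝ) ^ α * Real.log n ^ κ)
    (hd : (fun n : ℕ => (d n : ℝ)) =o[atTop] fun n : ℕ =>
      (n : ℝ) ^ (1 / 4 - ((qBar q : ℝ) + 3) * α / 2)
        / Real.log n ^ (6 + (2 * (qBar q : ℝ) + 6) * κ))
    -- the constraint sets and the test function
    (S : ∀ n, Set (Fin (p n) → ℝ)) (hSne : ∀ n, (S n).Nonempty)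
    (hS : ∀ n, ∀ w ∈ S n, ∀ j, w j ∈ Set.Icc (-L n) (L n))
    (g : ℝ → ℝ) (hg : ContDiff ℝ 3 g)
    (hgb : ∃ K : ℝ, ∀ k : ℕ, k ≤ 3 → ∀ x, |iteratedDeriv k g x| ≤ K) :
    (∀ n,
      Integrable
        (fun ω => g (minRisk (noisyLoss ell0 (ξ n ω)) (R n) (S n) (X n ω))) (P n) ∧
      Integrable
        (fun ω => g (minRisk (noisyLoss ell0 (ξ n ω)) (R n) (S n) (G n ω))) (P n)) ∧
    Tendsto (fun n : ℕ =>
      |(∫ ω, g (minRisk (noisyLoss ell0 (ξ n ω)) (R n) (S n) (X n ω)) ∂(P n))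
        - ∫ ω, g (minRisk (noisyLoss ell0 (ξ n ω)) (R n) (S n) (G n ω)) ∂(P n)|)
      atTop (𝓝 0) := by
  obtain ⟨A1, s, hell', hsq⟩ := hell.smoothableLoss
  have hs := hell'.s_nonneg
  have hA1 := hell'.A1_nonneg
  obtain ⟨K0, hK0⟩ := hgb
  set K := max K0 0 with hKdef
  have hK : 0 ≤ K := le_max_right _ _
  have hgK : ∀ k ≤ 3, ∀ x, |iteratedDeriv k g x| ≤ K := fun k hk x =>
    (hK0 k hk x).trans (le_max_left _ _)
  have hgd : ∀ k < 3, ∀ x, HasDerivAt (iteratedDeriv k g) (iteratedDeriv (k + 1) g x) x := by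
    intro k hk x
    rw [iteratedDeriv_succ]
    exact (hg.differentiable_iteratedDeriv k (by exact_mod_cast hk) x).hasDerivAt
  have hg0 : iteratedDeriv 0 g = g := iteratedDeriv_zero
  have hRS : ∀ n, BddBelow (R n '' S n) := fun n => bddBelow_image_of_convexOn (hR n) (hS n)
  refine ⟨fun n => ?_, ?_⟩
  · have hint : ∀ Y : Ω n → Fin n → Fin (p n) → ℝ, Measurable Y → Integrable
        (fun ω => g (minRisk (noisyLoss ell0 (ξ n ω)) (R n) (S n) (Y ω))) (P n) := fun Y hY =>
      Integrable.of_bound (hg.continuous.measurable.comp (measurable_minRisk_comp hell'.continuous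
        hell'.nonneg (hSne n) (hRS n) hY (hξ n))).aestronglyMeasurable K
        (Eventually.of_forall fun ω => by
          have := hgK 0 (by norm_num) (minRisk (noisyLoss ell0 (ξ n ω)) (R n) (S n) (Y ω))
          rwa [hg0] at this)
    exact ⟨hint _ (hX n).measurable, hint _ (hG n).measurable⟩
  have hne : ∀ n, Nonempty (Ω n) := fun n => nonempty_of_isProbabilityMeasure (P n)
  have hqB : s ≠ 0 → 4 ≤ qBar q := fun hs0 => by
    -- The exponents `q` depend neither on `n` nor on the outcome, so one loss is enough; sample
    -- size `1` is the first that has one.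
    have h := hloss 1 (Classical.arbitrary _)
    rw [hsq hs0] at h
    exact h.four_le_qBar 0
  set M' := max M 0 with hM'
  have hM0 : 0 ≤ M' := le_max_right _ _
  have hquad := fun n => quadForm_le_of_eigenvalues_le (hSig n).isHermitian (M := M')
    fun j => (heig n j).trans (le_max_left _ _)
  have hA0 := momentConst_nonneg M'
  choose k hk c hcard hblk using hblock
  have hXB : ∀ n, BlockDesign (P n) (Sig n) (momentConst M') s (c n) (X n) := fun n =>
    ⟨(hX n).measurable, (hX n).indep, hblk n, fun i => (hX n).rowMoments
      ((by norm_num : 3 ≤ 4).trans (four_le_qStar q)) (fun hs0 => seven_le_qStar (hqB hs0)) i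
      fun j => (hmom n i j).trans (ENNReal.ofReal_le_ofReal (le_max_left _ _))⟩
  have hGB : ∀ n, BlockDesign (P n) (Sig n) (momentConst M') s (c n) (G n) := fun n =>
    ⟨(hG n).measurable, (hG n).indep, (hG n).iIndepFun_blocks (hSig n) (hX n) (c n) (hblk n),
      fun i => (hG n).rowMoments (hSig n) s (hquad n) i⟩
  have hτ0 : 0 < τ := hτ.1
  have hT : 0 ≤ 1 / τ := by positivity
  have hp : ∀ n : ℕ, 1 ≤ n → (p n : ℝ) ≤ 1 / τ * n := fun n hn =>
    (div_le_iff₀ (by exact_mod_cast hn)).1 (hreg n hn).2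
  have hQ0 : (0 : ℝ) ≤ qBar q := Nat.cast_nonneg _
  have hα1 : α < 1 := hα.2.trans_lt (by rw [div_lt_one (by positivity)]; linarith)
  refine tendsto_order.2 ⟨fun b hb => Eventually.of_forall fun n => hb.trans_le (abs_nonneg _),
    fun η hη => ?_⟩
  -- Smoothing costs `2 K ε` for the two designs together, the exceptional noise another `2 K ε`;
  -- the `+ 1` makes the total strictly less than `η` and admits `K = 0`.
  set ε := η / (4 * K + 1) with hε
  have hε0 : 0 < ε := by positivity
  have hεη : 2 * (K * ε) + 0 + 2 * K * ε < η := by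
    have : ε * (4 * K + 1) = η := div_mul_cancel₀ _ (by positivity)
    nlinarith
  obtain ⟨C, hC, hsmooth⟩ := hell'.smooth ε hε0
  obtain ⟨C0, hC0⟩ := hAv ε hε0
  set a := A1 + s * max C0 0 with ha
  have ha0 : 0 ≤ a := add_nonneg hA1 (mul_nonneg hs (le_max_right _ _))
  have hlim := (((tendsto_smoothingError (a := a) (ε := ε) (K := K) hT hs hM0 ha0 hp hL1
    (isLittleO_natCast_of_growth hα1 hL)).const_mul 2).add
    (tendsto_replacementError (C := C) (M := M') hp hT hC hK hA0 hs ha0 hL1 hQ0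
      (fun hs0 => by exact_mod_cast hqB hs0) hα.1 hκ hL hd)).add_const (2 * K * ε)
  filter_upwards [hlim.eventually (gt_mem_nhds hεη), hC0, eventually_ge_atTop 1,
    tendsto_log_natCast.eventually_ge_atTop 1] with n hn hbad hn1 hlog
  have hnR : (0 : ℝ) < n := by exact_mod_cast hn1
  have main := abs_integral_minRisk_randomNoise_sub_le hn1 (hXB n) (hGB n) (hξ n) (hXξ n) (hGξ n)
    hM0 (hquad n) (hcard n) hell' (C := C) (ε := ε) (lam := Real.log n ^ 2) (K := K) (L := L n)
    (δ := ((n : ℝ) ^ 3)⁻¹) (a := a) hA0 hC (one_le_pow₀ hlog) hK (zero_le_one.trans (hL1 n))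
    (by positivity) hε0.le ha0 hsmooth hgd hgK (hSne n) (hRS n) (hS n)
  rw [hg0] at main
  refine main.trans_lt (lt_of_le_of_lt ?_ hn)
  have hP : (P n).real {ω | a < Av fun i => A1 + s * |ξ n ω i| ^ 3} ≤ ε := by
    refine ENNReal.toReal_le_of_le_ofReal hε0.le ((measure_mono fun ω hω => ?_).trans hbad)
    simp only [Set.mem_ofPred_eq] at hω ⊢
    rw [Av_add, Av_const hn1, Av_mul, ha, add_lt_add_iff_left] at hω
    -- For `s = 0` the exceptional event is empty. Otherwise the loss is the squared one, and the
    -- cubed noise is controlled by the constants of the growth assumption.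
    have hs0 : s ≠ 0 := by
      rintro rfl
      simp at hω
    have h := hloss n ω
    rw [hsq hs0] at h
    exact ((le_max_left _ _).trans_lt
      (lt_of_mul_lt_mul_left hω hs)).trans_le (Av_mono fun i => h.abs_pow_three_le i)
  exact add_le_add_right (mul_le_mul_of_nonneg_left hP (by positivity)) _
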